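/- **Setting.** Let $r,k\in\mathbb Z$, $0\le k\le r$, $d\in\mathbb N$, $T>0$, and let $u$ solve $u'(t)=f(t,u(t))$, $u(t_0)=u_0\in\mathbb R^d$, on $[t_0,t_0+T]$, where $f$ is sufficiently smooth, i.e. of class $C^m$ on $[t_0,t_0+T]\times\mathbb R^d$ for some $m$ that depends only on $r,k$ and the numbers $k_{\mathscr I},k_{\mathcal I}\in\mathbb N_0$ below. Let $\widehat{\mathscr I}$ be a linear functional on $C^{k_{\mathscr I}}([-1,1])$ and let $\widehat{\mathcal I}$ be a linear operator on $C^{k_{\mathcal I}}([-1,1])$ such that, for all $l\in\mathbb N_0$, $\widehat{\mathcal I}v\in C^l([-1,1])$ whenever $v\in C^{\max\{k_{\mathcal I},l\}}([-1,1])$; both act componentwise on vector-valued functions. For a mesh $t_0<t_1<\dots<t_N=t_0+T$ put $I_n=(t_{n-1},t_n]$, $\tau_n=t_n-t_{n-1}$, $\tau=\max_n\tau_n$, $T_n(\hat t)=\frac{t_n+t_{n-1}}2+\frac{\tau_n}2\hat t$, $\mathscr I_n[\varphi]=\frac{\tau_n}2\widehat{\mathscr I}[\varphi\circ T_n]$ and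 $\mathcal I_n\psi=(\widehat{\mathcal I}(\psi\circ T_n))\circ T_n^{-1}$. $P_s$ denotes polynomials of degree at most $s$, $P_{-1}=\{0\}$. **Method.** The discrete solution $U$ satisfies $U(t_0^-)=u_0$ and, for $n=1,\dots,N$, $U|_{I_n}\in P_r(I_n,\mathbb R^d)$ with $U(t_{n-1}^+)=U(t_{n-1}^-)$ if $k\ge1$; $U^{(i+1)}(t_n^-)=\frac{d^i}{dt^i}f(t,U(t))|_{t=t_n^-}$ for $0\le i\le\lfloor\frac k2\rfloor-1$ if $k\ge 2$; $U^{(i+1)}(t_{n-1}^+)=\frac{d^i}{dt^i}f(t,U(t))|_{t=t_{n-1}^+}$ for $0\le i\le\lfloor\frac{k-1}2\rfloor-1$ if $k\ge 3$; and $$\mathscr I_n[(U',\varphi)]+\delta_{0,k}\big(U(t_{n-1}^+)-U(t_{n-1}^-),\varphi(t_{n-1}^+)\big)=\mathscr I_n[(\mathcal I_nf(\cdot,U(\cdot)),\varphi)]\quad\forall\varphi\in P_{r-k}(I_n,\mathbb R^d).$$ **Assumptions.** Let $k_{\mathcal J}=\max\{\lfloor\frac k2\rfloor-1,k_{\mathscr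 I},k_{\mathcal I}\}$, and let $\sup$ denote the supremum over $[-1,1]$. 1. If $\psi\in P_{r-\max\{1,k\}}$ and $\widehat{\mathscr I}\big[(1-\hat t)^{\lfloor k/2\rfloor}(1+\hat t)^{|\lfloor (k-1)/2\rfloor|}\psi\varphi\big]=0$ for all $\varphi\in P_{r-\max\{1,k\}}$, then $\psi=0$. 2. $\|\widehat{\mathscr I}[\varphi]\|\le\mathfrak C_0\sum_{j=0}^{k_{\mathscr I}}\sup\|\varphi^{(j)}\|$ for all $\varphi\in C^{k_{\mathscr I}}([-1,1],\mathbb R^d)$. 3. For $0\le l\le k_{\mathscr I}$: $\sup\|(\widehat{\mathcal I}\varphi)^{(l)}\|\le\mathfrak C_1\sum_{j=0}^{\max\{k_{\mathcal I},l\}}\sup\|\varphi^{(j)}\|$ for all $\varphi\in C^{\max\{k_{\mathcal I},l\}}([-1,1],\mathbb R^d)$. 4. For $0\le i\le k_{\mathcal J}$ and $v,w\in C^{k_{\mathcal J}}([t_0,t_0+T],\mathbb R^d)$, for a.e. $s\in[t_0,t_0+T]$: $\big\|\frac{d^i}{dt^i}\big(f(t,v(t))-f(t,w(t))\big)\big|_{t=s}\big\|\le\mathfrak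 C_2\sum_{l=0}^i\|(v-w)^{(l)}(s)\|$. 5. At least one of the following holds. (a) There are finitely many distinct points $\hat t_m\in[-1,1]$, orders $K_m\le k_{\mathcal I}$ and constants such that for $0\le l\le k_{\mathscr I}$ and $\varphi\in C^{k_{\mathcal I}}([-1,1],\mathbb R^d)$ one has $\widehat{\mathcal I}\varphi\in C^l$ and $\sup\|(\widehat{\mathcal I}\varphi)^{(l)}\|\le\mathfrak C_{1,1}\sum_m\sum_{j=0}^{K_m}\|\varphi^{(j)}(\hat t_m)\|+\mathfrak C_{1,2}\sup\|\varphi\|$. (b) There are finitely many distinct points $\hat s_m\in[-1,1]$ with orders $L_m\le k_{\mathscr I}$, finitely many distinct points $\hat t_m\in[-1,1]$ with orders $K_m\le\max\{k_{\mathscr I},k_{\mathcal I}\}$, and constants such that $\|\widehat{\mathscr I}[\varphi]\|\le\widetilde{\mathfrak C}_{0,1}\sum_m\sum_{j=0}^{L_m}\|\varphi^{(j)}(\hat s_m)\|+\widetilde{\mathfrak C}_{0,2}\sup\|\varphi\|$ for $\varphi\in C^{k_{\mathscr I}}([-1,1],\mathbb R^d)$, and $\sum_m\sum_{l=0}^{L_m}\|(\widehat{\mathcal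 I}\varphi)^{(l)}(\hat s_m)\|+\sup\|\widehat{\mathcal I}\varphi\|\le\widetilde{\mathfrak C}_{1,1}\sum_m\sum_{j=0}^{K_m}\|\varphi^{(j)}(\hat t_m)\|+\widetilde{\mathfrak C}_{1,2}\sup\|\varphi\|$ for $\varphi\in C^{\max\{k_{\mathscr I},k_{\mathcal I}\}}([-1,1],\mathbb R^d)$. **Approximation orders.** Let $r_{\mathrm{ex}}^{\mathscr I}$ and $r^{\mathscr I}_{\mathcal I,i}$ ($i\in\mathbb N_0$) in $\mathbb N_0\cup\{-1,\infty\}$ be the largest numbers with $\int_{-1}^1\varphi\,d\hat t=\widehat{\mathscr I}[\varphi]$ for all $\varphi\in P_{r_{\mathrm{ex}}^{\mathscr I}}$ and $\widehat{\mathscr I}[\varphi\psi]=\widehat{\mathscr I}[(\widehat{\mathcal I}\varphi)\psi]$ for all $\varphi\in P_{r^{\mathscr I}_{\mathcal I,i}}$, $\psi\in P_i$, respectively. Put $r_{\mathcal I}^{\mathscr I}=r^{\mathscr I}_{\mathcal I,r-k}$ and $r_{\mathrm{var}}=\min_{0\le i\le r-k}\{r^{\mathscr I}_{\mathcal I,i}+i\}$.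 **Claim.** If $r_{\mathcal I}^{\mathscr I}\ge r-2$, then there are constants $C>0$ and $\tau^*>0$, independent of the mesh, such that for every mesh with $\tau\le\tau^*$, every discrete solution $U$ and every $1\le n\le N$ $$\|(u-U)(t_n^-)\|\le C\Big(\tau^{\min\{2r-k+1,\;r_{\mathrm{var}}+1,\;\max\{r_{\mathrm{ex}}^{\mathscr I}+1,\,\min\{r,\,r_{\mathcal I}^{\mathscr I}+1\}\}\}}+\delta_{0,k}\,\tau^{2r_{\mathcal I}^{\mathscr I}+4}\Big),$$ where $\tau^\infty$ is read as $0$. Moreover, without the condition $r_{\mathcal I}^{\mathscr I}\ge r-2$ and for every mesh, $\|(u-U)(t_n^-)\|\le\sup_{t\in I_n}\|(u-U)(t)\|$ for every discrete solution $U$ and $1\le n\le N$. -/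

import Mathlib

open Set MeasureTheory Polynomial
open scoped ENNReal Topology

namespace VTD

/-- `ℝ^d` with the Euclidean norm and the standard inner product. -/
abbrev E (d : ℕ) := EuclideanSpace ℝ (Fin d)

/-- The closed reference interval `[-1, 1]`. -/
abbrev Jhat : Set ℝ := Icc (-1 : ℝ) 1

/-- A linear functional on `C^κ([-1,1])` (the reference integrator). Functions on `[-1,1]` are
represented by functions on `ℝ`; only the values on `[-1,1]` matter, and the value is meaningful
for functions that are `C^κ` on `[-1,1]`. -/
structure Integrator (κ : ℕ) where
  toFun : (ℝ → ℝ) → ℝ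
  congr_on : ∀ v w : ℝ → ℝ, EqOn v w Jhat → toFun v = toFun w
  map_add : ∀ v w : ℝ → ℝ, ContDiffOn ℝ κ v Jhat → ContDiffOn ℝ κ w Jhat →
    toFun (fun t => v t + w t) = toFun v + toFun w
  map_smul : ∀ (c : ℝ) (v : ℝ → ℝ), ContDiffOn ℝ κ v Jhat →
    toFun (fun t => c * v t) = c * toFun v

/-- A linear operator on `C^κ([-1,1])` with values in functions on `[-1,1]` (the reference
approximation operator), such that the image of `v` is at least as smooth as `v`. -/
structure ApproxOp (κ : ℕ) where
  toFun : (ℝ → ℝ) → (ℝ → ℝ)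
  congr_on : ∀ v w : ℝ → ℝ, EqOn v w Jhat → EqOn (toFun v) (toFun w) Jhat
  map_add : ∀ v w : ℝ → ℝ, ContDiffOn ℝ κ v Jhat → ContDiffOn ℝ κ w Jhat →
    EqOn (toFun (fun t => v t + w t)) (fun t => toFun v t + toFun w t) Jhat
  map_smul : ∀ (c : ℝ) (v : ℝ → ℝ), ContDiffOn ℝ κ v Jhat →
    EqOn (toFun (fun t => c * v t)) (fun t => c * toFun v t) Jhat
  smooth : ∀ (l : ℕ) (v : ℝ → ℝ), ContDiffOn ℝ (max κ l : ℕ) v Jhat →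
    ContDiffOn ℝ l (toFun v) Jhat

/-- Componentwise application of the integrator to a vector-valued function. -/
noncomputable def Integrator.vec {κ d : ℕ} (Q : Integrator κ) (v : ℝ → E d) : E d :=
  WithLp.toLp 2 (fun j => Q.toFun (fun t => v t j))

/-- Componentwise application of the approximation operator to a vector-valued function. -/
noncomputable def ApproxOp.vec {κ d : ℕ} (A : ApproxOp κ) (v : ℝ → E d) : ℝ → E d :=
  fun t => WithLp.toLp 2 (fun j => A.toFun (fun s => v s j) t)

/-- The affine map from `[-1,1]` onto `[a,b]`. -/
noncomputable def aff (a b : ℝ) (x : ℝ) : ℝ := (a + b) / 2 + (b - a) / 2 * x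

/-- The inverse of `aff a b`. -/
noncomputable def affInv (a b : ℝ) (t : ℝ) : ℝ := (2 * t - (a + b)) / (b - a)

/-- The local integrator on `[a,b]`. -/
noncomputable def Integrator.loc {κ : ℕ} (Q : Integrator κ) (a b : ℝ) (v : ℝ → ℝ) : ℝ :=
  (b - a) / 2 * Q.toFun (fun x => v (aff a b x))

/-- The local approximation operator on `[a,b]`. -/
noncomputable def ApproxOp.loc {κ d : ℕ} (A : ApproxOp κ) (a b : ℝ) (v : ℝ → E d) : ℝ → E d :=
  fun t => A.vec (fun x => v (aff a b x)) (affInv a b t)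

/-- Supremum of `‖v t‖` over the set `S`. -/
noncomputable def supOn {d : ℕ} (S : Set ℝ) (v : ℝ → E d) : ℝ := ⨆ t : S, ‖v t‖

/-- The `j`-th derivative on the closed reference interval. -/
noncomputable def dhat {d : ℕ} (j : ℕ) (v : ℝ → E d) : ℝ → E d :=
  iteratedDerivWithin j v Jhat

/-! ### Vector-valued polynomials -/

/-- The value at `t` of an `ℝ^d`-valued polynomial, given by its components. -/
noncomputable def pval {d : ℕ} (p : Fin d → ℝ[X]) (t : ℝ) : E d :=
  WithLp.toLp 2 (fun j => (p j).eval t)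

/-- The `i`-th derivative of an `ℝ^d`-valued polynomial. -/
noncomputable def pder {d : ℕ} (i : ℕ) (p : Fin d → ℝ[X]) : Fin d → ℝ[X] :=
  fun j => Polynomial.derivative^[i] (p j)

/-- Degree at most `s` in each component. -/
def PDegLE {d : ℕ} (s : ℕ) (p : Fin d → ℝ[X]) : Prop := ∀ j, p j ∈ degreeLE ℝ s

/-! ### The discrete problem -/

/-- A mesh `t₀ = node 0 < node 1 < ... < node N = t₀ + T`. -/
structure Mesh (t₀ T : ℝ) where
  N : ℕ
  node : ℕ → ℝ
  node_zero : node 0 = t₀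
  node_last : node N = t₀ + T
  node_lt : ∀ n < N, node n < node (n + 1)

/-- The maximal step length `τ`. -/
noncomputable def Mesh.size {t₀ T : ℝ} (M : Mesh t₀ T) : ℝ :=
  ⨆ n : Fin M.N, (M.node (n + 1) - M.node n)

/-- The local problem on `(a,b]` of the method with parameters `r, k`, for the incoming value
`Uin = U(a^-)`; the unknown is the polynomial `p = U|_{(a,b]}`. -/
structure SolvesLocal {κQ κA d : ℕ} (r k : ℕ) (Q : Integrator κQ) (A : ApproxOp κA)
    (f : ℝ → E d → E d) (a b : ℝ) (Uin : E d) (p : Fin d → ℝ[X]) : Prop where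
  deg : PDegLE r p
  init : 1 ≤ k → pval p a = Uin
  right : ∀ i < k / 2,
    pval (pder (i + 1) p) b = iteratedDerivWithin i (fun t => f t (pval p t)) (Icc a b) b
  left : ∀ i < (k - 1) / 2,
    pval (pder (i + 1) p) a = iteratedDerivWithin i (fun t => f t (pval p t)) (Icc a b) a
  var : ∀ φ : Fin d → ℝ[X], PDegLE (r - k) φ →
    Q.loc a b (fun t => inner ℝ (pval (pder 1 p) t) (pval φ t))
        + (if k = 0 then inner ℝ (pval p a - Uin) (pval φ a) else 0)
      = Q.loc a b (fun t => inner ℝ (A.loc a b (fun s => f s (pval p s)) t) (pval φ t))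

/-- The left-sided values `U(t_n^-)` of the piecewise polynomial that equals `U n` on
`(t_{n-1}, t_n]`, where `U(t_0^-) = u₀`. -/
noncomputable def nodeVal {d : ℕ} {t₀ T : ℝ} (M : Mesh t₀ T) (u₀ : E d) (U : ℕ → Fin d → ℝ[X])
    (n : ℕ) : E d :=
  if n = 0 then u₀ else pval (U n) (M.node n)

/-- `U` (with polynomial piece `U n` on `(t_{n-1}, t_n]`, `1 ≤ n ≤ N`) solves the discrete
problem with initial value `u₀`. -/
def IsDiscreteSolution {κQ κA d : ℕ} (r k : ℕ) (Q : Integrator κQ) (A : ApproxOp κA)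
    (f : ℝ → E d → E d) {t₀ T : ℝ} (M : Mesh t₀ T) (u₀ : E d) (U : ℕ → Fin d → ℝ[X]) : Prop :=
  ∀ n, 1 ≤ n → n ≤ M.N →
    SolvesLocal r k Q A f (M.node (n - 1)) (M.node n) (nodeVal M u₀ U (n - 1)) (U n)

/-- `u` solves `u' = f(t,u)`, `u(t₀) = u₀` on `[t₀, t₀ + T]`. -/
def SolvesIVP {d : ℕ} (f : ℝ → E d → E d) (t₀ T : ℝ) (u₀ : E d) (u : ℝ → E d) : Prop :=
  u t₀ = u₀ ∧ ∀ t ∈ Icc t₀ (t₀ + T), HasDerivWithinAt u (f t (u t)) (Icc t₀ (t₀ + T)) t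

/-! ### Assumptions on the data of the method -/

/-- Unique solvability: `ψ ∈ P_{r - max{1,k}}` and
`Q[(1-t)^{⌊k/2⌋} (1+t)^{|⌊(k-1)/2⌋|} ψ φ] = 0` for all `φ ∈ P_{r - max{1,k}}` imply `ψ = 0`.
Here `degreeLT ℝ m` is `P_{m-1}`. -/
def AssSolvable {κQ : ℕ} (r k : ℕ) (Q : Integrator κQ) : Prop :=
  ∀ ψ ∈ degreeLT ℝ (r + 1 - max 1 k),
    (∀ φ ∈ degreeLT ℝ (r + 1 - max 1 k),
      Q.toFun (fun t => (1 - t) ^ (k / 2) * (1 + t) ^ (((k : ℤ) - 1) / 2).natAbs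
        * ψ.eval t * φ.eval t) = 0) → ψ = 0

/-- Stability of the reference integrator on `C^κQ([-1,1], ℝ^d)`. -/
def AssStabQ {κQ : ℕ} (d : ℕ) (Q : Integrator κQ) : Prop :=
  ∃ C₀ : ℝ, ∀ v : ℝ → E d, ContDiffOn ℝ κQ v Jhat →
    ‖Q.vec v‖ ≤ C₀ * ∑ j ∈ Finset.range (κQ + 1), supOn Jhat (dhat j v)

/-- Stability of the reference approximation operator, for derivatives of order `0 ≤ l ≤ κQ`. -/
def AssStabA {κA : ℕ} (d κQ : ℕ) (A : ApproxOp κA) : Prop :=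
  ∃ C₁ : ℝ, ∀ l ≤ κQ, ∀ v : ℝ → E d, ContDiffOn ℝ (max κA l : ℕ) v Jhat →
    supOn Jhat (dhat l (A.vec v))
      ≤ C₁ * ∑ j ∈ Finset.range (max κA l + 1), supOn Jhat (dhat j v)

/-- `k_J = max{⌊k/2⌋ - 1, κQ, κA}`. -/
def kJ (k κQ κA : ℕ) : ℕ := max (k / 2 - 1) (max κQ κA)

/-- The Lipschitz-type condition on the total derivatives of `t ↦ f(t, v(t))`. -/
def AssLip {d : ℕ} (kJ : ℕ) (f : ℝ → E d → E d) (t₀ T : ℝ) : Prop :=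
  ∃ C₂ : ℝ, ∀ i ≤ kJ, ∀ v w : ℝ → E d,
    ContDiffOn ℝ kJ v (Icc t₀ (t₀ + T)) → ContDiffOn ℝ kJ w (Icc t₀ (t₀ + T)) →
    ∀ᵐ s ∂(volume.restrict (Icc t₀ (t₀ + T))),
      ‖iteratedDerivWithin i (fun t => f t (v t) - f t (w t)) (Icc t₀ (t₀ + T)) s‖
        ≤ C₂ * ∑ l ∈ Finset.range (i + 1),
            ‖iteratedDerivWithin l (fun t => v t - w t) (Icc t₀ (t₀ + T)) s‖

/-- `∑_{x ∈ S} ∑_{j ≤ ord x} ‖v^{(j)}(x)‖` for a finite set `S ⊆ [-1,1]` of points. -/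
noncomputable def ptSum {d : ℕ} (S : Finset ℝ) (ord : ℝ → ℕ) (v : ℝ → E d) : ℝ :=
  ∑ x ∈ S, ∑ j ∈ Finset.range (ord x + 1), ‖dhat j v x‖

/-- First variant of the point condition (on the reference interval; the local form with the
factors `(τ_n/2)^j` is its image under the affine transformation). The derivatives of `v` that
occur exist for `v ∈ C^κA`. -/
def AssPointA {κA : ℕ} (d κQ : ℕ) (A : ApproxOp κA) : Prop :=
  ∃ (S : Finset ℝ) (ord : ℝ → ℕ) (C C' : ℝ),
    (∀ x ∈ S, x ∈ Jhat ∧ ord x ≤ κA) ∧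
    ∀ l ≤ κQ, ∀ v : ℝ → E d, ContDiffOn ℝ κA v Jhat →
      ContDiffOn ℝ l (A.vec v) Jhat ∧
      supOn Jhat (dhat l (A.vec v)) ≤ C * ptSum S ord v + C' * supOn Jhat v

/-- Second variant of the point condition (on the reference interval). -/
def AssPointB {κQ κA : ℕ} (d : ℕ) (Q : Integrator κQ) (A : ApproxOp κA) : Prop :=
  ∃ (S : Finset ℝ) (ord : ℝ → ℕ) (C C' : ℝ),
    (∀ x ∈ S, x ∈ Jhat ∧ ord x ≤ κQ) ∧
    (∀ v : ℝ → E d, ContDiffOn ℝ κQ v Jhat →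
      ‖Q.vec v‖ ≤ C * ptSum S ord v + C' * supOn Jhat v) ∧
    ∃ (S' : Finset ℝ) (ord' : ℝ → ℕ) (D D' : ℝ),
      (∀ x ∈ S', x ∈ Jhat ∧ ord' x ≤ max κQ κA) ∧
      ∀ v : ℝ → E d, ContDiffOn ℝ (max κQ κA : ℕ) v Jhat →
        ptSum S ord (A.vec v) + supOn Jhat (A.vec v)
          ≤ D * ptSum S' ord' v + D' * supOn Jhat v

/-! ### Approximation orders

The orders `r_ex` and `r_i` take values in `{-1, 0, 1, ..., ∞}`; the following quantities are these
orders plus one, as elements of `ℕ∞`. `degreeLT ℝ m` is `P_{m-1}`, and it is `{0}` for `m = 0`.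
Affine transformations show that the orders of the local operators do not depend on the interval. -/

/-- `r_ex + 1`, where `r_ex` is the largest number such that the integrator is exact on
`P_{r_ex}`. -/
noncomputable def exSucc {κQ : ℕ} (Q : Integrator κQ) : ℕ∞ :=
  ⨆ (m : ℕ) (_ : ∀ φ ∈ degreeLT ℝ m,
    ∫ t in (-1 : ℝ)..1, φ.eval t = Q.toFun (fun t => φ.eval t)), (m : ℕ∞)

/-- `r_i + 1`, where `r_i` is the largest number such that `Q[φ ψ] = Q[(A φ) ψ]` for all
`φ ∈ P_{r_i}` and `ψ ∈ P_i`. -/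
noncomputable def ordSucc {κQ κA : ℕ} (Q : Integrator κQ) (A : ApproxOp κA) (i : ℕ) : ℕ∞ :=
  ⨆ (m : ℕ) (_ : ∀ φ ∈ degreeLT ℝ m, ∀ ψ ∈ degreeLE ℝ i,
    Q.toFun (fun t => φ.eval t * ψ.eval t)
      = Q.toFun (fun t => A.toFun (fun s => φ.eval s) t * ψ.eval t)), (m : ℕ∞)

/-- `r_var + 1`, where `r_var = min_{0 ≤ i ≤ r-k} (r_i + i)`. -/
noncomputable def varSucc {κQ κA : ℕ} (r k : ℕ) (Q : Integrator κQ) (A : ApproxOp κA) : ℕ∞ :=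
  (Finset.range (r - k + 1)).inf (fun i => ordSucc Q A i + (i : ℕ∞))

/-- `min{2r-k+1, r_var+1, max{r_ex+1, min{r, r_{r-k}+1}}}`. -/
noncomputable def superExp {κQ κA : ℕ} (r k : ℕ) (Q : Integrator κQ) (A : ApproxOp κA) : ℕ∞ :=
  min ((2 * r - k + 1 : ℕ) : ℕ∞)
    (min (varSucc r k Q A) (max (exSucc Q) (min (r : ℕ∞) (ordSucc Q A (r - k)))))

/-- `x ^ e` with `x ^ ∞ = 0` (used for small `x > 0`). -/
noncomputable def powTop (x : ℝ) (e : ℕ∞) : ℝ := if e = ⊤ then 0 else x ^ e.toNat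

end VTD

/-!
The nodal error is a sum of local errors, one for each mesh interval, and these are of higher
order because at the end point of an interval only weighted averages of the defect `U' - f(·,U)`
matter.

*Structure of the method.* After transformation to `[-1,1]`, the derivative of the discrete
solution solves, componentwise, a linear system for polynomials of degree less than `r`, in which
the pull-back of `f(·,U)` is the datum. The solvability assumption makes this system injective
(`VTD.eq_zero_of_data`), hence stable (`VTD.exists_system_stability`). Stability may be used
relative to any polynomial on which the approximation operator is exact when tested with
`P_{r-k}`.

*Bounds for the discrete solution.* Together with the Lipschitz condition, stability shows that
`U` grows by a factor `1 + O(h)` per step (`VTD.StabData.exists_apriori`), so all discrete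
solutions stay in one compact set. The derivatives of `U` are bounded by a bootstrap: bounds up to
order `s` give Taylor polynomials of `f(·,U)` of degree `s - 1`, exactness on these gives the
bounds of order `s + 1` (`VTD.StabData.exists_coeff_le_pow_min`). Reaching all orders up to `r`
requires exactness on `P_{r-2}`; this is where the condition on the order of the approximation
operator enters. The same argument bounds the defect and the jump by `O(h^{q+1})` on the reference
interval, with `q = min r o`, where `o - 1` is the largest degree on which the operator is exact
when tested with `P_{r-k}` (`VTD.StabData.exists_defect_bounds`).

*Local error.* Instead of the flow of the differential equation its Taylor polynomials in time are
used, which are explicit expressions in the total derivatives of `f` (`VTD.flowDeriv`,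
`VTD.flowPoly`). Along a curve they change only through the defect of the curve, up to a term of
high order, which gives a formula of variation-of-constants type (`VTD.exists_flowPoly_error`):
the error at the end point is the integral of the defect against a smooth weight. In that integral
the integral is replaced by the integrator, and the weight by its Taylor polynomial of degree
`r - k`, which is an admissible test function. What remains is the consistency error of the
approximation operator, tested with monomials (`VTD.abs_weighted_defect_le`). In the case `k = 0`
the linear effect of the jump is tested together with the defect, as in the method itself, while
the quadratic effect carries a factor `h`, because the flow is the identity up to `O(h)` in `C^2`
(`VTD.exists_flowPoly_taylor`); this is the origin of the additional term.

*Conclusion.* One step thus increases the error by at most `O(h)` times the old error plus `h`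
times the asserted bound (`VTD.StabData.exists_step_error`), and the discrete Gronwall inequality
(`VTD.Mesh.le_exp_mul`) sums this up. The bound by the supremum over a mesh interval holds because
the node belongs to that interval (`VTD.norm_sub_nodeVal_le_supOn`).
-/

namespace VTD

/-! ### Functions on the reference interval with scaled derivative bounds -/

lemma uniqueDiffOn_Jhat : UniqueDiffOn ℝ Jhat := uniqueDiffOn_Icc (by norm_num)

/-- `v` is `C^N` on `[-1,1]` with `‖v^{(j)}‖ ≤ B h^j` for `j ≤ N`. This is the bound for the pull-back
to `[-1,1]` of a function with bounded derivatives on an interval of length `h`; for `h = 1` it is a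
bound for the `C^N` norm. -/
def Scaled {F : Type*} [NormedAddCommGroup F] [NormedSpace ℝ F] (N : ℕ) (h B : ℝ) (v : ℝ → F) :
    Prop :=
  ContDiffOn ℝ N v Jhat ∧ ∀ j ≤ N, ∀ x ∈ Jhat, ‖iteratedDerivWithin j v Jhat x‖ ≤ B * h ^ j

namespace Scaled

variable {F : Type*} [NormedAddCommGroup F] [NormedSpace ℝ F] {N : ℕ} {h B B' : ℝ} {v w : ℝ → F}

lemma norm_le (hv : Scaled N h B v) {x : ℝ} (hx : x ∈ Jhat) : ‖v x‖ ≤ B := by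
  simpa using hv.2 0 (Nat.zero_le _) x hx

lemma nonneg (hv : Scaled N h B v) : 0 ≤ B :=
  (norm_nonneg _).trans (hv.norm_le (x := 0) (by constructor <;> norm_num))

lemma mono_order (hv : Scaled N h B v) {N' : ℕ} (hN : N' ≤ N) : Scaled N' h B v :=
  ⟨hv.1.of_le (by exact_mod_cast hN), fun j hj => hv.2 j (hj.trans hN)⟩

lemma mono (hv : Scaled N h B v) {h' B' : ℝ} (h0 : 0 ≤ h) (hh : h ≤ h') (hB : B ≤ B') :
    Scaled N h' B' v :=
  ⟨hv.1, fun j hj x hx => (hv.2 j hj x hx).trans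
    (mul_le_mul hB (pow_le_pow_left₀ h0 hh j) (pow_nonneg h0 j) (hv.nonneg.trans hB))⟩

lemma mono_const (hv : Scaled N h B v) (h0 : 0 ≤ h) {B' : ℝ} (hB : B ≤ B') : Scaled N h B' v :=
  hv.mono h0 le_rfl hB

lemma congr (hv : Scaled N h B v) (hw : EqOn w v Jhat) : Scaled N h B w :=
  ⟨hv.1.congr hw, fun j hj x hx => by
    rw [iteratedDerivWithin_congr hw hx]; exact hv.2 j hj x hx⟩

lemma add (hv : Scaled N h B v) (hw : Scaled N h B' w) :
    Scaled N h (B + B') (fun x => v x + w x) := by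
  refine ⟨hv.1.add hw.1, fun j hj x hx => ?_⟩
  have hjN : ((j : ℕ) : WithTop ℕ∞) ≤ N := by exact_mod_cast hj
  rw [iteratedDerivWithin_fun_add hx uniqueDiffOn_Jhat ((hv.1 x hx).of_le hjN)
    ((hw.1 x hx).of_le hjN), add_mul]
  exact (norm_add_le _ _).trans (add_le_add (hv.2 j hj x hx) (hw.2 j hj x hx))

lemma smul {φ : ℝ → ℝ} (h0 : 0 ≤ h) (hφ : Scaled N h B φ) (hv : Scaled N h B' v) :
    Scaled N h (2 ^ N * (B * B')) (fun x => φ x • v x) := by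
  refine ⟨hφ.1.smul hv.1, fun j hj x hx => ?_⟩
  rw [← norm_iteratedFDerivWithin_eq_norm_iteratedDerivWithin]
  refine (norm_iteratedFDerivWithin_smul_le hφ.1 hv.1 uniqueDiffOn_Jhat hx
    (n := j) (by exact_mod_cast hj)).trans ?_
  calc _ ≤ ∑ i ∈ Finset.range (j + 1), (j.choose i : ℝ) * (B * B' * h ^ j) := by
        refine Finset.sum_le_sum fun i hi => ?_
        have hij : i ≤ j := Nat.lt_succ_iff.mp (Finset.mem_range.mp hi)
        rw [norm_iteratedFDerivWithin_eq_norm_iteratedDerivWithin,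
          norm_iteratedFDerivWithin_eq_norm_iteratedDerivWithin, mul_assoc]
        refine mul_le_mul_of_nonneg_left ?_ (Nat.cast_nonneg _)
        calc _ ≤ (B * h ^ i) * (B' * h ^ (j - i)) :=
              mul_le_mul (hφ.2 i (hij.trans hj) x hx) (hv.2 _ ((Nat.sub_le _ _).trans hj) x hx)
                (norm_nonneg _) (mul_nonneg hφ.nonneg (pow_nonneg h0 _))
          _ = B * B' * h ^ j := by
              rw [← Nat.add_sub_cancel' hij, pow_add, Nat.add_sub_cancel_left]; ring
    _ = 2 ^ j * (B * B' * h ^ j) := by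
        rw [← Finset.sum_mul]; congr 1
        exact_mod_cast Nat.sum_range_choose j
    _ ≤ 2 ^ N * (B * B') * h ^ j := by
        rw [mul_assoc (2 ^ N)]
        exact mul_le_mul_of_nonneg_right (pow_le_pow_right₀ (by norm_num : (1 : ℝ) ≤ 2) hj)
          (mul_nonneg (mul_nonneg hφ.nonneg hv.nonneg) (pow_nonneg h0 _))

lemma mul {φ ψ : ℝ → ℝ} (h0 : 0 ≤ h) (hφ : Scaled N h B φ) (hψ : Scaled N h B' ψ) :
    Scaled N h (2 ^ N * (B * B')) (fun x => φ x * ψ x) := hφ.smul h0 hψ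

lemma const (h0 : 0 ≤ h) (c : F) : Scaled N h ‖c‖ (fun _ => c) := by
  refine ⟨contDiffOn_const, fun j _ x _ => ?_⟩
  rw [iteratedDerivWithin_const]
  split_ifs with hj
  · simp [hj]
  · simpa using mul_nonneg (norm_nonneg c) (pow_nonneg h0 j)

lemma const_mul {φ : ℝ → ℝ} (c : ℝ) (hφ : Scaled N h B φ) :
    Scaled N h (|c| * B) (fun x => c * φ x) := by
  refine ⟨contDiffOn_const.mul hφ.1, fun j hj x hx => ?_⟩
  have hjN : ((j : ℕ) : WithTop ℕ∞) ≤ N := by exact_mod_cast hj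
  rw [iteratedDerivWithin_const_mul hx uniqueDiffOn_Jhat c ((hφ.1 x hx).of_le hjN), norm_mul,
    mul_assoc]
  exact mul_le_mul_of_nonneg_left (hφ.2 j hj x hx) (norm_nonneg _)

lemma sub (hv : Scaled N h B v) (hw : Scaled N h B' w) :
    Scaled N h (B + B') (fun x => v x - w x) := by
  refine ⟨hv.1.sub hw.1, fun j hj x hx => ?_⟩
  have hjN : ((j : ℕ) : WithTop ℕ∞) ≤ N := by exact_mod_cast hj
  have := iteratedDerivWithin_sub hx uniqueDiffOn_Jhat ((hv.1 x hx).of_le hjN)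
    ((hw.1 x hx).of_le hjN)
  change ‖iteratedDerivWithin j (v - w) Jhat x‖ ≤ _
  rw [this, add_mul]
  exact (norm_sub_le _ _).trans (add_le_add (hv.2 j hj x hx) (hw.2 j hj x hx))

lemma sum {ι : Type*} (s : Finset ι) {v : ι → ℝ → F} {B : ι → ℝ} (h0 : 0 ≤ h)
    (hv : ∀ i ∈ s, Scaled N h (B i) (v i)) :
    Scaled N h (∑ i ∈ s, B i) (fun x => ∑ i ∈ s, v i x) := by
  classical
  induction s using Finset.induction_on with
  | empty => simpa using const (F := F) (N := N) h0 0
  | insert a s ha ih =>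
    simp only [Finset.sum_insert ha]
    exact (hv a (Finset.mem_insert_self _ _)).add
      (ih fun i hi => hv i (Finset.mem_insert_of_mem hi))

lemma const_mul_id (h0 : 0 ≤ h) (h1 : h ≤ 1) : Scaled N h 1 (fun x : ℝ => h * x) := by
  refine ⟨contDiffOn_const.mul contDiffOn_id, fun j _ x hx => ?_⟩
  rcases j with _ | _ | j
  · rw [iteratedDerivWithin_zero, norm_mul, Real.norm_of_nonneg h0, pow_zero, one_mul]
    exact mul_le_one₀ h1 (norm_nonneg _) (abs_le.mpr hx)
  · have : derivWithin (fun x : ℝ => h * x) Jhat x = h := by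
      simpa using ((hasDerivAt_id x).const_mul h).hasDerivWithinAt.derivWithin
        (uniqueDiffOn_Jhat x hx)
    rw [iteratedDerivWithin_one, this, Real.norm_of_nonneg h0]; simp
  · have : EqOn (derivWithin (fun x : ℝ => h * x) Jhat) (fun _ => h) Jhat := fun y hy => by
      simpa using ((hasDerivAt_id y).const_mul h).hasDerivWithinAt.derivWithin
        (uniqueDiffOn_Jhat y hy)
    rw [iteratedDerivWithin_succ', iteratedDerivWithin_congr this hx,
      iteratedDerivWithin_const, if_neg (Nat.succ_ne_zero _), norm_zero, one_mul]
    exact pow_nonneg h0 _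

lemma pow_id (h0 : 0 ≤ h) (h1 : h ≤ 1) (i : ℕ) :
    Scaled N h ((2 ^ N) ^ i) (fun x : ℝ => (h * x) ^ i) := by
  induction i with
  | zero => simpa using const (N := N) h0 (1 : ℝ)
  | succ i ih =>
    have := ih.mul h0 (const_mul_id h0 h1)
    simpa [pow_succ, mul_comm] using this

/-- A polynomial in `h x` with bounded coefficients is scaled. -/
lemma sum_pow_smul (h0 : 0 ≤ h) (h1 : h ≤ 1) (n : ℕ) {R : ℝ} {z : ℕ → F}
    (hz : ∀ i < n, ‖z i‖ ≤ R) :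
    Scaled N h (∑ i ∈ Finset.range n, 2 ^ N * ((2 ^ N) ^ i * R))
      (fun x : ℝ => ∑ i ∈ Finset.range n, (h * x) ^ i • z i) :=
  sum _ h0 fun i hi => (pow_id h0 h1 i).smul h0
    ((const h0 (z i)).mono_const h0 (hz i (Finset.mem_range.mp hi)))

end Scaled

/-- The constant that bounds the derivatives up to order `N` of a polynomial with `n` coefficients
of size at most `1`. -/
noncomputable def polyConst (N n : ℕ) : ℝ := ∑ i ∈ Finset.range n, 2 ^ N * ((2 ^ N) ^ i * 1)

lemma polyConst_nonneg (N n : ℕ) : 0 ≤ polyConst N n :=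
  Finset.sum_nonneg fun _ _ => by positivity

lemma scaled_polynomial {N n : ℕ} {h R : ℝ} (h0 : 0 < h) (h1 : h ≤ 1) {P : ℝ[X]}
    (hP : P ∈ degreeLT ℝ n) (hc : ∀ i, |P.coeff i| ≤ R * h ^ i) :
    Scaled N h (polyConst N n * R) (fun x => P.eval x) := by
  have key := Scaled.sum_pow_smul (N := N) h0.le h1 n (R := R)
    (z := fun i => P.coeff i / h ^ i) (fun i _ => by
      rw [norm_div, Real.norm_eq_abs, norm_pow, Real.norm_of_nonneg h0.le,
        div_le_iff₀ (by positivity)]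
      exact hc i)
  have hconst : (∑ i ∈ Finset.range n, (2 : ℝ) ^ N * ((2 ^ N) ^ i * R)) = polyConst N n * R := by
    rw [polyConst, Finset.sum_mul]; exact Finset.sum_congr rfl fun _ _ => by ring
  rw [hconst] at key
  refine key.congr fun x _ => ?_
  have hdeg : P.degree < (n : ℕ) := mem_degreeLT.mp hP
  change P.eval x = _
  rcases eq_or_ne P 0 with rfl | hP0
  · simp
  rw [eval_eq_sum_range' ((natDegree_lt_iff_degree_lt hP0).mpr hdeg)]
  refine Finset.sum_congr rfl fun i _ => ?_
  have : h ^ i ≠ 0 := by positivity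
  rw [smul_eq_mul, mul_pow]; field_simp

/-! ### Derivatives of polynomials and Taylor expansion -/

lemma iteratedDerivWithin_polynomial (P : ℝ[X]) (j : ℕ) {x : ℝ} (hx : x ∈ Jhat) :
    iteratedDerivWithin j (fun y => P.eval y) Jhat x = (derivative^[j] P).eval x := by
  induction j generalizing P with
  | zero => simp
  | succ j ih =>
    have : EqOn (derivWithin (fun y => P.eval y) Jhat) (fun y => (derivative P).eval y) Jhat :=
      fun y hy => (P.hasDerivAt y).hasDerivWithinAt.derivWithin (uniqueDiffOn_Jhat y hy)
    rw [iteratedDerivWithin_succ', iteratedDerivWithin_congr this hx, ih,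
      Function.iterate_succ_apply]

lemma contDiff_polynomial {n : WithTop ℕ∞} (P : ℝ[X]) : ContDiff ℝ n (fun x => P.eval x) := by
  simpa using P.contDiff_aeval (𝕜 := ℝ) n

/-- The Taylor polynomial of degree less than `s` at `0`. -/
noncomputable def taylorPoly (s : ℕ) (v : ℝ → ℝ) : ℝ[X] :=
  ∑ i ∈ Finset.range s, monomial i (iteratedDerivWithin i v Jhat 0 / i.factorial)

lemma coeff_taylorPoly (s : ℕ) (v : ℝ → ℝ) (i : ℕ) :
    (taylorPoly s v).coeff i
      = if i < s then iteratedDerivWithin i v Jhat 0 / i.factorial else 0 := by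
  simp [taylorPoly, coeff_monomial]

lemma taylorPoly_mem (s : ℕ) (v : ℝ → ℝ) : taylorPoly s v ∈ degreeLT ℝ s := by
  rw [mem_degreeLT, degree_lt_iff_coeff_zero]
  intro i hi
  rw [coeff_taylorPoly, if_neg (not_lt.mpr hi)]

lemma zero_mem_Jhat : (0 : ℝ) ∈ Jhat := by constructor <;> norm_num
lemma one_mem_Jhat : (1 : ℝ) ∈ Jhat := by constructor <;> norm_num
lemma neg_one_mem_Jhat : (-1 : ℝ) ∈ Jhat := by constructor <;> norm_num

lemma Scaled.abs_coeff_taylorPoly_le {N s : ℕ} {h B : ℝ} {v : ℝ → ℝ} (hv : Scaled N h B v)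
    (h0 : 0 ≤ h) (hs : s ≤ N + 1) (i : ℕ) : |(taylorPoly s v).coeff i| ≤ B * h ^ i := by
  rw [coeff_taylorPoly]
  split_ifs with hi
  · rw [abs_div, Nat.abs_cast]
    exact (div_le_self (abs_nonneg _) (by exact_mod_cast i.factorial_pos)).trans
      (hv.2 i (by omega) 0 zero_mem_Jhat)
  · simpa using mul_nonneg hv.nonneg (pow_nonneg h0 i)

/-- The Taylor remainder of order `s` is of size `h^s` together with all its derivatives. -/
lemma Scaled.sub_taylorPoly {N s : ℕ} {h B : ℝ} {v : ℝ → ℝ} (hv : Scaled N h B v)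
    (h0 : 0 ≤ h) (h1 : h ≤ 1) (hs : s ≤ N) :
    Scaled N 1 (B * h ^ s) (fun x => v x - (taylorPoly s v).eval x) := by
  set T := taylorPoly s v with hT
  have hTs : ContDiffOn ℝ N (fun x => T.eval x) Jhat := (contDiff_polynomial T).contDiffOn
  have hsm : ContDiffOn ℝ N (fun x => v x - T.eval x) Jhat := hv.1.sub hTs
  have hder : ∀ j ≤ N, ∀ x ∈ Jhat, iteratedDerivWithin j (fun x => v x - T.eval x) Jhat x
      = iteratedDerivWithin j v Jhat x - (derivative^[j] T).eval x := by
    intro j hj x hx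
    have hjN : ((j : ℕ) : WithTop ℕ∞) ≤ N := by exact_mod_cast hj
    have := iteratedDerivWithin_sub hx uniqueDiffOn_Jhat ((hv.1 x hx).of_le hjN)
      ((hTs x hx).of_le hjN)
    rw [← iteratedDerivWithin_polynomial T j hx, ← this]; rfl
  have hhigh : ∀ j ≤ N, s ≤ j → ∀ x ∈ Jhat,
      ‖iteratedDerivWithin j (fun x => v x - T.eval x) Jhat x‖ ≤ B * h ^ s := by
    intro j hj hsj x hx
    have hz : derivative^[j] T = 0 :=
      iterate_derivative_eq_zero_of_degree_lt
        ((mem_degreeLT.mp (taylorPoly_mem s v)).trans_le (by exact_mod_cast hsj))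
    rw [hder j hj x hx, hz, eval_zero, sub_zero]
    exact (hv.2 j hj x hx).trans
      (mul_le_mul_of_nonneg_left (pow_le_pow_of_le_one h0 h1 hsj) hv.nonneg)
  have hzero : ∀ j < s, iteratedDerivWithin j (fun x => v x - T.eval x) Jhat 0 = 0 := by
    intro j hj
    rw [hder j (by omega) 0 zero_mem_Jhat, ← coeff_zero_eq_eval_zero, coeff_iterate_derivative,
      zero_add, Nat.descFactorial_self, hT, coeff_taylorPoly, if_pos hj, nsmul_eq_mul]
    have : (j.factorial : ℝ) ≠ 0 := by exact_mod_cast j.factorial_ne_zero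
    field_simp; ring
  have hlow : ∀ i ≤ s, ∀ x ∈ Jhat,
      ‖iteratedDerivWithin (s - i) (fun x => v x - T.eval x) Jhat x‖ ≤ B * h ^ s := by
    intro i
    induction i with
    | zero => exact fun _ => hhigh s hs le_rfl
    | succ i ih =>
      intro hi x hx
      have hji : s - i = (s - (i + 1)) + 1 := by omega
      have hdiff : DifferentiableOn ℝ
          (iteratedDerivWithin (s - (i + 1)) (fun x => v x - T.eval x) Jhat) Jhat :=
        hsm.differentiableOn_iteratedDerivWithin (by exact_mod_cast (by omega : s - (i+1) < N))
          uniqueDiffOn_Jhat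
      have := (convex_Icc (-1 : ℝ) 1).norm_image_sub_le_of_norm_derivWithin_le hdiff
        (C := B * h ^ s) (fun y hy => by
          rw [← iteratedDerivWithin_succ, ← hji]; exact ih (by omega) y hy) zero_mem_Jhat hx
      rw [hzero _ (by omega), sub_zero, sub_zero] at this
      exact this.trans (mul_le_of_le_one_right (mul_nonneg hv.nonneg (pow_nonneg h0 s))
        (abs_le.mpr hx))
  refine ⟨hsm, fun j hj x hx => ?_⟩
  rw [one_pow, mul_one]
  rcases le_total s j with hsj | hjs
  · exact hhigh j hj hsj x hx
  · have := hlow (s - j) (Nat.sub_le _ _) x hx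
    rwa [Nat.sub_sub_self hjs] at this

/-! ### Transformation to the reference interval -/

lemma affInv_aff {a b : ℝ} (hab : a < b) (x : ℝ) : affInv a b (aff a b x) = x := by
  have : b - a ≠ 0 := (sub_pos.mpr hab).ne'
  rw [affInv, aff]; field_simp; ring

lemma aff_neg_one (a b : ℝ) : aff a b (-1) = a := by rw [aff]; ring

lemma aff_one (a b : ℝ) : aff a b 1 = b := by rw [aff]; ring

lemma aff_mem {a b x : ℝ} (hab : a ≤ b) (hx : x ∈ Jhat) : aff a b x ∈ Icc a b := by
  obtain ⟨h1, h2⟩ := hx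
  constructor <;> rw [aff] <;> nlinarith

lemma hasDerivAt_aff (a b x : ℝ) : HasDerivAt (aff a b) ((b - a) / 2) x := by
  have := ((hasDerivAt_id x).const_mul ((b - a) / 2)).const_add ((a + b) / 2)
  rwa [mul_one] at this

/-- Pulling back to the reference interval multiplies the `j`-th derivative by `(h/2)^j`. The
derivative on the right may be taken within any larger interval `I`. -/
lemma iteratedDerivWithin_comp_aff {F : Type*} [NormedAddCommGroup F] [NormedSpace ℝ F]
    {a b : ℝ} (hab : a ≤ b) {I : Set ℝ} (hI : UniqueDiffOn ℝ I) (hsub : Icc a b ⊆ I)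
    {n : ℕ} {g : ℝ → F} (hg : ContDiffOn ℝ n g I) {j : ℕ} (hj : j ≤ n) {x : ℝ} (hx : x ∈ Jhat) :
    iteratedDerivWithin j (fun y => g (aff a b y)) Jhat x
      = ((b - a) / 2) ^ j • iteratedDerivWithin j g I (aff a b x) := by
  have hmaps : MapsTo (aff a b) Jhat I := fun y hy => hsub (aff_mem hab hy)
  induction j generalizing x with
  | zero => simp
  | succ j ih =>
    have hcongr : EqOn (iteratedDerivWithin j (fun y => g (aff a b y)) Jhat)
        (fun y => ((b - a) / 2) ^ j • iteratedDerivWithin j g I (aff a b y)) Jhat :=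
      fun y hy => ih (by omega) hy
    have hd : DifferentiableWithinAt ℝ (iteratedDerivWithin j g I) I (aff a b x) :=
      hg.differentiableOn_iteratedDerivWithin (by exact_mod_cast (by omega : j < n)) hI _
        (hmaps hx)
    have h2 := (hd.hasDerivWithinAt.scomp x (hasDerivAt_aff a b x).hasDerivWithinAt
      hmaps).const_smul (((b - a) / 2) ^ j)
    rw [iteratedDerivWithin_succ, derivWithin_congr hcongr (hcongr hx), iteratedDerivWithin_succ]
    refine (h2.derivWithin (uniqueDiffOn_Jhat x hx)).trans ?_
    rw [smul_smul, pow_succ]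

lemma contDiff_aff {n : WithTop ℕ∞} (a b : ℝ) : ContDiff ℝ n (aff a b) :=
  contDiff_const.add (contDiff_const.mul contDiff_id)

lemma contDiff_affInv {n : WithTop ℕ∞} (a b : ℝ) : ContDiff ℝ n (affInv a b) :=
  ((contDiff_const.mul contDiff_id).sub contDiff_const).div_const _

lemma contDiff_pval {d : ℕ} {n : WithTop ℕ∞} (P : Fin d → ℝ[X]) : ContDiff ℝ n (pval P) :=
  (contDiff_piLp 2).mpr fun c => contDiff_polynomial (P c)

lemma norm_le_sum_abs {d : ℕ} (x : E d) : ‖x‖ ≤ ∑ c, |x c| := by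
  rw [EuclideanSpace.norm_eq]
  exact Real.sqrt_le_iff.mpr ⟨Finset.sum_nonneg fun _ _ => abs_nonneg _,
    Finset.sum_sq_le_sq_sum_of_nonneg fun _ _ => norm_nonneg _⟩

lemma abs_apply_le_norm {d : ℕ} (x : E d) (c : Fin d) : |x c| ≤ ‖x‖ := PiLp.norm_apply_le x c

lemma norm_le_card_mul {d : ℕ} {x : E d} {R : ℝ} (hx : ∀ c, |x c| ≤ R) : ‖x‖ ≤ d * R :=
  (norm_le_sum_abs x).trans ((Finset.sum_le_sum fun c _ => hx c).trans (by simp))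

lemma Scaled.component {d N : ℕ} {h B : ℝ} {v : ℝ → E d} (hv : Scaled N h B v) (c : Fin d) :
    Scaled N h B (fun x => v x c) := by
  refine ⟨(contDiffOn_piLp 2).mp hv.1 c, fun j hj x hx => ?_⟩
  refine le_trans ?_ (hv.2 j hj x hx)
  have hjN : ((j : ℕ) : WithTop ℕ∞) ≤ N := by exact_mod_cast hj
  rw [← norm_iteratedFDerivWithin_eq_norm_iteratedDerivWithin,
    ← norm_iteratedFDerivWithin_eq_norm_iteratedDerivWithin]
  let L : E d →L[ℝ] ℝ := EuclideanSpace.proj c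
  have hL : ‖L‖ ≤ 1 :=
    ContinuousLinearMap.opNorm_le_bound _ zero_le_one fun y => by
      rw [one_mul]; exact PiLp.norm_apply_le y c
  exact (ContinuousLinearMap.norm_iteratedFDerivWithin_comp_left L (hv.1 x hx)
    uniqueDiffOn_Jhat hx hjN).trans (mul_le_of_le_one_left (norm_nonneg _) hL)

/-- The vector of the `i`-th coefficients. -/
noncomputable def coeffVec {d : ℕ} (P : Fin d → ℝ[X]) (i : ℕ) : E d :=
  WithLp.toLp 2 fun c => (P c).coeff i

lemma eval_eq_sum_of_mem_degreeLT {n : ℕ} {P : ℝ[X]} (hP : P ∈ degreeLT ℝ n) (x : ℝ) :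
    P.eval x = ∑ i ∈ Finset.range n, P.coeff i * x ^ i := by
  rcases eq_or_ne P 0 with rfl | hP0
  · simp
  exact eval_eq_sum_range' ((natDegree_lt_iff_degree_lt hP0).mpr (mem_degreeLT.mp hP)) x

lemma pval_eq_sum {d n : ℕ} {P : Fin d → ℝ[X]} (hP : ∀ c, P c ∈ degreeLT ℝ n) {h : ℝ}
    (hh : h ≠ 0) (x : ℝ) :
    pval P x = ∑ i ∈ Finset.range n, (h * x) ^ i • (h ^ i)⁻¹ • coeffVec P i := by
  ext c
  simp only [pval, coeffVec, WithLp.ofLp_sum, WithLp.ofLp_smul, Finset.sum_apply, Pi.smul_apply,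
    smul_eq_mul]
  rw [eval_eq_sum_of_mem_degreeLT (hP c)]
  refine Finset.sum_congr rfl fun i _ => ?_
  have : h ^ i ≠ 0 := pow_ne_zero _ hh
  rw [mul_pow]; field_simp

lemma scaled_pval {d N n : ℕ} {h R : ℝ} (h0 : 0 < h) (h1 : h ≤ 1) {P : Fin d → ℝ[X]}
    (hP : ∀ c, P c ∈ degreeLT ℝ n) (hc : ∀ c i, |(P c).coeff i| ≤ R * h ^ i) :
    Scaled N h (polyConst N n * (d * R)) (pval P) := by
  have key := Scaled.sum_pow_smul (N := N) h0.le h1 n (R := d * R)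
    (z := fun i => (h ^ i)⁻¹ • coeffVec P i) (fun i _ => norm_le_card_mul fun c => by
      rw [WithLp.ofLp_smul, Pi.smul_apply, smul_eq_mul, abs_mul, abs_inv, abs_pow,
        abs_of_pos h0, inv_mul_le_iff₀ (by positivity), mul_comm]
      exact hc c i)
  have hconst : (∑ i ∈ Finset.range n, (2 : ℝ) ^ N * ((2 ^ N) ^ i * (d * R)))
      = polyConst N n * (d * R) := by
    rw [polyConst, Finset.sum_mul]; exact Finset.sum_congr rfl fun _ _ => by ring
  rw [hconst] at key
  exact key.congr fun x _ => pval_eq_sum hP h0.ne' x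

/-- Composition of a fixed smooth function of `(t, y)` with curves `t ↦ (t, P(t))`, for polynomials
`P` with bounded derivatives: all derivatives are bounded, uniformly in the interval and in `P`. -/
lemma exists_scaled_comp {F : Type*} [NormedAddCommGroup F] [NormedSpace ℝ F] {d : ℕ} (N n : ℕ)
    {t₀ T : ℝ} (hT : 0 < T) {Φ : ℝ × E d → F}
    (hΦ : ContDiffOn ℝ N Φ (Icc t₀ (t₀ + T) ×ˢ univ)) (R : ℝ) :
    ∃ B : ℝ, 0 ≤ B ∧ ∀ a b : ℝ, t₀ ≤ a → a < b → b ≤ t₀ + T → b - a ≤ 1 → ∀ P : Fin d → ℝ[X],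
      (∀ c, P c ∈ degreeLT ℝ n) → (∀ c i, |(P c).coeff i| ≤ R * (b - a) ^ i) →
      Scaled N (b - a) B (fun x => Φ (aff a b x, pval P x)) := by
  set S := Icc t₀ (t₀ + T) ×ˢ (univ : Set (E d)) with hS
  have hSd : UniqueDiffOn ℝ S :=
    (uniqueDiffOn_Icc (by linarith)).prod uniqueDiffOn_univ
  set B₁ : ℝ := polyConst N n * (d * R) with hB₁
  set K := Icc t₀ (t₀ + T) ×ˢ Metric.closedBall (0 : E d) B₁ with hK
  have hKc : IsCompact K := isCompact_Icc.prod (isCompact_closedBall _ _)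
  have hKS : K ⊆ S := prod_mono le_rfl (subset_univ _)
  have hbd : ∀ i, ∃ C, i ≤ N → ∀ y ∈ K, ‖iteratedFDerivWithin ℝ i Φ S y‖ ≤ C := fun i => by
    by_cases hi : i ≤ N
    · obtain ⟨C, hC⟩ := hKc.exists_bound_of_continuousOn
        ((hΦ.continuousOn_iteratedFDerivWithin (m := i) (by exact_mod_cast hi) hSd).mono hKS)
      exact ⟨C, fun _ => hC⟩
    · exact ⟨0, fun h => absurd h hi⟩
  choose C hC using hbd
  set C' := ∑ i ∈ Finset.range (N + 1), |C i| with hC'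
  have hCC' : ∀ i ≤ N, C i ≤ C' := fun i hi => (le_abs_self _).trans
    (Finset.single_le_sum (f := fun i => |C i|) (fun _ _ => abs_nonneg _)
      (Finset.mem_range.mpr (by omega)))
  have hC'0 : 0 ≤ C' := Finset.sum_nonneg fun _ _ => abs_nonneg _
  set D : ℝ := max 1 (|t₀| + T + 1 + |B₁|) with hD
  have hD1 : 1 ≤ D := le_max_left _ _
  refine ⟨N.factorial * C' * D ^ N, by positivity, fun a b ha hab hb h1 P hP hc => ?_⟩
  set h := b - a with hh
  have h0 : 0 < h := sub_pos.mpr hab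
  have hPs : Scaled N h B₁ (pval P) := scaled_pval h0 h1 hP hc
  set κ : ℝ → ℝ × E d := fun x => (aff a b x, pval P x) with hκ
  have haff : Scaled N h (|t₀| + T + 1) (aff a b) := by
    have e1 : Scaled N h (|t₀| + T) (fun _ : ℝ => (a + b) / 2) :=
      (Scaled.const h0.le _).mono_const h0.le (by
        rw [Real.norm_eq_abs, abs_le]
        constructor <;> cases abs_cases t₀ <;> linarith)
    have e2 := (Scaled.const_mul_id (N := N) h0.le h1).const_mul (1 / 2)
    refine ((e1.add e2).mono_const h0.le (B' := |t₀| + T + 1) ?_).congr fun x _ => ?_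
    · rw [abs_of_pos (by norm_num : (0 : ℝ) < 1 / 2)]; linarith
    ·
      rw [aff]; ring
  have hκs : Scaled N h D κ := by
    have i1 : Scaled N h (|t₀| + T + 1) (fun x => (aff a b x, (0 : E d))) := by
      refine ⟨haff.1.prodMk contDiffOn_const, fun j hj x hx => ?_⟩
      refine le_trans ?_ (haff.2 j hj x hx)
      have hjN : ((j : ℕ) : WithTop ℕ∞) ≤ N := by exact_mod_cast hj
      rw [← norm_iteratedFDerivWithin_eq_norm_iteratedDerivWithin,
        ← norm_iteratedFDerivWithin_eq_norm_iteratedDerivWithin]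
      exact (ContinuousLinearMap.norm_iteratedFDerivWithin_comp_left
        (ContinuousLinearMap.inl ℝ ℝ (E d)) (haff.1 x hx) uniqueDiffOn_Jhat hx hjN).trans
        (mul_le_of_le_one_left (norm_nonneg _) (ContinuousLinearMap.norm_inl_le_one ℝ ℝ (E d)))
    have i2 : Scaled N h |B₁| (fun x => ((0 : ℝ), pval P x)) := by
      refine ⟨contDiffOn_const.prodMk hPs.1, fun j hj x hx => ?_⟩
      refine le_trans ?_ ((hPs.mono_const h0.le (le_abs_self _)).2 j hj x hx)
      have hjN : ((j : ℕ) : WithTop ℕ∞) ≤ N := by exact_mod_cast hj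
      rw [← norm_iteratedFDerivWithin_eq_norm_iteratedDerivWithin,
        ← norm_iteratedFDerivWithin_eq_norm_iteratedDerivWithin]
      exact (ContinuousLinearMap.norm_iteratedFDerivWithin_comp_left
        (ContinuousLinearMap.inr ℝ ℝ (E d)) (hPs.1 x hx) uniqueDiffOn_Jhat hx hjN).trans
        (mul_le_of_le_one_left (norm_nonneg _) (ContinuousLinearMap.norm_inr_le_one ℝ ℝ (E d)))
    exact ((i1.add i2).mono_const h0.le (le_max_right _ _)).congr fun x _ => by simp [hκ]
  have hmem : ∀ x ∈ Jhat, κ x ∈ K := fun x hx =>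
    ⟨Icc_subset_Icc ha hb (aff_mem hab.le hx), by simpa using hPs.norm_le hx⟩
  have hmaps : MapsTo κ Jhat S := fun x hx => hKS (hmem x hx)
  refine ⟨hΦ.comp hκs.1 hmaps, fun j hj x hx => ?_⟩
  have key := norm_iteratedFDerivWithin_comp_le hΦ hκs.1 (n := j) (by exact_mod_cast hj) hSd
    uniqueDiffOn_Jhat hmaps hx (C := C') (D := D * h)
    (fun i hi => (hC i (hi.trans hj) _ (hmem x hx)).trans (hCC' i (hi.trans hj)))
    (fun i hi hij => by
      rw [norm_iteratedFDerivWithin_eq_norm_iteratedDerivWithin, mul_pow]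
      exact (hκs.2 i (hij.trans hj) x hx).trans (mul_le_mul_of_nonneg_right
        (le_self_pow₀ hD1 (by omega)) (pow_nonneg h0.le _)))
  rw [norm_iteratedFDerivWithin_eq_norm_iteratedDerivWithin] at key
  refine key.trans ?_
  rw [mul_pow, ← mul_assoc]
  refine mul_le_mul_of_nonneg_right ?_ (pow_nonneg h0.le _)
  have hfac : ((j.factorial : ℕ) : ℝ) ≤ N.factorial := by exact_mod_cast Nat.factorial_le hj
  have hpow : D ^ j ≤ D ^ N := pow_le_pow_right₀ hD1 hj
  gcongr

lemma pval_sub {d : ℕ} (P W : Fin d → ℝ[X]) (x : ℝ) :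
    pval (fun c => P c - W c) x = pval P x - pval W x := by
  ext c; simp [pval]

/-- The Lipschitz condition on total derivatives, transformed to the reference interval and applied
to polynomials, whose `C^{kJ}` norms are controlled by their coefficients. -/
lemma exists_scaled_sub_of_assLip {d κ n : ℕ} {t₀ T : ℝ} (hT : 0 < T) {f : ℝ → E d → E d}
    (hf : ContDiffOn ℝ κ (fun p : ℝ × E d => f p.1 p.2) (Icc t₀ (t₀ + T) ×ˢ univ))
    (hL : AssLip κ f t₀ T) :
    ∃ C : ℝ, 0 ≤ C ∧ ∀ a b : ℝ, t₀ ≤ a → a < b → b ≤ t₀ + T → b - a ≤ 1 →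
      ∀ P W : Fin d → ℝ[X], (∀ c, P c ∈ degreeLT ℝ n) → (∀ c, W c ∈ degreeLT ℝ n) →
      ∀ η : ℝ, (∀ c i, |(P c).coeff i - (W c).coeff i| ≤ η) →
      Scaled κ 1 (C * η) (fun x => f (aff a b x) (pval P x) - f (aff a b x) (pval W x)) := by
  obtain ⟨C₂, hC₂⟩ := hL
  set I := Icc t₀ (t₀ + T) with hI
  have hId : UniqueDiffOn ℝ I := uniqueDiffOn_Icc (by linarith)
  refine ⟨|C₂| * ((κ + 1 : ℕ) * (polyConst κ n * d)), by
    have := polyConst_nonneg κ n; positivity, fun a b ha hab hb h1 P W hP hW η hη => ?_⟩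
  set h := b - a with hh
  have h0 : 0 < h := sub_pos.mpr hab
  have hsub : Icc a b ⊆ I := Icc_subset_Icc ha hb
  set v : ℝ → E d := fun t => pval P (affInv a b t) with hv
  set w : ℝ → E d := fun t => pval W (affInv a b t) with hw
  have hvc : ContDiffOn ℝ κ v I := ((contDiff_pval P).comp (contDiff_affInv a b)).contDiffOn
  have hwc : ContDiffOn ℝ κ w I := ((contDiff_pval W).comp (contDiff_affInv a b)).contDiffOn
  have hfc : ∀ {z : ℝ → E d}, ContDiffOn ℝ κ z I → ContDiffOn ℝ κ (fun t => f t (z t)) I :=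
    fun hz => hf.comp (contDiffOn_id.prodMk hz) fun t ht => ⟨ht, mem_univ _⟩
  have hg : ContDiffOn ℝ κ (fun t => f t (v t) - f t (w t)) I := (hfc hvc).sub (hfc hwc)
  have hvw : ContDiffOn ℝ κ (fun t => v t - w t) I := hvc.sub hwc
  -- the almost everywhere bound holds everywhere, both sides being continuous
  have hpt : ∀ i ≤ κ, ∀ s ∈ I, ‖iteratedDerivWithin i (fun t => f t (v t) - f t (w t)) I s‖
      ≤ C₂ * ∑ l ∈ Finset.range (i + 1), ‖iteratedDerivWithin l (fun t => v t - w t) I s‖ := by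
    intro i hi
    have hae := hC₂ i hi v w hvc hwc
    set X := fun s => ‖iteratedDerivWithin i (fun t => f t (v t) - f t (w t)) I s‖ with hX
    set Y := fun s => C₂ * ∑ l ∈ Finset.range (i + 1),
      ‖iteratedDerivWithin l (fun t => v t - w t) I s‖ with hY
    have hXc : ContinuousOn X I :=
      (hg.continuousOn_iteratedDerivWithin (by exact_mod_cast hi) hId).norm
    have hYc : ContinuousOn Y I := continuousOn_const.mul
      (continuousOn_finsetSum _ fun l hl => (hvw.continuousOn_iteratedDerivWithin
        (by exact_mod_cast (by have := Finset.mem_range.mp hl; omega : l ≤ κ)) hId).norm)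
    have heq := Measure.eqOn_Icc_of_ae_eq volume (a := t₀) (b := t₀ + T) (by linarith)
      (f := fun s => max (X s - Y s) 0) (g := fun _ => 0)
      (by filter_upwards [hae] with s hs using max_eq_right (sub_nonpos.mpr hs))
      ((hXc.sub hYc).sup continuousOn_const) continuousOn_const
    intro s hs
    have := heq hs
    simp only [max_eq_right_iff, sub_nonpos] at this
    exact this
  have hPW : Scaled κ 1 (polyConst κ n * (d * η)) (pval fun c => P c - W c) :=
    scaled_pval one_pos le_rfl (fun c => Submodule.sub_mem _ (hP c) (hW c))
      (fun c i => by simpa using hη c i)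
  have hback : ∀ y, f (aff a b y) (pval P y) - f (aff a b y) (pval W y)
      = f (aff a b y) (v (aff a b y)) - f (aff a b y) (w (aff a b y)) := fun y => by
    simp only [hv, hw, affInv_aff hab]
  simp only [hback]
  have hmaps : MapsTo (aff a b) Jhat I := fun y hy => hsub (aff_mem hab.le hy)
  refine ⟨hg.comp (contDiff_aff a b).contDiffOn hmaps, fun j hj x hx => ?_⟩
  have hs := iteratedDerivWithin_comp_aff hab.le hId hsub hg hj hx
  rw [hs, norm_smul, Real.norm_of_nonneg (by positivity), one_pow, mul_one]
  have hhalf : h / 2 ≤ 1 := by linarith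
  calc (h / 2) ^ j * ‖iteratedDerivWithin j (fun t => f t (v t) - f t (w t)) I (aff a b x)‖
      ≤ (h / 2) ^ j * (|C₂| * ∑ l ∈ Finset.range (j + 1),
          ‖iteratedDerivWithin l (fun t => v t - w t) I (aff a b x)‖) := by
        refine mul_le_mul_of_nonneg_left ((hpt j hj _ (hmaps hx)).trans ?_) (by positivity)
        exact mul_le_mul_of_nonneg_right (le_abs_self _)
          (Finset.sum_nonneg fun _ _ => norm_nonneg _)
    _ = |C₂| * ∑ l ∈ Finset.range (j + 1),
          (h / 2) ^ j * ‖iteratedDerivWithin l (fun t => v t - w t) I (aff a b x)‖ := by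
        rw [Finset.mul_sum, Finset.mul_sum, Finset.mul_sum]
        exact Finset.sum_congr rfl fun _ _ => by ring
    _ ≤ |C₂| * ∑ l ∈ Finset.range (j + 1), polyConst κ n * (d * η) := by
        refine mul_le_mul_of_nonneg_left (Finset.sum_le_sum fun l hl => ?_) (abs_nonneg _)
        have hlj : l ≤ j := Nat.lt_succ_iff.mp (Finset.mem_range.mp hl)
        have hl' := hPW.2 l (hlj.trans hj) x hx
        have hfun : (fun y => v (aff a b y) - w (aff a b y)) = pval fun c => P c - W c := by
          funext y; simp only [hv, hw, affInv_aff hab, pval_sub]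
        rw [← hfun, iteratedDerivWithin_comp_aff hab.le hId hsub hvw (hlj.trans hj) hx, norm_smul,
          Real.norm_of_nonneg (by positivity), one_pow, mul_one] at hl'
        exact (mul_le_mul_of_nonneg_right (pow_le_pow_of_le_one (by positivity) hhalf hlj)
          (norm_nonneg _)).trans hl'
    _ ≤ |C₂| * ((κ + 1 : ℕ) * (polyConst κ n * d)) * η := by
        rw [Finset.sum_const, Finset.card_range, nsmul_eq_mul]
        have h3 : 0 ≤ polyConst κ n * (d * η) := hPW.nonneg
        have h4 : ((j + 1 : ℕ) : ℝ) ≤ (κ + 1 : ℕ) := by exact_mod_cast Nat.succ_le_succ hj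
        calc _ ≤ |C₂| * ((κ + 1 : ℕ) * (polyConst κ n * (d * η))) := by gcongr
          _ = _ := by ring

/-! ### Linearity, stability and exactness of the reference operators -/

namespace Integrator

variable {κ : ℕ} (Q : Integrator κ)

lemma toFun_sub {v w : ℝ → ℝ} (hv : ContDiffOn ℝ κ v Jhat) (hw : ContDiffOn ℝ κ w Jhat) :
    Q.toFun (fun t => v t - w t) = Q.toFun v - Q.toFun w := by
  have h1 := Q.map_add v (fun t => (-1) * w t) hv (contDiffOn_const.mul hw)
  have h2 := Q.map_smul (-1) w hw
  have h3 : (fun t => v t - w t) = fun t => v t + (-1) * w t := by funext t; ring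
  rw [h3, h1, h2]; ring

lemma toFun_zero : Q.toFun (fun _ => 0) = 0 := by
  simpa using Q.map_smul 0 (fun _ => 0) contDiffOn_const

lemma toFun_sum {ι : Type*} (s : Finset ι) (v : ι → ℝ → ℝ)
    (hv : ∀ i ∈ s, ContDiffOn ℝ κ (v i) Jhat) :
    Q.toFun (fun t => ∑ i ∈ s, v i t) = ∑ i ∈ s, Q.toFun (v i) := by
  classical
  induction s using Finset.induction_on with
  | empty => simpa using Q.toFun_zero
  | insert a s ha ih =>
    simp only [Finset.sum_insert ha]
    rw [Q.map_add _ _ (hv a (Finset.mem_insert_self _ _))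
      (ContDiffOn.sum fun i hi => hv i (Finset.mem_insert_of_mem hi)),
      ih fun i hi => hv i (Finset.mem_insert_of_mem hi)]

/-- The integrator as a linear functional on polynomials. -/
noncomputable def onPoly : ℝ[X] →ₗ[ℝ] ℝ where
  toFun P := Q.toFun (fun x => P.eval x)
  map_add' P R := by
    simpa using Q.map_add (fun x => P.eval x) (fun x => R.eval x)
      (contDiff_polynomial P).contDiffOn (contDiff_polynomial R).contDiffOn
  map_smul' c P := by
    simpa using Q.map_smul c (fun x => P.eval x) (contDiff_polynomial P).contDiffOn

lemma onPoly_apply (P : ℝ[X]) : Q.onPoly P = Q.toFun (fun x => P.eval x) := rfl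

end Integrator

lemma norm_le_supOn {d : ℕ} {S : Set ℝ} {v : ℝ → E d} (hS : BddAbove (range fun t : S => ‖v t‖))
    {x : ℝ} (hx : x ∈ S) : ‖v x‖ ≤ supOn S v :=
  le_ciSup hS ⟨x, hx⟩

lemma supOn_nonneg {d : ℕ} (S : Set ℝ) (v : ℝ → E d) : 0 ≤ supOn S v :=
  Real.iSup_nonneg fun _ => norm_nonneg _

lemma supOn_Jhat_le {d : ℕ} {v : ℝ → E d} {η : ℝ} (hv : ∀ x ∈ Jhat, ‖v x‖ ≤ η) :
    supOn Jhat v ≤ η := by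
  have : Nonempty Jhat := ⟨⟨0, zero_mem_Jhat⟩⟩
  exact ciSup_le fun x => hv x x.2

lemma sum_supOn_le {d N : ℕ} {v : ℝ → E d} {η : ℝ} (hv : Scaled N 1 η v) {n : ℕ}
    (hn : n ≤ N) :
    ∑ j ∈ Finset.range (n + 1), supOn Jhat (dhat j v) ≤ (n + 1 : ℕ) * η := by
  refine (Finset.sum_le_card_nsmul _ _ η fun j hj => supOn_Jhat_le fun x hx => ?_).trans_eq
    (by rw [Finset.card_range, nsmul_eq_mul])
  simpa [dhat] using hv.2 j (by have := Finset.mem_range.mp hj; omega) x hx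

lemma scaled_smul_single {d N : ℕ} (c : Fin d) {v : ℝ → ℝ} {η : ℝ} (hv : Scaled N 1 η v) :
    Scaled N 1 (2 ^ N * η) (fun x => v x • (EuclideanSpace.single c (1 : ℝ) : E d)) := by
  have := hv.smul zero_le_one (Scaled.const zero_le_one (EuclideanSpace.single c (1 : ℝ) : E d))
  simpa using this

lemma smul_single_apply {d : ℕ} (c : Fin d) (y : ℝ) :
    (y • (EuclideanSpace.single c (1 : ℝ) : E d)) c = y := by simp

/-- The stability of the integrator for vector-valued functions, restated for scalar ones. -/
lemma AssStabQ.exists_abs_le {κQ d : ℕ} {Q : Integrator κQ} (hQ : AssStabQ d Q) (c : Fin d) :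
    ∃ C : ℝ, 0 ≤ C ∧ ∀ (η : ℝ) (v : ℝ → ℝ), Scaled κQ 1 η v → |Q.toFun v| ≤ C * η := by
  obtain ⟨C₀, hC₀⟩ := hQ
  refine ⟨|C₀| * ((κQ + 1 : ℕ) * 2 ^ κQ), by positivity, fun η v hv => ?_⟩
  have hw := scaled_smul_single c hv
  set w : ℝ → E d := fun x => v x • EuclideanSpace.single c (1 : ℝ) with hwdef
  have e : Q.toFun v = Q.vec w c := by
    simp only [Integrator.vec, hwdef, smul_single_apply]
  rw [e]
  refine (abs_apply_le_norm _ c).trans ((hC₀ w hw.1).trans ?_)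
  calc _ ≤ |C₀| * ∑ j ∈ Finset.range (κQ + 1), supOn Jhat (dhat j w) :=
        mul_le_mul_of_nonneg_right (le_abs_self _) (Finset.sum_nonneg fun _ _ => supOn_nonneg _ _)
    _ ≤ |C₀| * ((κQ + 1 : ℕ) * (2 ^ κQ * η)) :=
        mul_le_mul_of_nonneg_left (sum_supOn_le hw le_rfl) (abs_nonneg _)
    _ = _ := by ring

lemma ApproxOp.contDiffOn_vec {κA d l : ℕ} (A : ApproxOp κA) {w : ℝ → E d}
    (hw : ContDiffOn ℝ (max κA l : ℕ) w Jhat) : ContDiffOn ℝ l (A.vec w) Jhat :=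
  (contDiffOn_piLp 2).mpr fun j => A.smooth l _ ((contDiffOn_piLp 2).mp hw j)

/-- The stability of the approximation operator for vector-valued functions, restated for scalar
ones. -/
lemma AssStabA.exists_scaled {κQ κA d : ℕ} {A : ApproxOp κA} (hA : AssStabA d κQ A) (c : Fin d) :
    ∃ C : ℝ, 0 ≤ C ∧ ∀ (η : ℝ) (v : ℝ → ℝ), Scaled (max κA κQ) 1 η v →
      Scaled κQ 1 (C * η) (A.toFun v) := by
  obtain ⟨C₁, hC₁⟩ := hA
  set N := max κA κQ with hN
  refine ⟨|C₁| * ((N + 1 : ℕ) * 2 ^ N), by positivity, fun η v hv => ?_⟩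
  have hw := scaled_smul_single c hv
  set w : ℝ → E d := fun x => v x • EuclideanSpace.single c (1 : ℝ) with hwdef
  have hAw : ContDiffOn ℝ κQ (A.vec w) Jhat := A.contDiffOn_vec hw.1
  have key : Scaled κQ 1 (|C₁| * ((N + 1 : ℕ) * 2 ^ N) * η) (A.vec w) := by
    refine ⟨hAw, fun l hl x hx => ?_⟩
    have hlN : max κA l ≤ N := max_le_max le_rfl hl
    have hbdd : BddAbove (range fun t : Jhat => ‖dhat l (A.vec w) t‖) := by
      obtain ⟨B, hB⟩ := isCompact_Icc.exists_bound_of_continuousOn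
        (hAw.continuousOn_iteratedDerivWithin (m := l) (by exact_mod_cast hl) uniqueDiffOn_Jhat)
      exact ⟨B, by rintro _ ⟨t, rfl⟩; exact hB t t.2⟩
    have h1 := (norm_le_supOn hbdd hx).trans
      (hC₁ l hl w (hw.1.of_le (by exact_mod_cast hlN)))
    rw [one_pow, mul_one]
    refine h1.trans ?_
    have hw0 := hw.nonneg
    calc _ ≤ |C₁| * ∑ j ∈ Finset.range (max κA l + 1), supOn Jhat (dhat j w) :=
          mul_le_mul_of_nonneg_right (le_abs_self _)
            (Finset.sum_nonneg fun _ _ => supOn_nonneg _ _)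
      _ ≤ |C₁| * ((max κA l + 1 : ℕ) * (2 ^ N * η)) :=
          mul_le_mul_of_nonneg_left (sum_supOn_le hw hlN) (abs_nonneg _)
      _ ≤ |C₁| * ((N + 1 : ℕ) * (2 ^ N * η)) := by
          have : ((max κA l + 1 : ℕ) : ℝ) ≤ (N + 1 : ℕ) := by exact_mod_cast Nat.succ_le_succ hlN
          gcongr
      _ = _ := by ring
  have e : A.toFun v = fun t => A.vec w t c := by
    funext t; simp only [ApproxOp.vec, hwdef, smul_single_apply]
  rw [e]; exact key.component c

/-- A supremum of naturals over a downward closed set that contains `0`: whatever lies below the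
supremum belongs to the set. -/
lemma of_le_iSup_natCast {p : ℕ → Prop} (h0 : p 0) (hp : ∀ m n, m ≤ n → p n → p m) {s : ℕ}
    (hs : (s : ℕ∞) ≤ ⨆ (m : ℕ) (_ : p m), (m : ℕ∞)) : p s := by
  by_contra hps
  have hs0 : s ≠ 0 := fun h => hps (h ▸ h0)
  have : (⨆ (m : ℕ) (_ : p m), (m : ℕ∞)) ≤ ((s - 1 : ℕ) : ℕ∞) := by
    refine iSup₂_le fun m hm => ?_
    have : m < s := lt_of_not_ge fun h => hps (hp s m h hm)
    exact_mod_cast (by omega : m ≤ s - 1)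
  have h2 : s ≤ s - 1 := by exact_mod_cast hs.trans this
  omega

lemma integral_eq_of_le_exSucc {κQ : ℕ} {Q : Integrator κQ} {s : ℕ} (hs : (s : ℕ∞) ≤ exSucc Q)
    {φ : ℝ[X]} (hφ : φ ∈ degreeLT ℝ s) :
    ∫ t in (-1 : ℝ)..1, φ.eval t = Q.toFun (fun t => φ.eval t) := by
  refine of_le_iSup_natCast (p := fun m => ∀ φ ∈ degreeLT ℝ m,
    ∫ t in (-1 : ℝ)..1, φ.eval t = Q.toFun (fun t => φ.eval t)) ?_ ?_ hs φ hφ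
  · intro φ hφ
    have : φ = 0 := by simpa [mem_degreeLT] using hφ
    subst this
    simpa using Q.toFun_zero.symm
  · exact fun m n hmn h φ hφ => h φ (degreeLT_mono hmn hφ)

lemma ApproxOp.eqOn_zero {κA : ℕ} (A : ApproxOp κA) :
    EqOn (A.toFun fun _ => 0) (fun _ => 0) Jhat := by
  intro x hx
  simpa using A.map_smul 0 (fun _ => 0) contDiffOn_const hx

lemma toFun_mul_eq_of_le_ordSucc {κQ κA : ℕ} {Q : Integrator κQ} {A : ApproxOp κA} {i s : ℕ}
    (hs : (s : ℕ∞) ≤ ordSucc Q A i) {φ ψ : ℝ[X]} (hφ : φ ∈ degreeLT ℝ s)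
    (hψ : ψ ∈ degreeLE ℝ i) :
    Q.toFun (fun t => φ.eval t * ψ.eval t)
      = Q.toFun (fun t => A.toFun (fun s => φ.eval s) t * ψ.eval t) := by
  refine of_le_iSup_natCast (p := fun m => ∀ φ ∈ degreeLT ℝ m, ∀ ψ ∈ degreeLE ℝ i,
    Q.toFun (fun t => φ.eval t * ψ.eval t)
      = Q.toFun (fun t => A.toFun (fun s => φ.eval s) t * ψ.eval t)) ?_ ?_ hs φ hφ ψ hψ
  · intro φ hφ ψ _
    have : φ = 0 := by simpa [mem_degreeLT] using hφ
    subst this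
    refine Q.congr_on _ _ fun x hx => ?_
    simp only [eval_zero]
    rw [A.eqOn_zero hx]
  · exact fun m n hmn h φ hφ => h φ (degreeLT_mono hmn hφ)

/-- Exactness on `T` lets one replace `γ` by `γ - T` in the consistency error of `A`. -/
lemma toFun_approx_sub {κQ κA : ℕ} {Q : Integrator κQ} {A : ApproxOp κA} {i s : ℕ}
    (hs : (s : ℕ∞) ≤ ordSucc Q A i) {T φ : ℝ[X]} (hT : T ∈ degreeLT ℝ s) (hφ : φ ∈ degreeLE ℝ i)
    {γ : ℝ → ℝ} (hγ : ContDiffOn ℝ (max κA κQ : ℕ) γ Jhat) :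
    Q.toFun (fun x => A.toFun γ x * φ.eval x) - Q.toFun (fun x => T.eval x * φ.eval x)
      = Q.toFun (fun x => A.toFun (fun y => γ y - T.eval y) x * φ.eval x) := by
  have hTs : ContDiffOn ℝ (max κA κQ : ℕ) (fun x => T.eval x) Jhat :=
    (contDiff_polynomial T).contDiffOn
  have hφs : ContDiffOn ℝ κQ (fun x => φ.eval x) Jhat := (contDiff_polynomial φ).contDiffOn
  have hle : ((κA : ℕ) : WithTop ℕ∞) ≤ (max κA κQ : ℕ) := by exact_mod_cast le_max_left _ _
  have hAdd := A.map_add (fun y => γ y - T.eval y) (fun y => T.eval y)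
    ((hγ.sub hTs).of_le hle) (hTs.of_le hle)
  simp only [sub_add_cancel] at hAdd
  rw [toFun_mul_eq_of_le_ordSucc hs hT hφ, sub_eq_iff_eq_add,
    ← Q.map_add _ _ ((A.smooth κQ _ (hγ.sub hTs)).mul hφs) ((A.smooth κQ _ hTs).mul hφs)]
  refine Q.congr_on _ _ fun x hx => ?_
  rw [hAdd hx]; ring

/-! ### The linear system for the derivative of the discrete solution -/

lemma X_sub_C_pow_dvd {V : ℝ[X]} {y : ℝ} {n : ℕ} (h : ∀ i < n, (derivative^[i] V).eval y = 0) :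
    (X - C y) ^ n ∣ V := by
  rcases eq_or_ne V 0 with rfl | hV
  · exact dvd_zero _
  rcases n with _ | n
  · simp
  rw [← le_rootMultiplicity_iff hV]
  exact (lt_rootMultiplicity_iff_isRoot_iterate_derivative hV).mpr
    fun m hm => h m (Nat.lt_succ_of_le hm)

/-- The exponent of the factor `1 + X` of the test functions: for `k = 0` it removes the jump. -/
def jumpExp (k : ℕ) : ℕ := if k = 0 then 1 else 0

/-- A polynomial of degree less than `r` is determined by the data of the linear system: the
collocation conditions force the factor `(1-X)^{⌊k/2⌋} (1+X)^{⌊(k-1)/2⌋}`, and the cofactor vanishes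
by the solvability assumption. -/
lemma eq_zero_of_data {κQ r k : ℕ} (hkr : k ≤ r) {Q : Integrator κQ} (hS : AssSolvable r k Q)
    {V : ℝ[X]} (hV : V ∈ degreeLT ℝ r) (hr : ∀ i < k / 2, (derivative^[i] V).eval 1 = 0)
    (hl : ∀ i < (k - 1) / 2, (derivative^[i] V).eval (-1) = 0)
    (hvar : ∀ j < r + 1 - max 1 k, Q.onPoly (V * ((1 + X) ^ jumpExp k * X ^ j)) = 0) : V = 0 := by
  by_contra hV0
  have hcop : IsCoprime ((X - C (1 : ℝ)) ^ (k / 2)) ((X - C (-1 : ℝ)) ^ ((k - 1) / 2)) :=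
    (isCoprime_X_sub_C_of_isUnit_sub (by norm_num)).pow
  obtain ⟨χ, hχ⟩ := hcop.mul_dvd (X_sub_C_pow_dvd hr) (X_sub_C_pow_dvd hl)
  have hχ0 : χ ≠ 0 := by rintro rfl; exact hV0 (by rw [hχ, mul_zero])
  have hdeg : V.natDegree = k / 2 + (k - 1) / 2 + χ.natDegree := by
    rw [hχ, natDegree_mul (mul_ne_zero (pow_ne_zero _ (X_sub_C_ne_zero _))
      (pow_ne_zero _ (X_sub_C_ne_zero _))) hχ0, natDegree_mul (pow_ne_zero _ (X_sub_C_ne_zero _))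
      (pow_ne_zero _ (X_sub_C_ne_zero _)), natDegree_pow, natDegree_pow, natDegree_X_sub_C,
      natDegree_X_sub_C, mul_one, mul_one]
  have hVr : V.natDegree < r := (natDegree_lt_iff_degree_lt hV0).mpr (mem_degreeLT.mp hV)
  set ψ : ℝ[X] := C ((-1) ^ (k / 2)) * χ with hψ
  have hψmem : ψ ∈ degreeLT ℝ (r + 1 - max 1 k) := by
    rw [mem_degreeLT]
    rw [hψ, degree_C_mul (pow_ne_zero _ (by norm_num)), ← natDegree_lt_iff_degree_lt hχ0]
    omega
  -- for `k = 0` the integer `⌊(k-1)/2⌋` is `-1`, so the weight contains a factor `1 + t`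
  have hexp : (((k : ℤ) - 1) / 2).natAbs = (k - 1) / 2 + jumpExp k := by
    rcases k with _ | k
    · rfl
    · have : (((k + 1 : ℕ) : ℤ) - 1) / 2 = ((k / 2 : ℕ) : ℤ) := by omega
      rw [this, Int.natAbs_natCast]; simp [jumpExp]
  have hψ0 := hS ψ hψmem fun φ hφ => by
    have h1 : Q.toFun (fun t => (1 - t) ^ (k / 2) * (1 + t) ^ (((k : ℤ) - 1) / 2).natAbs
        * ψ.eval t * φ.eval t) = Q.onPoly (V * ((1 + X) ^ jumpExp k * φ)) := by
      rw [Integrator.onPoly_apply]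
      congr 1
      funext t
      have e1 : (1 - t) ^ (k / 2) = (-1) ^ (k / 2) * (t - 1) ^ (k / 2) := by
        rw [← mul_pow]; ring
      have e2 : ((-1 : ℝ) ^ (k / 2)) * (-1) ^ (k / 2) = 1 := by
        rw [← mul_pow]; norm_num
      rw [hχ, hexp, hψ, e1]
      simp only [eval_mul, eval_pow, eval_sub, eval_add, eval_X, eval_C, eval_one]
      calc _ = ((-1 : ℝ) ^ (k / 2) * (-1) ^ (k / 2)) * ((t - 1) ^ (k / 2)
            * (1 + t) ^ ((k - 1) / 2) * χ.eval t * ((1 + t) ^ jumpExp k * φ.eval t)) := by ring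
        _ = _ := by rw [e2]; ring
    have h2 : V * ((1 + X) ^ jumpExp k * φ) = ∑ j ∈ Finset.range (r + 1 - max 1 k),
        φ.coeff j • (V * ((1 + X) ^ jumpExp k * X ^ j)) := by
      have hφsum : φ = ∑ j ∈ Finset.range (r + 1 - max 1 k), φ.coeff j • (X : ℝ[X]) ^ j := by
        rcases eq_or_ne φ 0 with rfl | hφ0
        · simp
        conv_lhs => rw [φ.as_sum_range' _
          ((natDegree_lt_iff_degree_lt hφ0).mpr (mem_degreeLT.mp hφ))]
        exact Finset.sum_congr rfl fun j _ => by rw [← smul_X_eq_monomial]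
      conv_lhs => rw [hφsum]
      rw [Finset.mul_sum, Finset.mul_sum]
      exact Finset.sum_congr rfl fun j _ => by rw [mul_smul_comm, mul_smul_comm]
    rw [h1, h2, map_sum]
    exact Finset.sum_eq_zero fun j hj => by
      rw [map_smul, hvar j (Finset.mem_range.mp hj), smul_zero]
  rw [hψ, mul_eq_zero, C_eq_zero] at hψ0
  exact hψ0.elim (pow_ne_zero _ (by norm_num)) hχ0

/-- Quantitative form of unique solvability: in finite dimension injectivity gives a bound for the
coefficients. -/
lemma exists_coeff_le_of_data {κQ r k : ℕ} (hkr : k ≤ r) {Q : Integrator κQ}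
    (hS : AssSolvable r k Q) :
    ∃ K : ℝ, 0 ≤ K ∧ ∀ V ∈ degreeLT ℝ r, ∀ η : ℝ, 0 ≤ η →
      (∀ i < k / 2, |(derivative^[i] V).eval 1| ≤ η) →
      (∀ i < (k - 1) / 2, |(derivative^[i] V).eval (-1)| ≤ η) →
      (∀ j < r + 1 - max 1 k, |Q.onPoly (V * ((1 + X) ^ jumpExp k * X ^ j))| ≤ η) →
      ∀ i, |V.coeff i| ≤ K * η := by
  let ev (y : ℝ) (n : ℕ) : ℝ[X] →ₗ[ℝ] (Fin n → ℝ) :=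
    LinearMap.pi fun i => (leval y) ∘ₗ ((derivative : ℝ[X] →ₗ[ℝ] ℝ[X]) ^ (i : ℕ))
  have hev : ∀ y n P i, ev y n P i = (derivative^[(i : ℕ)] P).eval y := fun y n P i => by
    simp only [ev, LinearMap.pi_apply, LinearMap.comp_apply, Module.End.pow_apply]; rfl
  let qv : ℝ[X] →ₗ[ℝ] (Fin (r + 1 - max 1 k) → ℝ) :=
    LinearMap.pi fun j => Q.onPoly ∘ₗ LinearMap.mulRight ℝ ((1 + X) ^ jumpExp k * X ^ (j : ℕ))
  have hqv : ∀ P j, qv P j = Q.onPoly (P * ((1 + X) ^ jumpExp k * X ^ (j : ℕ))) :=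
    fun _ _ => rfl
  let Λ₀ := (ev 1 (k / 2)).prod ((ev (-1) ((k - 1) / 2)).prod qv)
  let Λ := Λ₀ ∘ₗ (degreeLT ℝ r).subtype ∘ₗ (degreeLTEquiv ℝ r).symm.toLinearMap
  have hker : LinearMap.ker Λ = ⊥ := by
    rw [LinearMap.ker_eq_bot']
    intro x hx
    set V := (degreeLTEquiv ℝ r).symm x with hV
    have hΛ : Λ x = (ev 1 (k / 2) V, ev (-1) ((k - 1) / 2) V, qv V) := rfl
    rw [hΛ, Prod.mk_eq_zero, Prod.mk_eq_zero] at hx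
    obtain ⟨h1, h2, h3⟩ := hx
    have : (V : ℝ[X]) = 0 := eq_zero_of_data hkr hS V.2
      (fun i hi => by rw [← hev 1 _ _ ⟨i, hi⟩, h1]; rfl)
      (fun i hi => by rw [← hev (-1) _ _ ⟨i, hi⟩, h2]; rfl)
      (fun j hj => by rw [← hqv _ ⟨j, hj⟩, h3]; rfl)
    have hV0 : V = 0 := Subtype.ext this
    rwa [hV, LinearEquiv.map_eq_zero_iff] at hV0
  obtain ⟨K, -, hK⟩ := Λ.exists_antilipschitzWith hker
  refine ⟨K, K.2, fun V hV η hη h1 h2 h3 i => ?_⟩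
  set x := degreeLTEquiv ℝ r ⟨V, hV⟩ with hx
  have hΛ : Λ x = (ev 1 (k / 2) V, ev (-1) ((k - 1) / 2) V, qv V) := by
    have : (degreeLTEquiv ℝ r).symm x = ⟨V, hV⟩ := by rw [hx, LinearEquiv.symm_apply_apply]
    change Λ₀ ((degreeLTEquiv ℝ r).symm x : ℝ[X]) = _
    rw [this]; rfl
  have hnorm : ‖Λ x‖ ≤ η := by
    rw [hΛ, norm_prod_le_iff, norm_prod_le_iff]
    refine ⟨(pi_norm_le_iff_of_nonneg hη).mpr fun i => ?_,
      (pi_norm_le_iff_of_nonneg hη).mpr fun i => ?_, (pi_norm_le_iff_of_nonneg hη).mpr fun i => ?_⟩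
    · exact (congrArg norm (hev 1 _ V i)).trans_le (h1 i i.2)
    · exact (congrArg norm (hev (-1) _ V i)).trans_le (h2 i i.2)
    · exact (congrArg norm (hqv V i)).trans_le (h3 i i.2)
  have hxle : ‖x‖ ≤ K * η := by
    have := hK.le_mul_dist x 0
    rw [map_zero, dist_zero_right, dist_zero_right] at this
    exact this.trans (mul_le_mul_of_nonneg_left hnorm K.2)
  by_cases hi : i < r
  · exact (norm_le_pi_norm x ⟨i, hi⟩).trans hxle
  · have : V.coeff i = 0 := coeff_eq_zero_of_degree_lt
      ((mem_degreeLT.mp hV).trans_le (by exact_mod_cast not_lt.mp hi))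
    rw [this, abs_zero]; exact mul_nonneg K.2 hη

/-- One component of the local problem on the reference interval: `V` is the derivative of the
transformed discrete solution, `J` its jump at the left end point (only present for `k = 0`) and `γ`
the transformed right-hand side. -/
structure ComponentSystem {κQ κA : ℕ} (r k : ℕ) (Q : Integrator κQ) (A : ApproxOp κA) (h : ℝ)
    (γ : ℝ → ℝ) (V : ℝ[X]) (J : ℝ) : Prop where
  deg : V ∈ degreeLT ℝ r
  right : ∀ i < k / 2, (derivative^[i] V).eval 1 = h / 2 * iteratedDerivWithin i γ Jhat 1
  left : ∀ i < (k - 1) / 2,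
    (derivative^[i] V).eval (-1) = h / 2 * iteratedDerivWithin i γ Jhat (-1)
  jump : 1 ≤ k → J = 0
  var : ∀ φ ∈ degreeLE ℝ (r - k : ℕ),
    Q.toFun (fun x => V.eval x * φ.eval x) + J * φ.eval (-1)
      = h / 2 * Q.toFun (fun x => A.toFun γ x * φ.eval x)

lemma exists_scaled_polynomial (N : ℕ) (φ : ℝ[X]) : ∃ B, Scaled N 1 B (fun x => φ.eval x) := by
  refine ⟨_, scaled_polynomial one_pos le_rfl (n := φ.natDegree + 1)
    (R := ∑ i ∈ Finset.range (φ.natDegree + 1), |φ.coeff i|) ?_ fun i => ?_⟩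
  · rw [mem_degreeLT]
    exact degree_le_natDegree.trans_lt (by exact_mod_cast Nat.lt_succ_self _)
  · rw [one_pow, mul_one]
    by_cases hi : i < φ.natDegree + 1
    · exact Finset.single_le_sum (f := fun i => |φ.coeff i|) (fun _ _ => abs_nonneg _)
        (Finset.mem_range.mpr hi)
    · rw [coeff_eq_zero_of_natDegree_lt (by omega), abs_zero]
      exact Finset.sum_nonneg fun _ _ => abs_nonneg _

/-- Stability of the linear system, relative to polynomials `T` on which the method is exact:
`V` is close to `(h/2) T` if `γ` is close to `T`. -/
lemma exists_system_stability {κQ κA r k : ℕ} (hkr : k ≤ r) {Q : Integrator κQ} {A : ApproxOp κA}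
    (hS : AssSolvable r k Q) {CQ CA : ℝ} (hCQ : 0 ≤ CQ) (hCA : 0 ≤ CA)
    (hQ : ∀ (η : ℝ) (v : ℝ → ℝ), Scaled κQ 1 η v → |Q.toFun v| ≤ CQ * η)
    (hA : ∀ (η : ℝ) (v : ℝ → ℝ), Scaled (max κA κQ) 1 η v → Scaled κQ 1 (CA * η) (A.toFun v)) :
    ∃ L : ℝ, 0 ≤ L ∧ ∀ (h : ℝ) (γ : ℝ → ℝ) (V : ℝ[X]) (J : ℝ), 0 < h →
      ComponentSystem r k Q A h γ V J → ∀ s ≤ r, (s : ℕ∞) ≤ ordSucc Q A (r - k) →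
      ∀ T ∈ degreeLT ℝ s, ∀ η : ℝ, Scaled (kJ k κQ κA) 1 η (fun x => γ x - T.eval x) →
      (∀ i, |(V - C (h / 2) * T).coeff i| ≤ L * (h * η)) ∧ |J| ≤ L * (h * η) := by
  obtain ⟨K, hK0, hK⟩ := exists_coeff_le_of_data hkr hS
  have hpoly := fun j : ℕ =>
    exists_scaled_polynomial κQ ((1 + X : ℝ[X]) ^ jumpExp k * X ^ j)
  choose Bφ hBφ using hpoly
  have hBφ0 : ∀ j, 0 ≤ Bφ j := fun j => (hBφ j).nonneg
  set m := r + 1 - max 1 k with hm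
  set B := 1 + ∑ j ∈ Finset.range m, Bφ j with hB
  have hB1 : 1 ≤ B := by
    have : 0 ≤ ∑ j ∈ Finset.range m, Bφ j := Finset.sum_nonneg fun j _ => hBφ0 j
    linarith
  have hBle : ∀ j < m, Bφ j ≤ B := fun j hj => by
    have := Finset.single_le_sum (f := Bφ) (fun j _ => hBφ0 j) (Finset.mem_range.mpr hj)
    linarith
  -- `D` bounds all data of the system, relative to `h η`
  set D := 1 + CQ * (2 ^ κQ * (CA * B)) with hD
  have hD0 : 0 ≤ D := by positivity
  have hD1 : 1 ≤ D := by
    have : 0 ≤ CQ * (2 ^ κQ * (CA * B)) := by positivity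
    linarith
  set C' := K * D + (CQ * (polyConst κQ r * (K * D)) + D) with hC'
  have hp0 := polyConst_nonneg κQ r
  refine ⟨C', by positivity, fun h γ V J hh hsys s hsr hso T hT η hη => ?_⟩
  have hη0 : 0 ≤ η := hη.nonneg
  have hhη : 0 ≤ h * η := mul_nonneg hh.le hη0
  have hkA : max κA κQ ≤ kJ k κQ κA := by rw [kJ]; omega
  have hTs : ∀ n : ℕ, ContDiffOn ℝ n (fun x => T.eval x) Jhat :=
    fun n => (contDiff_polynomial T).contDiffOn
  have hγ : ContDiffOn ℝ (kJ k κQ κA) γ Jhat :=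
    (hη.1.add (hTs _)).congr fun x _ => by ring
  set V₁ := V - C (h / 2) * T with hV₁
  have hV₁mem : V₁ ∈ degreeLT ℝ r := by
    refine Submodule.sub_mem _ hsys.deg ?_
    rw [← smul_eq_C_mul]
    exact Submodule.smul_mem _ _ (degreeLT_mono hsr hT)
  -- Hermite data
  have hder : ∀ i ≤ kJ k κQ κA, ∀ y ∈ Jhat,
      (derivative^[i] V).eval y = h / 2 * iteratedDerivWithin i γ Jhat y →
      |(derivative^[i] V₁).eval y| ≤ D * (h * η) := by
    intro i hi y hy hV
    have hiN : ((i : ℕ) : WithTop ℕ∞) ≤ (kJ k κQ κA : ℕ) := by exact_mod_cast hi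
    have e := iteratedDerivWithin_sub hy uniqueDiffOn_Jhat ((hγ y hy).of_le hiN)
      ((hTs _ y hy).of_le hiN)
    rw [iteratedDerivWithin_polynomial T i hy] at e
    have hb := hη.2 i hi y hy
    change ‖iteratedDerivWithin i (γ - fun x => T.eval x) Jhat y‖ ≤ _ at hb
    rw [e, one_pow, mul_one, Real.norm_eq_abs] at hb
    have : (derivative^[i] V₁).eval y
        = h / 2 * (iteratedDerivWithin i γ Jhat y - (derivative^[i] T).eval y) := by
      rw [hV₁, iterate_derivative_sub, iterate_derivative_C_mul, eval_sub, eval_mul, eval_C, hV]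
      ring
    rw [this, abs_mul, abs_of_pos (by positivity)]
    calc h / 2 * _ ≤ h / 2 * η := by gcongr
      _ ≤ 1 * (h * η) := by linarith
      _ ≤ D * (h * η) := by gcongr
  -- variational data
  have hvar : ∀ φ ∈ degreeLE ℝ (r - k : ℕ), ∀ b ≤ B, Scaled κQ 1 b (fun x => φ.eval x) →
      |Q.toFun (fun x => V₁.eval x * φ.eval x) + J * φ.eval (-1)| ≤ D * (h * η) := by
    intro φ hφ b hb hφb
    have hφs : ContDiffOn ℝ κQ (fun x => φ.eval x) Jhat := hφb.1
    have e1 : Q.toFun (fun x => V₁.eval x * φ.eval x)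
        = Q.toFun (fun x => V.eval x * φ.eval x)
          - h / 2 * Q.toFun (fun x => T.eval x * φ.eval x) := by
      rw [← Q.map_smul _ _ ((hTs κQ).mul hφs), ← Q.toFun_sub
        ((contDiff_polynomial V).contDiffOn.mul hφs) (contDiffOn_const.mul ((hTs κQ).mul hφs))]
      congr 1; funext x
      rw [hV₁, eval_sub, eval_mul, eval_C]; ring
    have e2 := toFun_approx_sub (Q := Q) (A := A) hso hT hφ
      (hγ.of_le (by exact_mod_cast hkA))
    have e3 : Q.toFun (fun x => V₁.eval x * φ.eval x) + J * φ.eval (-1)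
        = h / 2 * Q.toFun (fun x => A.toFun (fun y => γ y - T.eval y) x * φ.eval x) := by
      rw [← e2, e1, mul_sub, ← hsys.var φ hφ]; ring
    have e4 := hQ _ _ ((hA η _ (hη.mono_order hkA)).mul zero_le_one hφb)
    rw [e3, abs_mul, abs_of_pos (by positivity)]
    calc h / 2 * _ ≤ h / 2 * (CQ * (2 ^ κQ * (CA * η * b))) := by gcongr
      _ ≤ h * (CQ * (2 ^ κQ * (CA * η * B))) := by
          have : 0 ≤ CQ * (2 ^ κQ * (CA * η * B)) := by positivity
          calc _ ≤ h / 2 * (CQ * (2 ^ κQ * (CA * η * B))) := by gcongr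
            _ ≤ _ := mul_le_mul_of_nonneg_right (by linarith) this
      _ = (D - 1) * (h * η) := by rw [hD]; ring
      _ ≤ D * (h * η) := by gcongr; linarith
  have hcoef := hK V₁ hV₁mem (D * (h * η)) (by positivity)
    (fun i hi => hder i (by rw [kJ]; omega) 1 one_mem_Jhat (hsys.right i hi))
    (fun i hi => hder i (by rw [kJ]; omega) (-1) neg_one_mem_Jhat (hsys.left i hi))
    (fun j hj => by
      have hJ0 : J * ((1 + X : ℝ[X]) ^ jumpExp k * X ^ j).eval (-1) = 0 := by
        rcases Nat.eq_zero_or_pos k with hk | hk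
        · simp [jumpExp, hk]
        · rw [hsys.jump hk, zero_mul]
      have hmem : ((1 + X : ℝ[X]) ^ jumpExp k * X ^ j) ∈ degreeLE ℝ (r - k : ℕ) := by
        rw [mem_degreeLE]
        refine (degree_le_natDegree).trans ?_
        have h1 : ((1 + X : ℝ[X]) ^ jumpExp k * X ^ j).natDegree ≤ jumpExp k + j := by
          refine natDegree_mul_le.trans (add_le_add ?_ (natDegree_X_pow_le j))
          refine natDegree_pow_le.trans ?_
          have : (1 + X : ℝ[X]).natDegree ≤ 1 := by
            rw [add_comm]; exact (natDegree_X_add_C (1 : ℝ)).le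
          calc _ ≤ jumpExp k * 1 := Nat.mul_le_mul_left _ this
            _ = _ := mul_one _
        have h2 : jumpExp k + j ≤ r - k := by
          unfold jumpExp; split_ifs <;> omega
        exact_mod_cast h1.trans h2
      have := hvar _ hmem _ (hBle j hj) (hBφ j)
      rw [hJ0, add_zero] at this
      rw [Integrator.onPoly_apply]
      simpa only [eval_mul] using this)
  refine ⟨fun i => (hcoef i).trans ?_, ?_⟩
  · rw [← mul_assoc]
    refine mul_le_mul_of_nonneg_right ?_ hhη
    have : 0 ≤ CQ * (polyConst κQ r * (K * D)) + D := by positivity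
    linarith
  · -- testing with the constant `1` isolates the jump
    have h1 := hvar 1 (by rw [mem_degreeLE]; exact degree_one_le.trans (by positivity)) 1 hB1
      (by simpa using Scaled.const (N := κQ) zero_le_one (1 : ℝ))
    have h2 := hQ _ _ (scaled_polynomial (N := κQ) one_pos le_rfl hV₁mem
      (R := K * (D * (h * η))) (by simpa using hcoef))
    simp only [eval_one, mul_one] at h1
    calc |J| = |(Q.toFun (fun x => V₁.eval x) + J) - Q.toFun (fun x => V₁.eval x)| := by
          congr 1; ring
      _ ≤ D * (h * η) + CQ * (polyConst κQ r * (K * (D * (h * η)))) :=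
          (abs_sub _ _).trans (add_le_add h1 h2)
      _ = (CQ * (polyConst κQ r * (K * D)) + D) * (h * η) := by ring
      _ ≤ C' * (h * η) := by
          refine mul_le_mul_of_nonneg_right ?_ hhη
          have : 0 ≤ K * D := by positivity
          linarith

/-! ### The local problem on the reference interval -/

/-- The pull-back of an `ℝ^d`-valued polynomial on `[a,b]` to the reference interval. -/
noncomputable def hatPoly {d : ℕ} (a b : ℝ) (p : Fin d → ℝ[X]) : Fin d → ℝ[X] :=
  fun c => (p c).comp (C ((a + b) / 2) + C ((b - a) / 2) * X)

lemma eval_hatPoly {d : ℕ} (a b : ℝ) (p : Fin d → ℝ[X]) (c : Fin d) (x : ℝ) :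
    (hatPoly a b p c).eval x = (p c).eval (aff a b x) := by
  simp [hatPoly, aff]

lemma pval_hatPoly {d : ℕ} (a b : ℝ) (p : Fin d → ℝ[X]) (x : ℝ) :
    pval (hatPoly a b p) x = pval p (aff a b x) := by
  ext c; exact eval_hatPoly a b p c x

lemma natDegree_affine_le (y z : ℝ) : (C y + C z * X : ℝ[X]).natDegree ≤ 1 := by
  rw [add_comm]; exact natDegree_linear_le

lemma comp_affine_mem_degreeLE {s : ℕ} {φ : ℝ[X]} (hφ : φ ∈ degreeLE ℝ s) (y z : ℝ) :
    φ.comp (C y + C z * X) ∈ degreeLE ℝ s := by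
  rw [mem_degreeLE, ← natDegree_le_iff_degree_le] at *
  calc _ ≤ φ.natDegree * (C y + C z * X : ℝ[X]).natDegree := natDegree_comp_le
    _ ≤ s * 1 := Nat.mul_le_mul hφ (natDegree_affine_le y z)
    _ = s := mul_one s

lemma derivative_iterate_comp_affine (φ : ℝ[X]) (y z : ℝ) (i : ℕ) :
    derivative^[i] (φ.comp (C y + C z * X))
      = C (z ^ i) * (derivative^[i] φ).comp (C y + C z * X) := by
  induction i with
  | zero => simp
  | succ i ih =>
    rw [Function.iterate_succ_apply', ih, Function.iterate_succ_apply', derivative_C_mul,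
      derivative_comp]
    simp only [derivative_add, derivative_C, derivative_C_mul, derivative_X, zero_add, mul_one,
      pow_succ, C_mul]
    ring

lemma iteratedDerivWithin_apply {d n i : ℕ} {I : Set ℝ} (hI : UniqueDiffOn ℝ I) {g : ℝ → E d}
    (hg : ContDiffOn ℝ n g I) (hi : i ≤ n) {t : ℝ} (ht : t ∈ I) (c : Fin d) :
    iteratedDerivWithin i g I t c = iteratedDerivWithin i (fun s => g s c) I t := by
  let L : E d →L[ℝ] ℝ := EuclideanSpace.proj c
  have := L.iteratedFDerivWithin_comp_left (hg t ht) hI ht (i := i) (by exact_mod_cast hi)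
  rw [iteratedDerivWithin_eq_iteratedFDerivWithin, iteratedDerivWithin_eq_iteratedFDerivWithin]
  change _ = iteratedFDerivWithin ℝ i (L ∘ g) I t fun _ => 1
  rw [this]; rfl

/-- The local problem after transformation to the reference interval; `P` is the pull-back of the
discrete solution on `[a,b]`, a subinterval of `[t₀, t₀ + T]` of length at most `1`. -/
structure RefSolution {κQ κA d : ℕ} (r k : ℕ) (Q : Integrator κQ) (A : ApproxOp κA)
    (f : ℝ → E d → E d) (t₀ T a b : ℝ) (Uin : E d) (P : Fin d → ℝ[X]) : Prop where
  left_le : t₀ ≤ a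
  lt : a < b
  le_right : b ≤ t₀ + T
  le_one : b - a ≤ 1
  deg : ∀ c, P c ∈ degreeLT ℝ (r + 1)
  sys : ∀ c, ComponentSystem r k Q A (b - a) (fun x => f (aff a b x) (pval P x) c)
    (derivative (P c)) (pval P (-1) c - Uin c)

lemma SolvesLocal.refSolution {κQ κA d r k : ℕ} {Q : Integrator κQ} {A : ApproxOp κA}
    {f : ℝ → E d → E d} {t₀ T a b : ℝ} {Uin : E d} {p : Fin d → ℝ[X]}
    (hf : ContDiffOn ℝ (k / 2 : ℕ) (fun q : ℝ × E d => f q.1 q.2) (Icc t₀ (t₀ + T) ×ˢ univ))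
    (hp : SolvesLocal r k Q A f a b Uin p) (ha : t₀ ≤ a) (hab : a < b) (hb : b ≤ t₀ + T)
    (h1 : b - a ≤ 1) : RefSolution r k Q A f t₀ T a b Uin (hatPoly a b p) := by
  set P := hatPoly a b p with hP
  have h0 : 0 < b - a := sub_pos.mpr hab
  have hI : UniqueDiffOn ℝ (Icc a b) := uniqueDiffOn_Icc hab
  set g : ℝ → E d := fun t => f t (pval p t) with hg
  have hgs : ContDiffOn ℝ (k / 2 : ℕ) g (Icc a b) :=
    hf.comp (contDiffOn_id.prodMk (contDiff_pval p).contDiffOn)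
      fun t ht => ⟨Icc_subset_Icc ha hb ht, mem_univ _⟩
  have hγ : ∀ c, (fun x => f (aff a b x) (pval P x) c) = fun x => g (aff a b x) c := fun c => by
    funext x; rw [hP, pval_hatPoly]
  have hder : ∀ c i x, (derivative^[i] (derivative (P c))).eval x
      = ((b - a) / 2) ^ (i + 1) * (derivative^[i + 1] (p c)).eval (aff a b x) := by
    intro c i x
    rw [← Function.iterate_succ_apply derivative i, hP, hatPoly, derivative_iterate_comp_affine]
    simp [aff]
  have hend : ∀ c, ∀ i ≤ k / 2, ∀ x ∈ Jhat,
      pval (pder (i + 1) p) (aff a b x) = iteratedDerivWithin i g (Icc a b) (aff a b x) →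
      (derivative^[i] (derivative (P c))).eval x
        = (b - a) / 2 * iteratedDerivWithin i (fun x => f (aff a b x) (pval P x) c) Jhat x := by
    intro c i hi x hx hpi
    have hc : (derivative^[i + 1] (p c)).eval (aff a b x)
        = iteratedDerivWithin i (fun t => g t c) (Icc a b) (aff a b x) := by
      rw [← iteratedDerivWithin_apply hI hgs hi (aff_mem hab.le hx), ← hpi]; rfl
    rw [hγ, iteratedDerivWithin_comp_aff hab.le hI le_rfl ((contDiffOn_piLp 2).mp hgs c) hi hx,
      hder, hc, smul_eq_mul, pow_succ]
    ring
  refine ⟨ha, hab, hb, h1, fun c => ?_, fun c => ⟨?_, fun i hi => ?_, fun i hi => ?_, fun hk => ?_,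
    fun φ hφ => ?_⟩⟩
  · rw [degreeLT_succ_eq_degreeLE]
    exact comp_affine_mem_degreeLE (hp.deg c) _ _
  · have hPc : P c ∈ degreeLE ℝ r := comp_affine_mem_degreeLE (hp.deg c) _ _
    rw [mem_degreeLE, ← natDegree_le_iff_degree_le] at hPc
    rw [mem_degreeLT, degree_lt_iff_coeff_zero]
    intro i hi
    rw [coeff_derivative, coeff_eq_zero_of_natDegree_lt (by omega), zero_mul]
  · refine hend c i (by omega) 1 one_mem_Jhat ?_
    rw [aff_one]; exact hp.right i hi
  · refine hend c i (by omega) (-1) neg_one_mem_Jhat ?_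
    rw [aff_neg_one]; exact hp.left i hi
  · rw [hP, pval_hatPoly, aff_neg_one, hp.init hk, sub_self]
  · set Φ : Fin d → ℝ[X] := Pi.single c (φ.comp (C (-(a + b) / (b - a)) + C (2 / (b - a)) * X))
      with hΦ
    have hΦval : ∀ x, pval Φ (aff a b x) = φ.eval x • EuclideanSpace.single c (1 : ℝ) := by
      intro x
      ext j
      rcases eq_or_ne j c with rfl | hj
      · have e : -(a + b) / (b - a) + 2 / (b - a) * aff a b x = x := by
          rw [aff]; field_simp; ring
        change (Φ j).eval _ = _
        rw [hΦ, Pi.single_eq_same, eval_comp, eval_add, eval_C, eval_mul, eval_C, eval_X, e]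
        simp
      · simp [pval, hΦ, hj]
    have hΦdeg : PDegLE (r - k) Φ := by
      intro j
      rcases eq_or_ne j c with rfl | hj
      · rw [hΦ, Pi.single_eq_same]; exact comp_affine_mem_degreeLE hφ _ _
      · rw [hΦ, Pi.single_eq_of_ne hj]; exact Submodule.zero_mem _
    have hinner : ∀ (v : E d) (x : ℝ), inner ℝ v (pval Φ (aff a b x)) = v c * φ.eval x := by
      intro v x
      rw [hΦval, inner_smul_right, EuclideanSpace.inner_single_right]
      simp [mul_comm]
    have hv := hp.var Φ hΦdeg
    have e1 : Q.loc a b (fun t => inner ℝ (pval (pder 1 p) t) (pval Φ t))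
        = Q.toFun (fun x => (derivative (P c)).eval x * φ.eval x) := by
      simp only [Integrator.loc, hinner]
      rw [← Q.map_smul ((b - a) / 2) (fun x => pval (pder 1 p) (aff a b x) c * φ.eval x)
        (((contDiff_piLp 2).mp ((contDiff_pval (pder 1 p)).comp
        (contDiff_aff a b)) c).contDiffOn.mul (contDiff_polynomial φ).contDiffOn)]
      congr 1; funext x
      have := hder c 0 x
      simp only [Function.iterate_zero, id_eq, zero_add, pow_one, Function.iterate_one] at this
      rw [this]
      simp only [pval, pder, Function.iterate_one]; ring
    have e2 : Q.loc a b (fun t => inner ℝ (A.loc a b (fun s => f s (pval p s)) t) (pval Φ t))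
        = (b - a) / 2 * Q.toFun (fun x =>
            A.toFun (fun x => f (aff a b x) (pval P x) c) x * φ.eval x) := by
      simp only [Integrator.loc, hinner]
      congr 2; funext x
      simp only [ApproxOp.loc, ApproxOp.vec, affInv_aff hab, hP, pval_hatPoly]
    have e3 : (if k = 0 then inner ℝ (pval p a - Uin) (pval Φ a) else 0)
        = (pval P (-1) c - Uin c) * φ.eval (-1) := by
      have := hinner (pval p a - Uin) (-1)
      rw [aff_neg_one] at this
      split_ifs with hk
      · rw [this, hP, pval_hatPoly, aff_neg_one]; rfl
      · rw [hP, pval_hatPoly, aff_neg_one, hp.init (Nat.one_le_iff_ne_zero.mpr hk), sub_self,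
          zero_mul]
    rw [e1, e2, e3] at hv
    exact hv

/-! ### A priori bounds and bounded derivatives of the discrete solution -/

/-- The constants of the method and of the right-hand side: stability of the reference operators and
of the linear system, and the Lipschitz constant for total derivatives. -/
structure StabData {κQ κA d : ℕ} (r k : ℕ) (Q : Integrator κQ) (A : ApproxOp κA)
    (f : ℝ → E d → E d) (t₀ T CQ CA L CL : ℝ) : Prop where
  CQ_nonneg : 0 ≤ CQ
  CA_nonneg : 0 ≤ CA
  L_nonneg : 0 ≤ L
  CL_nonneg : 0 ≤ CL
  integ : ∀ (η : ℝ) (v : ℝ → ℝ), Scaled κQ 1 η v → |Q.toFun v| ≤ CQ * η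
  approx : ∀ (η : ℝ) (v : ℝ → ℝ), Scaled (max κA κQ) 1 η v → Scaled κQ 1 (CA * η) (A.toFun v)
  system : ∀ (h : ℝ) (γ : ℝ → ℝ) (V : ℝ[X]) (J : ℝ), 0 < h →
      ComponentSystem r k Q A h γ V J → ∀ s ≤ r, (s : ℕ∞) ≤ ordSucc Q A (r - k) →
      ∀ S ∈ degreeLT ℝ s, ∀ η : ℝ, Scaled (kJ k κQ κA) 1 η (fun x => γ x - S.eval x) →
      (∀ i, |(V - C (h / 2) * S).coeff i| ≤ L * (h * η)) ∧ |J| ≤ L * (h * η)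
  lip : ∀ a b : ℝ, t₀ ≤ a → a < b → b ≤ t₀ + T → b - a ≤ 1 →
      ∀ P W : Fin d → ℝ[X], (∀ c, P c ∈ degreeLT ℝ (r + 1)) → (∀ c, W c ∈ degreeLT ℝ (r + 1)) →
      ∀ η : ℝ, (∀ c i, |(P c).coeff i - (W c).coeff i| ≤ η) →
      Scaled (kJ k κQ κA) 1 (CL * η)
        (fun x => f (aff a b x) (pval P x) - f (aff a b x) (pval W x))

lemma abs_eval_sub_coeff_zero_le {r : ℕ} {P : ℝ[X]} (hP : P ∈ degreeLT ℝ (r + 1)) {ε : ℝ}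
    (hc : ∀ i, |P.coeff (i + 1)| ≤ ε) {x : ℝ} (hx : x ∈ Jhat) :
    |P.eval x - P.coeff 0| ≤ r * ε := by
  rw [eval_eq_sum_of_mem_degreeLT hP, Finset.sum_range_succ', pow_zero, mul_one, add_sub_cancel_right]
  refine (Finset.abs_sum_le_sum_abs _ _).trans ((Finset.sum_le_card_nsmul _ _ ε fun i _ => ?_).trans
    (by simp))
  rw [abs_mul, abs_pow]
  exact (mul_le_of_le_one_right (abs_nonneg _) (pow_le_one₀ (abs_nonneg _) (abs_le.mpr hx))).trans
    (hc i)

lemma abs_coeff_succ_le (P : ℝ[X]) (i : ℕ) : |P.coeff (i + 1)| ≤ |(derivative P).coeff i| := by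
  rw [coeff_derivative, abs_mul]
  refine le_mul_of_one_le_right (abs_nonneg _) ?_
  rw [abs_of_nonneg (by positivity)]
  linarith [(Nat.cast_nonneg i : (0 : ℝ) ≤ i)]

section Bounds

variable {κQ κA d r k : ℕ} {Q : Integrator κQ} {A : ApproxOp κA} {f : ℝ → E d → E d}
  {t₀ T CQ CA L CL : ℝ}

/-- For small steps the discrete solution grows at most by the factor `1 + O(h)`: the global
Lipschitz condition gives linear growth of the right-hand side. -/
lemma StabData.exists_apriori (D : StabData r k Q A f t₀ T CQ CA L CL) (hT : 0 < T)
    (hf : ContDiffOn ℝ (kJ k κQ κA) (fun q : ℝ × E d => f q.1 q.2) (Icc t₀ (t₀ + T) ×ˢ univ)) :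
    ∃ K : ℝ, 0 ≤ K ∧ ∃ h₀ : ℝ, 0 < h₀ ∧ ∀ (a b : ℝ) (Uin : E d) (P : Fin d → ℝ[X]),
      RefSolution r k Q A f t₀ T a b Uin P → b - a ≤ h₀ →
      (∀ c i, |(P c).coeff i| ≤ K * (1 + ‖Uin‖)) ∧
      ‖pval P 1 - Uin‖ ≤ K * (b - a) * (1 + ‖Uin‖) := by
  obtain ⟨B, hB0, hB⟩ := exists_scaled_comp (kJ k κQ κA) (r + 1) hT hf 0
  have hL0 := D.L_nonneg
  have hCL0 := D.CL_nonneg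
  set M₁ : ℝ := d * (r + 1 : ℕ) with hM₁
  have hM0 : 0 ≤ M₁ := by positivity
  set G : ℝ := M₁ * ((r + 1) * L * CL) with hG
  have hG0 : 0 ≤ G := by positivity
  set K₁ : ℝ := 2 * M₁ * (1 + (r + 1) * L * B) with hK₁
  have hK₁0 : 0 ≤ K₁ := by positivity
  set K₂ : ℝ := d * ((2 * r + 1) * (L * (CL * K₁ + B))) with hK₂
  have hK₂0 : 0 ≤ K₂ := by positivity
  refine ⟨K₁ + K₂, by positivity, 1 / (2 * (G + 1)), by positivity,
    fun a b Uin P hP hh => ?_⟩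
  set h := b - a with hhdef
  have h0 : 0 < h := sub_pos.mpr hP.lt
  have h1 : h ≤ 1 := hP.le_one
  have hU0 := norm_nonneg Uin
  set μ : ℝ := ∑ c, ∑ i ∈ Finset.range (r + 1), |(P c).coeff i| with hμ
  have hμ0 : 0 ≤ μ := Finset.sum_nonneg fun _ _ => Finset.sum_nonneg fun _ _ => abs_nonneg _
  have hcμ : ∀ c i, |(P c).coeff i| ≤ μ := by
    intro c i
    by_cases hi : i < r + 1
    · exact (Finset.single_le_sum (f := fun i => |(P c).coeff i|) (fun _ _ => abs_nonneg _)
        (Finset.mem_range.mpr hi)).trans (Finset.single_le_sum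
          (f := fun c => ∑ i ∈ Finset.range (r + 1), |(P c).coeff i|)
          (fun _ _ => Finset.sum_nonneg fun _ _ => abs_nonneg _) (Finset.mem_univ c))
    · rw [coeff_eq_zero_of_degree_lt ((mem_degreeLT.mp (hP.deg c)).trans_le
        (by exact_mod_cast not_lt.mp hi)), abs_zero]
      exact hμ0
  set Z : Fin d → ℝ[X] := fun _ => 0 with hZ
  have e1 := D.lip a b hP.left_le hP.lt hP.le_right h1 P Z hP.deg
    (fun c => Submodule.zero_mem _) μ (fun c i => by simpa [hZ] using hcμ c i)
  have e2 := (hB a b hP.left_le hP.lt hP.le_right h1 Z (fun c => Submodule.zero_mem _)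
    (fun c i => by simp [hZ])).mono h0.le h1 le_rfl
  have e3 : Scaled (kJ k κQ κA) 1 (CL * μ + B) (fun x => f (aff a b x) (pval P x)) :=
    (e1.add e2).congr fun x _ => by simp
  set ε : ℝ := L * (h * (CL * μ + B)) with hε
  have hε0 : 0 ≤ ε := by positivity
  have hsys := fun c => D.system h _ _ _ h0 (hP.sys c) 0 (Nat.zero_le _) (by simp) 0
    (Submodule.zero_mem _) (CL * μ + B) ((e3.component c).congr fun x _ => by simp)
  have hhigh : ∀ c i, |(P c).coeff (i + 1)| ≤ ε := fun c i =>
    (abs_coeff_succ_le _ i).trans (by simpa using (hsys c).1 i)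
  have hJ : ∀ c, |(P c).eval (-1) - Uin c| ≤ ε := fun c => (hsys c).2
  have hev : ∀ c, ∀ x ∈ Jhat, |(P c).eval x - (P c).coeff 0| ≤ r * ε := fun c x hx =>
    abs_eval_sub_coeff_zero_le (hP.deg c) (hhigh c) hx
  have hcoef : ∀ c i, |(P c).coeff i| ≤ ‖Uin‖ + (r + 1) * ε := by
    intro c i
    rcases i with _ | i
    · have a1 := abs_le.mp (hev c (-1) neg_one_mem_Jhat)
      have a2 := abs_le.mp (hJ c)
      have a3 := abs_le.mp (abs_apply_le_norm Uin c)
      rw [abs_le]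
      constructor <;> linarith [a1.1, a1.2, a2.1, a2.2, a3.1, a3.2]
    · have : 0 ≤ (r : ℝ) * ε := by positivity
      linarith [hhigh c i]
  have hμle : μ ≤ M₁ * (‖Uin‖ + (r + 1) * ε) := by
    calc μ ≤ ∑ c : Fin d, ∑ i ∈ Finset.range (r + 1), (‖Uin‖ + (r + 1) * ε) :=
          Finset.sum_le_sum fun c _ => Finset.sum_le_sum fun i _ => hcoef c i
      _ = _ := by simp [hM₁]; ring
  have hGh : G * h ≤ 1 / 2 := by
    have : h * (2 * (G + 1)) ≤ 1 := by rwa [le_div_iff₀ (by positivity)] at hh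
    nlinarith
  -- the contribution of `μ` on the right is absorbed
  have hμK : μ ≤ K₁ * (1 + ‖Uin‖) := by
    have i1 : M₁ * (‖Uin‖ + (r + 1) * ε)
        = M₁ * ‖Uin‖ + G * h * μ + M₁ * ((r + 1) * L * B) * h := by
      rw [hε, hG]; ring
    have i2 : G * h * μ ≤ 1 / 2 * μ := mul_le_mul_of_nonneg_right hGh hμ0
    have i3 : M₁ * ((r + 1) * L * B) * h ≤ M₁ * ((r + 1) * L * B) :=
      mul_le_of_le_one_right (by positivity) h1
    have i4 : K₁ * (1 + ‖Uin‖) = 2 * (M₁ * ‖Uin‖) + 2 * M₁ + 2 * (M₁ * ((r + 1) * L * B))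
        + 2 * (M₁ * ((r + 1) * L * B)) * ‖Uin‖ := by rw [hK₁]; ring
    have i5 : 0 ≤ 2 * (M₁ * ((r + 1) * L * B)) * ‖Uin‖ := by positivity
    linarith
  refine ⟨fun c i => (hcμ c i).trans (hμK.trans ?_), ?_⟩
  · exact mul_le_mul_of_nonneg_right (by linarith) (by positivity)
  have hεle : ε ≤ L * (CL * K₁ + B) * h * (1 + ‖Uin‖) := by
    have : CL * μ + B ≤ (CL * K₁ + B) * (1 + ‖Uin‖) := by
      have j1 : CL * μ ≤ CL * (K₁ * (1 + ‖Uin‖)) := mul_le_mul_of_nonneg_left hμK hCL0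
      have j2 : 0 ≤ B * ‖Uin‖ := by positivity
      linarith
    calc ε ≤ L * (h * ((CL * K₁ + B) * (1 + ‖Uin‖))) := by rw [hε]; gcongr
      _ = _ := by ring
  have hdiff : ∀ c, |(pval P 1 - Uin) c| ≤ (2 * r + 1) * ε := by
    intro c
    change |(P c).eval 1 - Uin c| ≤ _
    have a1 := abs_le.mp (hev c (-1) neg_one_mem_Jhat)
    have a2 := abs_le.mp (hJ c)
    have a3 := abs_le.mp (hev c 1 one_mem_Jhat)
    rw [abs_le]
    constructor <;> linarith [a1.1, a1.2, a2.1, a2.2, a3.1, a3.2]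
  calc ‖pval P 1 - Uin‖ ≤ d * ((2 * r + 1) * ε) := norm_le_card_mul hdiff
    _ ≤ d * ((2 * r + 1) * (L * (CL * K₁ + B) * h * (1 + ‖Uin‖))) := by gcongr
    _ = K₂ * h * (1 + ‖Uin‖) := by rw [hK₂]; ring
    _ ≤ (K₁ + K₂) * h * (1 + ‖Uin‖) := by gcongr; linarith

/-- The part of degree less than `n` of a polynomial. -/
noncomputable def truncPoly (n : ℕ) (P : ℝ[X]) : ℝ[X] :=
  ∑ i ∈ Finset.range n, monomial i (P.coeff i)

lemma coeff_truncPoly (n : ℕ) (P : ℝ[X]) (i : ℕ) :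
    (truncPoly n P).coeff i = if i < n then P.coeff i else 0 := by
  simp [truncPoly, coeff_monomial]

lemma truncPoly_mem (n : ℕ) (P : ℝ[X]) : truncPoly n P ∈ degreeLT ℝ n := by
  rw [mem_degreeLT, degree_lt_iff_coeff_zero]
  intro i hi
  rw [coeff_truncPoly, if_neg (not_lt.mpr hi)]

/-- Bootstrap: as long as the method is exact on `P_{s-1}`, bounds for the physical derivatives of
the discrete solution up to order `s` improve to order `s + 1`. In terms of the coefficients of the
pull-back, bounded physical derivatives mean that the `i`-th coefficient is `O(h^i)`. -/
lemma StabData.exists_coeff_le_pow_min (D : StabData r k Q A f t₀ T CQ CA L CL) (hT : 0 < T)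
    {N : ℕ} (hN : kJ k κQ κA ≤ N) (hrN : r ≤ N)
    (hf : ContDiffOn ℝ N (fun q : ℝ × E d => f q.1 q.2) (Icc t₀ (t₀ + T) ×ˢ univ))
    (hord : (r : ℕ∞) ≤ ordSucc Q A (r - k) + 1) {R : ℝ} (hR : 0 ≤ R) (s : ℕ) (hs : s ≤ r) :
    ∃ K : ℝ, 0 ≤ K ∧ ∀ (a b : ℝ) (Uin : E d) (P : Fin d → ℝ[X]),
      RefSolution r k Q A f t₀ T a b Uin P → (∀ c i, |(P c).coeff i| ≤ R) →
      ∀ c i, |(P c).coeff i| ≤ K * (b - a) ^ (min i s) := by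
  induction s with
  | zero => exact ⟨R, hR, fun a b Uin P hP hPR c i => by simpa using hPR c i⟩
  | succ s ih =>
    obtain ⟨K, hK0, hK⟩ := ih (by omega)
    have hso : (s : ℕ∞) ≤ ordSucc Q A (r - k) := by
      have h1 : ((s + 1 : ℕ) : ℕ∞) ≤ ordSucc Q A (r - k) + 1 :=
        le_trans (by exact_mod_cast hs) hord
      rw [Nat.cast_add, Nat.cast_one] at h1
      exact (ENat.add_le_add_iff_right ENat.one_ne_top).mp h1
    obtain ⟨B, hB0, hB⟩ := exists_scaled_comp N (s + 1) hT hf K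
    have hL0 := D.L_nonneg
    have hCL0 := D.CL_nonneg
    set K' := R + (B + L * (B + CL * K)) with hK'
    refine ⟨K', by positivity, fun a b Uin P hP hPR c i => ?_⟩
    set h := b - a with hh
    have h0 : 0 < h := sub_pos.mpr hP.lt
    have h1 : h ≤ 1 := hP.le_one
    have hKP := hK a b Uin P hP hPR
    set W : Fin d → ℝ[X] := fun c => truncPoly (s + 1) (P c) with hW
    have hWs : ∀ c, W c ∈ degreeLT ℝ (s + 1) := fun c => truncPoly_mem _ _
    have e1 := D.lip a b hP.left_le hP.lt hP.le_right h1 P W hP.deg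
      (fun c => degreeLT_mono (by omega) (hWs c)) (K * h ^ s) (fun c i => by
        rw [hW, coeff_truncPoly]
        split_ifs with hi
        · rw [sub_self, abs_zero]; positivity
        · rw [sub_zero]
          have := hKP c i
          rwa [min_eq_right (by omega)] at this)
    have e2 := (hB a b hP.left_le hP.lt hP.le_right h1 W hWs (fun c i => by
        rw [hW, coeff_truncPoly]
        split_ifs with hi
        · have := hKP c i
          rwa [min_eq_left (by omega)] at this
        · rw [abs_zero]; positivity)).component c
    set S := taylorPoly s (fun x => f (aff a b x) (pval W x) c) with hS
    have e3 := (e2.sub_taylorPoly h0.le h1 (s := s) (by omega)).mono_order hN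
    have e4 : Scaled (kJ k κQ κA) 1 ((B + CL * K) * h ^ s)
        (fun x => f (aff a b x) (pval P x) c - S.eval x) :=
      ((e3.add (e1.component c)).mono_const zero_le_one (by rw [add_mul, mul_assoc])).congr
        fun x _ => by simp [hS]
    have hsys := (D.system h _ _ _ h0 (hP.sys c) s (by omega) hso S (taylorPoly_mem _ _) _ e4).1
    rcases i with _ | i
    · rw [Nat.zero_min, pow_zero, mul_one]
      have : 0 ≤ B + L * (B + CL * K) := by positivity
      linarith [hPR c 0]
    · have hmin : min (i + 1) (s + 1) = min i s + 1 := by omega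
      have hpow : h ^ s ≤ h ^ (min i s) := pow_le_pow_of_le_one h0.le h1 (min_le_right _ _)
      have hSc : |S.coeff i| ≤ B * h ^ (min i s) := by
        by_cases hi : i < s
        · rw [min_eq_left hi.le]
          exact e2.abs_coeff_taylorPoly_le h0.le (by omega) i
        · rw [hS, coeff_taylorPoly, if_neg hi, abs_zero]; positivity
      have hVc : (derivative (P c)).coeff i
          = (derivative (P c) - C (h / 2) * S).coeff i + h / 2 * S.coeff i := by
        rw [coeff_sub, coeff_C_mul]; ring
      calc |(P c).coeff (i + 1)| ≤ |(derivative (P c)).coeff i| := abs_coeff_succ_le _ _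
        _ ≤ L * (h * ((B + CL * K) * h ^ s)) + h / 2 * |S.coeff i| := by
            rw [hVc]
            refine (abs_add_le _ _).trans (add_le_add (hsys i) ?_)
            rw [abs_mul, abs_of_pos (by positivity)]
        _ ≤ L * (h * ((B + CL * K) * h ^ (min i s))) + h * (B * h ^ (min i s)) := by
            have : h / 2 ≤ h := by linarith
            gcongr
        _ = (B + L * (B + CL * K)) * h ^ (min i s + 1) := by rw [pow_succ]; ring
        _ ≤ K' * h ^ (min (i + 1) (s + 1)) := by
            rw [hmin]
            exact mul_le_mul_of_nonneg_right (by rw [hK']; linarith) (by positivity)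

/-- The pull-back of the defect `U' - f(·,U)`, multiplied by half the step length. -/
noncomputable def defect (f : ℝ → E d → E d) (a b : ℝ) (P : Fin d → ℝ[X]) (c : Fin d) (x : ℝ) : ℝ :=
  (derivative (P c)).eval x - (b - a) / 2 * f (aff a b x) (pval P x) c

/-- The discrete solution has bounded derivatives, hence so have `f(·,U)` and the defect. Moreover
the defect and the jump are small, to the order on which the method is exact. -/
lemma StabData.exists_defect_bounds (D : StabData r k Q A f t₀ T CQ CA L CL) (hT : 0 < T)
    {N : ℕ} (hN : kJ k κQ κA ≤ N) (hrN : r ≤ N)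
    (hf : ContDiffOn ℝ N (fun q : ℝ × E d => f q.1 q.2) (Icc t₀ (t₀ + T) ×ˢ univ))
    (hord : (r : ℕ∞) ≤ ordSucc Q A (r - k) + 1) {q : ℕ} (hqr : q ≤ r)
    (hqo : (q : ℕ∞) ≤ ordSucc Q A (r - k)) {R : ℝ} (hR : 0 ≤ R) :
    ∃ K : ℝ, 0 ≤ K ∧ ∀ (a b : ℝ) (Uin : E d) (P : Fin d → ℝ[X]),
      RefSolution r k Q A f t₀ T a b Uin P → (∀ c i, |(P c).coeff i| ≤ R) →
      (∀ c i, |(P c).coeff i| ≤ K * (b - a) ^ i) ∧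
      ∀ c, Scaled N (b - a) K (fun x => f (aff a b x) (pval P x) c) ∧
        Scaled N (b - a) (K * (b - a)) (defect f a b P c) ∧
        Scaled N 1 (K * (b - a) ^ (q + 1)) (defect f a b P c) ∧
        |pval P (-1) c - Uin c| ≤ K * (b - a) ^ (q + 1) := by
  obtain ⟨K, hK0, hK⟩ := D.exists_coeff_le_pow_min hT hN hrN hf hord hR r le_rfl
  obtain ⟨B, hB0, hB⟩ := exists_scaled_comp N (r + 1) hT hf K
  have hL0 := D.L_nonneg
  have hp0 := polyConst_nonneg N r
  set K' := K + B + (polyConst N r * (r * K) + B) + (polyConst N r * (L * B) + B) + L * B with hK'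
  have t1 : 0 ≤ polyConst N r * (r * K) := by positivity
  have t2 : 0 ≤ polyConst N r * (L * B) := by positivity
  have t3 : 0 ≤ L * B := by positivity
  refine ⟨K', by positivity, fun a b Uin P hP hPR => ?_⟩
  set h := b - a with hh
  have h0 : 0 < h := sub_pos.mpr hP.lt
  have h1 : h ≤ 1 := hP.le_one
  have hc : ∀ c i, |(P c).coeff i| ≤ K * h ^ i := by
    intro c i
    by_cases hi : i < r + 1
    · have := hK a b Uin P hP hPR c i
      rwa [min_eq_left (by omega)] at this
    · rw [coeff_eq_zero_of_degree_lt ((mem_degreeLT.mp (hP.deg c)).trans_le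
        (by exact_mod_cast not_lt.mp hi)), abs_zero]
      positivity
  have hg := hB a b hP.left_le hP.lt hP.le_right h1 P hP.deg hc
  refine ⟨fun c i => (hc c i).trans (mul_le_mul_of_nonneg_right (by linarith) (by positivity)),
    fun c => ?_⟩
  have hgc := hg.component c
  have hγh := hgc.const_mul (h / 2)
  have hhabs : |h / 2| = h / 2 := abs_of_pos (by positivity)
  refine ⟨hgc.mono_const h0.le (by linarith), ?_, ?_⟩
  · have hV : Scaled N h (polyConst N r * (r * K * h)) (fun x => (derivative (P c)).eval x) := by
      refine scaled_polynomial h0 h1 (hP.sys c).deg fun i => ?_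
      by_cases hi : i < r
      · rw [coeff_derivative, abs_mul]
        have i1 : |((i : ℝ) + 1)| ≤ r := by
          rw [abs_of_nonneg (by positivity)]; exact_mod_cast hi
        calc _ ≤ K * h ^ (i + 1) * r := mul_le_mul (hc c _) i1 (abs_nonneg _) (by positivity)
          _ = _ := by rw [pow_succ]; ring
      · rw [coeff_eq_zero_of_degree_lt ((mem_degreeLT.mp (hP.sys c).deg).trans_le
          (by exact_mod_cast not_lt.mp hi)), abs_zero]
        positivity
    refine (hV.sub hγh).mono_const h0.le ?_
    rw [hhabs]
    have : h / 2 * B ≤ h * B := by gcongr; linarith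
    calc _ ≤ polyConst N r * (r * K * h) + h * B := by linarith
      _ = (polyConst N r * (r * K) + B) * h := by ring
      _ ≤ K' * h := mul_le_mul_of_nonneg_right (by linarith) h0.le
  · set S := taylorPoly q (fun x => f (aff a b x) (pval P x) c) with hS
    have e3 := hgc.sub_taylorPoly h0.le h1 (s := q) (by omega)
    obtain ⟨hsys, hJ⟩ := D.system h _ _ _ h0 (hP.sys c) q hqr hqo S (taylorPoly_mem _ _) _
      (e3.mono_order hN)
    have hmem : derivative (P c) - C (h / 2) * S ∈ degreeLT ℝ r := by
      refine Submodule.sub_mem _ (hP.sys c).deg ?_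
      rw [← smul_eq_C_mul]
      exact Submodule.smul_mem _ _ (degreeLT_mono hqr (taylorPoly_mem _ _))
    have e5 := scaled_polynomial (N := N) one_pos le_rfl hmem (R := L * (h * (B * h ^ q)))
      (by simpa using hsys)
    have e6 := e5.sub (e3.const_mul (h / 2))
    constructor
    · refine (e6.mono_const zero_le_one (B' := K' * h ^ (q + 1)) ?_).congr fun x _ => ?_
      · rw [hhabs]
        have : h / 2 * (B * h ^ q) ≤ h * (B * h ^ q) := by gcongr; linarith
        calc _ ≤ polyConst N r * (L * (h * (B * h ^ q))) + h * (B * h ^ q) := by linarith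
          _ = (polyConst N r * (L * B) + B) * h ^ (q + 1) := by rw [pow_succ]; ring
          _ ≤ K' * h ^ (q + 1) := mul_le_mul_of_nonneg_right (by linarith) (by positivity)
      · simp only [defect, eval_sub, eval_mul, eval_C]; ring
    · calc _ ≤ L * (h * (B * h ^ q)) := hJ
        _ = L * B * h ^ (q + 1) := by rw [pow_succ]; ring
        _ ≤ K' * h ^ (q + 1) := mul_le_mul_of_nonneg_right (by linarith) (by positivity)

end Bounds

/-! ### The defect tested with smooth functions -/

lemma natCast_sub_le_of_le_add {p i : ℕ} {o : ℕ∞} (h : (p : ℕ∞) ≤ o + (i : ℕ∞)) :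
    ((p - i : ℕ) : ℕ∞) ≤ o := by
  cases o with
  | top => exact le_top
  | coe n =>
    have : p ≤ n + i := by exact_mod_cast h
    exact_mod_cast (by omega : p - i ≤ n)

lemma le_ordSucc_add_of_le_varSucc {κQ κA r k p i : ℕ} {Q : Integrator κQ} {A : ApproxOp κA}
    (hp : (p : ℕ∞) ≤ varSucc r k Q A) (hi : i ≤ r - k) : (p : ℕ∞) ≤ ordSucc Q A i + (i : ℕ∞) :=
  hp.trans (Finset.inf_le (Finset.mem_range.mpr (by omega)))

lemma intervalIntegrable_of_continuousOn_Jhat {v : ℝ → ℝ} (hv : ContinuousOn v Jhat) :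
    IntervalIntegrable v volume (-1) 1 := by
  refine ContinuousOn.intervalIntegrable ?_
  rwa [uIcc_of_le (by norm_num)]

lemma abs_integral_Jhat_le {v : ℝ → ℝ} {η : ℝ} (hv : ∀ x ∈ Jhat, |v x| ≤ η) :
    |∫ x in (-1 : ℝ)..1, v x| ≤ 2 * η := by
  have := intervalIntegral.norm_integral_le_of_norm_le_const (a := -1) (b := 1) (C := η) (f := v)
    (fun x hx => by
      rw [uIoc_of_le (by norm_num)] at hx
      exact hv x ⟨hx.1.le, hx.2⟩)
  rw [Real.norm_eq_abs] at this
  refine this.trans_eq ?_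
  norm_num; ring

section Weighted

variable {κQ κA r k : ℕ} {Q : Integrator κQ} {A : ApproxOp κA} {CQ CA : ℝ} {N : ℕ} {h K : ℝ}

lemma scaled_X_pow {i : ℕ} (hi : i ≤ r) :
    Scaled N 1 ((2 ^ N) ^ r) (fun x : ℝ => (X ^ i : ℝ[X]).eval x) := by
  have h1 : (1 : ℝ) ≤ 2 ^ N := one_le_pow₀ (by norm_num)
  refine ((Scaled.pow_id (N := N) zero_le_one le_rfl i).mono_const zero_le_one
    (pow_le_pow_right₀ h1 hi)).congr fun x _ => by simp

/-- The consistency error of the approximation operator, tested with a monomial. -/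
lemma abs_consistency_monomial_le
    (hQ : ∀ (η : ℝ) (v : ℝ → ℝ), Scaled κQ 1 η v → |Q.toFun v| ≤ CQ * η)
    (hA : ∀ (η : ℝ) (v : ℝ → ℝ), Scaled (max κA κQ) 1 η v → Scaled κQ 1 (CA * η) (A.toFun v))
    (hN : max κA κQ ≤ N) (h0 : 0 ≤ h) (h1 : h ≤ 1) {γ : ℝ → ℝ} (hγ : Scaled N h K γ) {i s : ℕ}
    (hi : i ≤ r) (hsN : s ≤ N) (hs : (s : ℕ∞) ≤ ordSucc Q A i) :
    |Q.toFun (fun x => A.toFun γ x * (X ^ i : ℝ[X]).eval x)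
        - Q.toFun (fun x => γ x * (X ^ i : ℝ[X]).eval x)|
      ≤ CQ * (2 ^ κQ * ((CA + 1) * K * (2 ^ κQ) ^ r)) * h ^ s := by
  have hT := taylorPoly_mem s γ
  set S := taylorPoly s γ with hS
  have hrem := hγ.sub_taylorPoly h0 h1 hsN
  have hX := scaled_X_pow (N := κQ) hi
  have hXmem : (X ^ i : ℝ[X]) ∈ degreeLE ℝ i := mem_degreeLE.mpr (degree_X_pow_le i)
  have hκ : κQ ≤ N := (le_max_right _ _).trans hN
  have e1 := toFun_approx_sub (Q := Q) (A := A) hs hT hXmem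
    (hγ.1.of_le (by exact_mod_cast hN))
  have hcγ : ContDiffOn ℝ κQ γ Jhat := (hγ.mono_order hκ).1
  have e2 := Q.toFun_sub (hcγ.mul hX.1) (((contDiff_polynomial S).contDiffOn (n := κQ)).mul hX.1)
  have b1 := hQ _ _ ((hA _ _ (hrem.mono_order hN)).mul zero_le_one hX)
  have b2 := hQ _ _ ((hrem.mono_order hκ).mul zero_le_one hX)
  have e3 : (fun x => (γ x - S.eval x) * (X ^ i : ℝ[X]).eval x)
      = fun x => γ x * (X ^ i : ℝ[X]).eval x - S.eval x * (X ^ i : ℝ[X]).eval x := by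
    funext x; ring
  rw [e3, e2] at b2
  rw [← e1] at b1
  calc _ = |(Q.toFun (fun x => A.toFun γ x * (X ^ i : ℝ[X]).eval x)
          - Q.toFun (fun x => S.eval x * (X ^ i : ℝ[X]).eval x))
        - (Q.toFun (fun x => γ x * (X ^ i : ℝ[X]).eval x)
          - Q.toFun (fun x => S.eval x * (X ^ i : ℝ[X]).eval x))| := by congr 1; ring
    _ ≤ _ := (abs_sub _ _).trans (add_le_add b1 b2)
    _ = _ := by ring

/-- The constant in `abs_weighted_defect_le`. -/
noncomputable def weightedConst (r N κQ : ℕ) (CQ CA K : ℝ) : ℝ :=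
  3 * K ^ 2 + (2 + CQ) * (2 ^ N * K ^ 2) + (CQ * 2 ^ N + 1) * K ^ 2
    + (r + 1 : ℕ) * (K * (CQ * (2 ^ κQ * ((CA + 1) * K * (2 ^ κQ) ^ r))))

/-- The defect together with the jump, tested with a smooth function `ψ`. If the plain bound of the
defect is not good enough, then the integral may be replaced by the integrator; the Taylor
polynomial of `ψ` is a test function of the method, which leaves the consistency error of the
approximation operator, and the Taylor remainder gains the factor `h^{r-k+1}`. -/
lemma abs_weighted_defect_le (hkr : k ≤ r) (hCQ : 0 ≤ CQ) (hCA : 0 ≤ CA)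
    (hQ : ∀ (η : ℝ) (v : ℝ → ℝ), Scaled κQ 1 η v → |Q.toFun v| ≤ CQ * η)
    (hA : ∀ (η : ℝ) (v : ℝ → ℝ), Scaled (max κA κQ) 1 η v → Scaled κQ 1 (CA * η) (A.toFun v))
    (hN : max κA κQ ≤ N) (hrN : 2 * r + 1 ≤ N) {p q : ℕ}
    (hp : (p : ℕ∞) ≤ superExp r k Q A) (hq : (q : ℕ∞) = min (r : ℕ∞) (ordSucc Q A (r - k)))
    (h0 : 0 < h) (h1 : h ≤ 1) {γ ψ : ℝ → ℝ} {V : ℝ[X]} {J : ℝ}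
    (hsys : ComponentSystem r k Q A h γ V J) (hγ : Scaled N h K γ) (hψ : Scaled N h K ψ)
    (hδ : Scaled N h (K * h) (fun x => V.eval x - h / 2 * γ x))
    (hδq : Scaled N 1 (K * h ^ (q + 1)) (fun x => V.eval x - h / 2 * γ x))
    (hJ : |J| ≤ K * h ^ (q + 1)) :
    |(∫ x in (-1 : ℝ)..1, (V.eval x - h / 2 * γ x) * ψ x) + J * ψ (-1)|
      ≤ weightedConst r N κQ CQ CA K * h ^ (p + 1) := by
  have hK0 : 0 ≤ K := hγ.nonneg
  set δ : ℝ → ℝ := fun x => V.eval x - h / 2 * γ x with hδdef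
  rw [superExp, le_min_iff, le_min_iff] at hp
  obtain ⟨hp1, hp2, hp3⟩ := hp
  have hp1' : p ≤ 2 * r - k + 1 := by exact_mod_cast hp1
  have hψb : |ψ (-1)| ≤ K := hψ.norm_le neg_one_mem_Jhat
  set G := CQ * (2 ^ κQ * ((CA + 1) * K * (2 ^ κQ) ^ r)) with hG
  have hG0 : 0 ≤ G := by positivity
  have w1 : 0 ≤ (2 + CQ) * (2 ^ N * K ^ 2) := by positivity
  have w2 : 0 ≤ (CQ * 2 ^ N + 1) * K ^ 2 := by positivity
  have w3 : 0 ≤ ((r + 1 : ℕ) : ℝ) * (K * G) := by positivity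
  have hpow : 0 ≤ h ^ (p + 1) := by positivity
  by_cases hpq : p ≤ q
  · have hle : h ^ (q + 1) ≤ h ^ (p + 1) := pow_le_pow_of_le_one h0.le h1 (by omega)
    have b1 := abs_integral_Jhat_le (v := fun x => δ x * ψ x) (η := K * h ^ (q + 1) * K)
      fun x hx => by
        rw [abs_mul]
        exact mul_le_mul (hδq.norm_le hx) (hψ.norm_le hx) (abs_nonneg _) (by positivity)
    have b2 : |J * ψ (-1)| ≤ K * h ^ (q + 1) * K := by
      rw [abs_mul]; exact mul_le_mul hJ hψb (abs_nonneg _) (by positivity)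
    calc _ ≤ _ := abs_add_le _ _
      _ ≤ 2 * (K * h ^ (q + 1) * K) + K * h ^ (q + 1) * K := add_le_add b1 b2
      _ = 3 * K ^ 2 * h ^ (q + 1) := by ring
      _ ≤ 3 * K ^ 2 * h ^ (p + 1) := by gcongr
      _ ≤ _ := mul_le_mul_of_nonneg_right (by rw [weightedConst]; linarith) hpow
  -- now the integrator is exact on polynomials of degree less than `p`
  have hex : (p : ℕ∞) ≤ exSucc Q := by
    rw [← hq] at hp3
    rcases le_max_iff.mp hp3 with h | h
    · exact h
    · exact absurd (by exact_mod_cast h) hpq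
  have hκ : κQ ≤ N := (le_max_right _ _).trans hN
  have hδc : ContDiffOn ℝ κQ δ Jhat := (hδ.mono_order hκ).1
  have hψc : ContDiffOn ℝ κQ ψ Jhat := (hψ.mono_order hκ).1
  have hpc : ∀ S : ℝ[X], ContDiffOn ℝ κQ (fun x => S.eval x) Jhat :=
    fun S => (contDiff_polynomial S).contDiffOn
  -- replacing the integral by the integrator
  have step1 : |(∫ x in (-1 : ℝ)..1, δ x * ψ x) - Q.toFun (fun x => δ x * ψ x)|
      ≤ (2 + CQ) * (2 ^ N * K ^ 2) * h ^ (p + 1) := by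
    have hχ := hδ.mul h0.le hψ
    have hrem := hχ.sub_taylorPoly h0.le h1 (s := p) (by omega)
    have hmem := taylorPoly_mem p (fun x => δ x * ψ x)
    set S := taylorPoly p (fun x => δ x * ψ x) with hS
    have hSc : ContinuousOn (fun x => S.eval x) Jhat := S.continuous.continuousOn
    have e1 := intervalIntegral.integral_sub
      (intervalIntegrable_of_continuousOn_Jhat hχ.1.continuousOn)
      (intervalIntegrable_of_continuousOn_Jhat hSc)
    have e2 := Q.toFun_sub (hδc.mul hψc) (hpc S)
    have e3 := integral_eq_of_le_exSucc hex hmem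
    have b1 := abs_integral_Jhat_le (v := fun x => δ x * ψ x - S.eval x) fun x hx =>
      hrem.norm_le hx
    have b2 := hQ _ _ (hrem.mono_order hκ)
    calc _ = |(∫ x in (-1 : ℝ)..1, (δ x * ψ x - S.eval x))
          - Q.toFun (fun x => δ x * ψ x - S.eval x)| := by
          rw [e1, e2, e3]; congr 1; ring
      _ ≤ _ := (abs_sub _ _).trans (add_le_add b1 b2)
      _ = _ := by ring
  have hmem : taylorPoly (r - k + 1) ψ ∈ degreeLE ℝ (r - k : ℕ) := by
    rw [← degreeLT_succ_eq_degreeLE]; exact taylorPoly_mem _ _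
  have hrem := hψ.sub_taylorPoly h0.le h1 (s := r - k + 1) (by omega)
  have hφcoef := fun i => hψ.abs_coeff_taylorPoly_le h0.le (s := r - k + 1) (by omega) i
  set φ := taylorPoly (r - k + 1) ψ with hφ
  -- the Taylor remainder of `ψ`
  have step2 : |Q.toFun (fun x => δ x * (ψ x - φ.eval x)) + J * (ψ (-1) - φ.eval (-1))|
      ≤ (CQ * 2 ^ N + 1) * K ^ 2 * h ^ (p + 1) := by
    have hexp : p + 1 ≤ (q + 1) + (r - k + 1) := by
      have hv := le_ordSucc_add_of_le_varSucc hp2 (le_refl (r - k))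
      have h3 : ((p - (r - k) : ℕ) : ℕ∞) ≤ min ((r + 1 : ℕ) : ℕ∞) (ordSucc Q A (r - k)) :=
        le_min (by exact_mod_cast (by omega : p - (r - k) ≤ r + 1)) (natCast_sub_le_of_le_add hv)
      have h4 : ((p - (r - k) : ℕ) : ℕ∞) ≤ (q : ℕ∞) + 1 := by
        refine h3.trans ?_
        rw [hq]
        rcases le_total (r : ℕ∞) (ordSucc Q A (r - k)) with h | h
        · rw [min_eq_left h]; exact (min_le_left _ _).trans (by push_cast; exact le_rfl)
        · rw [min_eq_right h]; exact (min_le_right _ _).trans le_self_add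
      have : p - (r - k) ≤ q + 1 := by exact_mod_cast h4
      omega
    have hle : h ^ ((q + 1) + (r - k + 1)) ≤ h ^ (p + 1) := pow_le_pow_of_le_one h0.le h1 hexp
    have b1 := hQ _ _ ((hδq.mul zero_le_one hrem).mono_order hκ)
    have b2 : |J * (ψ (-1) - φ.eval (-1))| ≤ K * h ^ (q + 1) * (K * h ^ (r - k + 1)) := by
      rw [abs_mul]
      exact mul_le_mul hJ (hrem.norm_le neg_one_mem_Jhat) (abs_nonneg _) (by positivity)
    calc _ ≤ _ := (abs_add_le _ _).trans (add_le_add b1 b2)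
      _ = (CQ * 2 ^ N + 1) * K ^ 2 * h ^ ((q + 1) + (r - k + 1)) := by rw [pow_add]; ring
      _ ≤ _ := by gcongr
  -- the test function `φ` of the method
  have step3 : |Q.toFun (fun x => δ x * φ.eval x) + J * φ.eval (-1)|
      ≤ (r + 1 : ℕ) * (K * G) * h ^ (p + 1) := by
    have hγc : ContDiffOn ℝ κQ γ Jhat := (hγ.mono_order hκ).1
    have hAγ : ContDiffOn ℝ κQ (A.toFun γ) Jhat := A.smooth κQ γ (hγ.mono_order hN).1
    have e1 : Q.toFun (fun x => δ x * φ.eval x)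
        = Q.toFun (fun x => V.eval x * φ.eval x) - h / 2 * Q.toFun (fun x => γ x * φ.eval x) := by
      rw [← Q.map_smul _ _ (hγc.mul (hpc φ)), ← Q.toFun_sub ((hpc V).mul (hpc φ))
        (contDiffOn_const.mul (hγc.mul (hpc φ)))]
      congr 1; funext x; rw [hδdef]; ring
    have esum : ∀ v : ℝ → ℝ, ContDiffOn ℝ κQ v Jhat → Q.toFun (fun x => v x * φ.eval x)
        = ∑ i ∈ Finset.range (r - k + 1),
          φ.coeff i * Q.toFun (fun x => v x * (X ^ i : ℝ[X]).eval x) := by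
      intro v hv
      have : (fun x => v x * φ.eval x) = fun x => ∑ i ∈ Finset.range (r - k + 1),
          φ.coeff i * (v x * (X ^ i : ℝ[X]).eval x) := by
        funext x
        rw [eval_eq_sum_of_mem_degreeLT (taylorPoly_mem (r - k + 1) ψ), Finset.mul_sum]
        exact Finset.sum_congr rfl fun i _ => by simp only [eval_pow, eval_X]; ring
      rw [this, Q.toFun_sum _ (fun i x => φ.coeff i * (v x * (X ^ i : ℝ[X]).eval x))
        fun i _ => contDiffOn_const.mul (hv.mul (hpc _))]
      exact Finset.sum_congr rfl fun i _ => Q.map_smul _ _ (hv.mul (hpc _))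
    have e2 : Q.toFun (fun x => δ x * φ.eval x) + J * φ.eval (-1)
        = h / 2 * ∑ i ∈ Finset.range (r - k + 1), φ.coeff i *
          (Q.toFun (fun x => A.toFun γ x * (X ^ i : ℝ[X]).eval x)
            - Q.toFun (fun x => γ x * (X ^ i : ℝ[X]).eval x)) := by
      have hv := hsys.var φ hmem
      simp only [mul_sub, Finset.sum_sub_distrib]
      rw [← esum γ hγc, ← esum _ hAγ, ← hv, e1]; ring
    rw [e2, abs_mul, abs_of_pos (by positivity)]
    have hterm : ∀ i ∈ Finset.range (r - k + 1), |φ.coeff i *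
        (Q.toFun (fun x => A.toFun γ x * (X ^ i : ℝ[X]).eval x)
          - Q.toFun (fun x => γ x * (X ^ i : ℝ[X]).eval x))| ≤ K * G * h ^ p := by
      intro i hi
      have hi' : i ≤ r - k := by have := Finset.mem_range.mp hi; omega
      have b := abs_consistency_monomial_le hQ hA hN h0.le h1 hγ (i := i) (s := p - i)
        (by omega : i ≤ r) (by omega)
        (natCast_sub_le_of_le_add (le_ordSucc_add_of_le_varSucc hp2 hi'))
      rw [abs_mul]
      calc _ ≤ K * h ^ i * (G * h ^ (p - i)) :=
            mul_le_mul (hφcoef i) b (abs_nonneg _) (by positivity)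
        _ = K * G * h ^ (i + (p - i)) := by rw [pow_add]; ring
        _ ≤ K * G * h ^ p := by
            have := pow_le_pow_of_le_one h0.le h1 (by omega : p ≤ i + (p - i))
            gcongr
    have hs := (Finset.abs_sum_le_sum_abs _ _).trans (Finset.sum_le_card_nsmul _ _ _ hterm)
    rw [Finset.card_range, nsmul_eq_mul] at hs
    have hcard : ((r - k + 1 : ℕ) : ℝ) ≤ (r + 1 : ℕ) := by
      exact_mod_cast (by omega : r - k + 1 ≤ r + 1)
    calc _ ≤ h / 2 * ((r - k + 1 : ℕ) * (K * G * h ^ p)) := by gcongr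
      _ ≤ h * ((r + 1 : ℕ) * (K * G * h ^ p)) := by
          have : h / 2 ≤ h := by linarith
          gcongr
      _ = _ := by rw [pow_succ]; ring
  have esplit : Q.toFun (fun x => δ x * ψ x)
      = Q.toFun (fun x => δ x * φ.eval x) + Q.toFun (fun x => δ x * (ψ x - φ.eval x)) := by
    rw [← Q.map_add _ _ (hδc.mul (hpc φ)) (hδc.mul (hψc.sub (hpc φ)))]
    congr 1; funext x; ring
  calc _ = |((∫ x in (-1 : ℝ)..1, δ x * ψ x) - Q.toFun (fun x => δ x * ψ x))
        + ((Q.toFun (fun x => δ x * (ψ x - φ.eval x)) + J * (ψ (-1) - φ.eval (-1)))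
          + (Q.toFun (fun x => δ x * φ.eval x) + J * φ.eval (-1)))| := by
        rw [esplit]; congr 1; ring
    _ ≤ (2 + CQ) * (2 ^ N * K ^ 2) * h ^ (p + 1) + ((CQ * 2 ^ N + 1) * K ^ 2 * h ^ (p + 1)
          + (r + 1 : ℕ) * (K * G) * h ^ (p + 1)) :=
        (abs_add_le _ _).trans (add_le_add step1 ((abs_add_le _ _).trans (add_le_add step2 step3)))
    _ = ((2 + CQ) * (2 ^ N * K ^ 2) + (CQ * 2 ^ N + 1) * K ^ 2 + (r + 1 : ℕ) * (K * G))
          * h ^ (p + 1) := by ring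
    _ ≤ _ := mul_le_mul_of_nonneg_right (by
        rw [weightedConst]
        have : 0 ≤ 3 * K ^ 2 := by positivity
        linarith) hpow

end Weighted

/-! ### Taylor polynomials of the flow -/

/-- The domain of the right-hand side of the differential equation. -/
abbrev dom (t₀ T : ℝ) (d : ℕ) : Set (ℝ × E d) := Icc t₀ (t₀ + T) ×ˢ univ

lemma uniqueDiffOn_dom {t₀ T : ℝ} (hT : 0 < T) (d : ℕ) : UniqueDiffOn ℝ (dom t₀ T d) :=
  (uniqueDiffOn_Icc (by linarith)).prod uniqueDiffOn_univ

/-- The `j`-th total derivative along solutions of `y' = f(t,y)` of the coordinate `y_c`, as a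
function of `(t,y)`. -/
noncomputable def flowDeriv {d : ℕ} (f : ℝ → E d → E d) (t₀ T : ℝ) (c : Fin d) :
    ℕ → ℝ × E d → ℝ
  | 0 => fun p => p.2 c
  | j + 1 => fun p => fderivWithin ℝ (flowDeriv f t₀ T c j) (dom t₀ T d) p (1, f p.1 p.2)

/-- The `M`-th Taylor polynomial, with respect to the time step `h`, of the `c`-th component of the
flow that starts at time `t` in `z`. -/
noncomputable def flowPoly {d : ℕ} (f : ℝ → E d → E d) (t₀ T : ℝ) (c : Fin d) (M : ℕ) (h t : ℝ)
    (z : E d) : ℝ :=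
  ∑ j ∈ Finset.range (M + 1), h ^ j / j.factorial * flowDeriv f t₀ T c j (t, z)

/-- The derivative of `flowPoly` with respect to the initial value, in direction `v`. -/
noncomputable def flowPolyDeriv {d : ℕ} (f : ℝ → E d → E d) (t₀ T : ℝ) (c : Fin d) (M : ℕ)
    (h : ℝ) (p : ℝ × E d) (v : E d) : ℝ :=
  ∑ j ∈ Finset.range (M + 1),
    h ^ j / j.factorial * fderivWithin ℝ (flowDeriv f t₀ T c j) (dom t₀ T d) p (0, v)

section Flow

variable {d : ℕ} {f : ℝ → E d → E d} {t₀ T : ℝ} {m : ℕ}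

lemma contDiffOn_flowDeriv (hT : 0 < T)
    (hf : ContDiffOn ℝ m (fun p : ℝ × E d => f p.1 p.2) (dom t₀ T d)) (c : Fin d) (j : ℕ) :
    ∀ n : ℕ, n + j ≤ m → ContDiffOn ℝ n (flowDeriv f t₀ T c j) (dom t₀ T d) := by
  induction j with
  | zero =>
    intro n _
    exact (contDiffOn_piLp_apply 2 (i := c)).comp contDiff_snd.contDiffOn (mapsTo_univ _ _)
  | succ j ih =>
    intro n hn
    have h1 := ih (n + 1) (by omega)
    exact (h1.fderivWithin (uniqueDiffOn_dom hT d) (m := n) (by norm_cast)).clm_apply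
      (contDiffOn_const.prodMk (hf.of_le (by exact_mod_cast (by omega : n ≤ m))))

lemma hasDerivWithinAt_flowDeriv (hT : 0 < T)
    (hf : ContDiffOn ℝ m (fun p : ℝ × E d => f p.1 p.2) (dom t₀ T d)) (c : Fin d) {j : ℕ}
    (hj : 1 + j ≤ m) {a b : ℝ} (ha : t₀ ≤ a) (hab : a ≤ b) (hb : b ≤ t₀ + T) {y : ℝ → E d}
    {v : E d} {x : ℝ} (hx : x ∈ Jhat) (hy : HasDerivWithinAt y v Jhat x) :
    HasDerivWithinAt (fun x => flowDeriv f t₀ T c j (aff a b x, y x))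
      ((b - a) / 2 * flowDeriv f t₀ T c (j + 1) (aff a b x, y x)
        + fderivWithin ℝ (flowDeriv f t₀ T c j) (dom t₀ T d) (aff a b x, y x)
          (0, v - ((b - a) / 2) • f (aff a b x) (y x))) Jhat x := by
  have hmaps : MapsTo (fun x => (aff a b x, y x)) Jhat (dom t₀ T d) := fun z hz =>
    ⟨Icc_subset_Icc ha hb (aff_mem hab hz), mem_univ _⟩
  have h1 : DifferentiableWithinAt ℝ (flowDeriv f t₀ T c j) (dom t₀ T d) (aff a b x, y x) :=
    ((contDiffOn_flowDeriv hT hf c j 1 hj).differentiableOn (by norm_num)) _ (hmaps hx)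
  have h2 := h1.hasFDerivWithinAt.comp_hasDerivWithinAt x
    ((hasDerivAt_aff a b x).hasDerivWithinAt.prodMk hy) hmaps
  refine h2.congr_deriv ?_
  have e : flowDeriv f t₀ T c (j + 1) (aff a b x, y x)
      = fderivWithin ℝ (flowDeriv f t₀ T c j) (dom t₀ T d) (aff a b x, y x)
        (1, f (aff a b x) (y x)) := rfl
  rw [e, ← smul_eq_mul, ← map_smul, ← map_add]
  congr 1
  ext <;> simp

/-- Along a curve the Taylor polynomial of the flow with fixed end time changes only through the
defect of the curve, up to a term of high order. -/
lemma hasDerivWithinAt_flowPoly (hT : 0 < T)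
    (hf : ContDiffOn ℝ m (fun p : ℝ × E d => f p.1 p.2) (dom t₀ T d)) (c : Fin d) {M : ℕ}
    (hM : 1 + M ≤ m) {a b : ℝ} (ha : t₀ ≤ a) (hab : a ≤ b) (hb : b ≤ t₀ + T) {y : ℝ → E d}
    {v : E d} {x : ℝ} (hx : x ∈ Jhat) (hy : HasDerivWithinAt y v Jhat x) :
    HasDerivWithinAt (fun x => flowPoly f t₀ T c M ((b - a) / 2 * (1 - x)) (aff a b x) (y x))
      ((b - a) / 2 * (((b - a) / 2 * (1 - x)) ^ M / M.factorial
          * flowDeriv f t₀ T c (M + 1) (aff a b x, y x))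
        + flowPolyDeriv f t₀ T c M ((b - a) / 2 * (1 - x)) (aff a b x, y x)
          (v - ((b - a) / 2) • f (aff a b x) (y x))) Jhat x := by
  induction M with
  | zero =>
    simpa [flowPoly, flowPolyDeriv] using
      hasDerivWithinAt_flowDeriv hT hf c (j := 0) hM ha hab hb hx hy
  | succ M ih =>
    have h1 := ih (by omega)
    have h2 := hasDerivWithinAt_flowDeriv hT hf c (j := M + 1) hM ha hab hb hx hy
    have hθ : HasDerivWithinAt (fun x : ℝ => ((b - a) / 2 * (1 - x)) ^ (M + 1) / (M + 1).factorial)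
        (-((b - a) / 2) * (((b - a) / 2 * (1 - x)) ^ M / M.factorial)) Jhat x := by
      have h3 : HasDerivAt (fun x : ℝ => (b - a) / 2 * (1 - x)) (-((b - a) / 2)) x := by
        simpa using ((hasDerivAt_id x).const_sub 1).const_mul ((b - a) / 2)
      have h4 := ((h3.pow (M + 1)).div_const ((M + 1).factorial : ℝ)).hasDerivWithinAt (s := Jhat)
      refine h4.congr_deriv ?_
      have : ((M + 1 : ℕ) : ℝ) ≠ 0 := by positivity
      rw [Nat.factorial_succ, Nat.cast_mul, Nat.add_sub_cancel]
      have h5 : (M.factorial : ℝ) ≠ 0 := by positivity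
      field_simp
    have h6 := h1.add (hθ.mul h2)
    have hsum : ∀ x, flowPoly f t₀ T c (M + 1) ((b - a) / 2 * (1 - x)) (aff a b x) (y x)
        = flowPoly f t₀ T c M ((b - a) / 2 * (1 - x)) (aff a b x) (y x)
          + ((b - a) / 2 * (1 - x)) ^ (M + 1) / (M + 1).factorial
            * flowDeriv f t₀ T c (M + 1) (aff a b x, y x) := fun x => by
      rw [flowPoly, Finset.sum_range_succ]; rfl
    have hsum' : ∀ p w, flowPolyDeriv f t₀ T c (M + 1) ((b - a) / 2 * (1 - x)) p w
        = flowPolyDeriv f t₀ T c M ((b - a) / 2 * (1 - x)) p w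
          + ((b - a) / 2 * (1 - x)) ^ (M + 1) / (M + 1).factorial
            * fderivWithin ℝ (flowDeriv f t₀ T c (M + 1)) (dom t₀ T d) p (0, w) := fun p w => by
      rw [flowPolyDeriv, Finset.sum_range_succ]; rfl
    refine (h6.congr_deriv ?_).congr (fun x _ => hsum x) (hsum x)
    rw [hsum']; ring

lemma flowPoly_zero_step (c : Fin d) (M : ℕ) (t : ℝ) (z : E d) :
    flowPoly f t₀ T c M 0 t z = z c := by
  rw [flowPoly, Finset.sum_range_succ', Finset.sum_eq_zero fun j _ => by simp]
  simp [flowDeriv]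

lemma flowPolyDeriv_eq_sum (c : Fin d) (M : ℕ) (h : ℝ) (p : ℝ × E d) (v : E d) :
    flowPolyDeriv f t₀ T c M h p v
      = ∑ l, v l * flowPolyDeriv f t₀ T c M h p (EuclideanSpace.single l 1) := by
  have hv : ((0 : ℝ), v) = ∑ l, v l • ((0 : ℝ), (EuclideanSpace.single l (1 : ℝ) : E d)) := by
    have h1 : v = ∑ l, v l • (EuclideanSpace.single l (1 : ℝ) : E d) := by
      ext i; simp [Finset.sum_apply, Pi.single_apply]
    refine Prod.ext ?_ ?_
    · simp [Prod.fst_sum]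
    · rw [Prod.snd_sum]; simpa using h1
  simp only [flowPolyDeriv, Finset.mul_sum]
  rw [Finset.sum_comm]
  refine Finset.sum_congr rfl fun j _ => ?_
  rw [hv, map_sum, Finset.mul_sum]
  exact Finset.sum_congr rfl fun l _ => by rw [map_smul, smul_eq_mul]; ring

lemma continuousOn_flowPolyDeriv (hT : 0 < T)
    (hf : ContDiffOn ℝ m (fun p : ℝ × E d => f p.1 p.2) (dom t₀ T d)) (c : Fin d) {M : ℕ}
    (hM : 1 + M ≤ m) {θ : ℝ → ℝ} {κ : ℝ → ℝ × E d} {s : Set ℝ} (hθ : ContinuousOn θ s)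
    (hκ : ContinuousOn κ s) (hmaps : MapsTo κ s (dom t₀ T d)) (v : E d) :
    ContinuousOn (fun x => flowPolyDeriv f t₀ T c M (θ x) (κ x) v) s := by
  refine continuousOn_finsetSum _ fun j hj => ((hθ.pow j).div_const _).mul ?_
  have := Finset.mem_range.mp hj
  exact (((contDiffOn_flowDeriv hT hf c j 1 (by omega)).continuousOn_fderivWithin
    (uniqueDiffOn_dom hT d) (by norm_num)).comp hκ hmaps).clm_apply continuousOn_const

/-- A version of the variation-of-constants formula: the value at the end point of a curve with
defect `δ` is the Taylor polynomial of the flow at the initial point plus the integral of the defect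
against the derivative of the flow, up to high order. -/
lemma exists_flowPoly_error (hT : 0 < T)
    (hf : ContDiffOn ℝ m (fun p : ℝ × E d => f p.1 p.2) (dom t₀ T d)) {M : ℕ}
    (hM : 1 + M ≤ m) (R : ℝ) :
    ∃ B : ℝ, 0 ≤ B ∧ ∀ (c : Fin d) (a b : ℝ), t₀ ≤ a → a < b → b ≤ t₀ + T →
      ∀ y v : ℝ → E d, (∀ x ∈ Jhat, HasDerivWithinAt y (v x) Jhat x) → ContinuousOn v Jhat →
      (∀ x ∈ Jhat, ‖y x‖ ≤ R) →
      |y 1 c - flowPoly f t₀ T c M (b - a) a (y (-1))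
        - ∑ l, ∫ x in (-1 : ℝ)..1, (v x - ((b - a) / 2) • f (aff a b x) (y x)) l
            * flowPolyDeriv f t₀ T c M ((b - a) / 2 * (1 - x)) (aff a b x, y x)
              (EuclideanSpace.single l 1)| ≤ B * (b - a) ^ (M + 1) := by
  have hcomp : IsCompact (Icc t₀ (t₀ + T) ×ˢ Metric.closedBall (0 : E d) R) :=
    isCompact_Icc.prod (isCompact_closedBall _ _)
  have hbd : ∀ c : Fin d, ∃ B, ∀ p ∈ Icc t₀ (t₀ + T) ×ˢ Metric.closedBall (0 : E d) R,
      ‖flowDeriv f t₀ T c (M + 1) p‖ ≤ B := fun c =>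
    hcomp.exists_bound_of_continuousOn ((contDiffOn_flowDeriv hT hf c (M + 1) 0
      (by omega)).continuousOn.mono (prod_mono le_rfl (subset_univ _)))
  choose B hB using hbd
  refine ⟨∑ c, |B c|, Finset.sum_nonneg fun _ _ => abs_nonneg _,
    fun c a b ha hab hb y v hy hv hyR => ?_⟩
  set h := b - a with hh
  have h0 : 0 < h := sub_pos.mpr hab
  have hBc : |B c| ≤ ∑ c, |B c| :=
    Finset.single_le_sum (f := fun c => |B c|) (fun _ _ => abs_nonneg _) (Finset.mem_univ c)
  set κ : ℝ → ℝ × E d := fun x => (aff a b x, y x) with hκ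
  have hmaps : MapsTo κ Jhat (dom t₀ T d) := fun z hz =>
    ⟨Icc_subset_Icc ha hb (aff_mem hab.le hz), mem_univ _⟩
  have hyc : ContinuousOn y Jhat := fun x hx => (hy x hx).continuousWithinAt
  have haffc : ContinuousOn (aff a b) Jhat := (contDiff_aff (n := 0) a b).continuous.continuousOn
  have hκc : ContinuousOn κ Jhat := haffc.prodMk hyc
  have hθc : ContinuousOn (fun x : ℝ => h / 2 * (1 - x)) Jhat := by fun_prop
  have hfc : ContinuousOn (fun x => f (aff a b x) (y x)) Jhat := hf.continuousOn.comp hκc hmaps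
  set δ : ℝ → E d := fun x => v x - (h / 2) • f (aff a b x) (y x) with hδ
  have hδc : ContinuousOn δ Jhat := 
    hv.sub (show ContinuousOn (fun x => (h / 2) • f (aff a b x) (y x)) Jhat from hfc.const_smul (h / 2))
  set g₁ : ℝ → ℝ := fun x => h / 2 * ((h / 2 * (1 - x)) ^ M / M.factorial
    * flowDeriv f t₀ T c (M + 1) (κ x)) with hg₁
  have hg₁c : ContinuousOn g₁ Jhat := continuousOn_const.mul (((hθc.pow M).div_const _).mul
    ((contDiffOn_flowDeriv hT hf c (M + 1) 0 (by omega)).continuousOn.comp hκc hmaps))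
  set g₂ : Fin d → ℝ → ℝ := fun l x => δ x l
    * flowPolyDeriv f t₀ T c M (h / 2 * (1 - x)) (κ x) (EuclideanSpace.single l 1) with hg₂
  have hg₂c : ∀ l, ContinuousOn (g₂ l) Jhat := fun l =>
    ((EuclideanSpace.proj l : E d →L[ℝ] ℝ).continuous.comp_continuousOn hδc).mul
      (continuousOn_flowPolyDeriv hT hf c hM hθc hκc hmaps _)
  have hsum₂c : ContinuousOn (fun x => ∑ l, g₂ l x) Jhat :=
    continuousOn_finsetSum _ fun l _ => hg₂c l
  set G : ℝ → ℝ := fun x => flowPoly f t₀ T c M (h / 2 * (1 - x)) (aff a b x) (y x) with hG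
  have hder : ∀ x ∈ Jhat, HasDerivWithinAt G (g₁ x + ∑ l, g₂ l x) Jhat x := by
    intro x hx
    refine (hasDerivWithinAt_flowPoly hT hf c hM ha hab.le hb hx (hy x hx)).congr_deriv ?_
    rw [flowPolyDeriv_eq_sum]
  have hFTC : ∫ x in (-1 : ℝ)..1, (g₁ x + ∑ l, g₂ l x) = G 1 - G (-1) := by
    refine intervalIntegral.integral_eq_sub_of_hasDerivAt_of_le (by norm_num)
      (fun x hx => (hder x hx).continuousWithinAt)
      (fun x hx => (hder x (Ioo_subset_Icc_self hx)).hasDerivAt (Icc_mem_nhds hx.1 hx.2))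
      (intervalIntegrable_of_continuousOn_Jhat (hg₁c.add hsum₂c))
  rw [intervalIntegral.integral_add (intervalIntegrable_of_continuousOn_Jhat hg₁c)
    (intervalIntegrable_of_continuousOn_Jhat hsum₂c), intervalIntegral.integral_finsetSum
    (fun l _ => intervalIntegrable_of_continuousOn_Jhat (hg₂c l))] at hFTC
  have hG1 : G 1 = y 1 c := by
    simp only [hG, sub_self, mul_zero]; exact flowPoly_zero_step c M _ _
  have hGm : G (-1) = flowPoly f t₀ T c M h a (y (-1)) := by
    simp only [hG, aff_neg_one]; congr 1; ring
  have hb1 : |∫ x in (-1 : ℝ)..1, g₁ x| ≤ 2 * (h / 2 * (h ^ M * |B c|)) := by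
    refine abs_integral_Jhat_le fun x hx => ?_
    have i1 : |h / 2 * (1 - x)| ≤ h := by
      rw [abs_of_nonneg (mul_nonneg (by positivity) (by linarith [hx.2]))]
      nlinarith [hx.1]
    have i2 : |(h / 2 * (1 - x)) ^ M / M.factorial| ≤ h ^ M := by
      rw [abs_div, abs_pow, Nat.abs_cast]
      exact (div_le_self (by positivity) (by exact_mod_cast M.factorial_pos)).trans
        (pow_le_pow_left₀ (abs_nonneg _) i1 M)
    have i3 : |flowDeriv f t₀ T c (M + 1) (κ x)| ≤ |B c| :=
      (hB c _ ⟨(hmaps hx).1, by simpa using hyR x hx⟩).trans (le_abs_self _)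
    rw [hg₁, abs_mul, abs_mul, abs_of_pos (by positivity : (0 : ℝ) < h / 2)]
    gcongr
  have hfin : y 1 c - flowPoly f t₀ T c M h a (y (-1)) - ∑ l, ∫ x in (-1 : ℝ)..1, g₂ l x
      = ∫ x in (-1 : ℝ)..1, g₁ x := by
    rw [← hG1, ← hGm]; linarith
  change |y 1 c - flowPoly f t₀ T c M h a (y (-1)) - ∑ l, ∫ x in (-1 : ℝ)..1, g₂ l x| ≤ _
  rw [hfin]
  refine hb1.trans ?_
  calc 2 * (h / 2 * (h ^ M * |B c|)) = |B c| * h ^ (M + 1) := by rw [pow_succ]; ring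
    _ ≤ _ := mul_le_mul_of_nonneg_right hBc (by positivity)

/-! ### Dependence of the Taylor polynomials of the flow on the initial value -/

lemma exists_lipschitz_on_ball {F : Type*} [NormedAddCommGroup F] [NormedSpace ℝ F] (hT : 0 < T)
    {Φ : ℝ × E d → F} (hΦ : ContDiffOn ℝ 1 Φ (dom t₀ T d)) (R : ℝ) :
    ∃ B : ℝ, 0 ≤ B ∧ ∀ p ∈ Icc t₀ (t₀ + T) ×ˢ Metric.closedBall (0 : E d) R,
      ∀ q ∈ Icc t₀ (t₀ + T) ×ˢ Metric.closedBall (0 : E d) R, ‖Φ p - Φ q‖ ≤ B * ‖p - q‖ := by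
  set K := Icc t₀ (t₀ + T) ×ˢ Metric.closedBall (0 : E d) R with hK
  have hKS : K ⊆ dom t₀ T d := prod_mono le_rfl (subset_univ _)
  obtain ⟨B, hB⟩ := (isCompact_Icc.prod (isCompact_closedBall (0 : E d) R) :
    IsCompact K).exists_bound_of_continuousOn
      ((hΦ.continuousOn_fderivWithin (uniqueDiffOn_dom hT d) (by norm_num)).mono hKS)
  refine ⟨|B|, abs_nonneg _, fun p hp q hq => ?_⟩
  exact ((convex_Icc _ _).prod (convex_closedBall _ _)).norm_image_sub_le_of_norm_hasFDerivWithin_le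
    (fun x hx => ((hΦ.differentiableOn (by norm_num) x (hKS hx)).hasFDerivWithinAt.mono hKS))
    (fun x hx => (hB x hx).trans (le_abs_self _)) hq hp

lemma exists_taylor_on_ball (hT : 0 < T)
    {Φ : ℝ × E d → ℝ} (hΦ : ContDiffOn ℝ 2 Φ (dom t₀ T d)) (R : ℝ) :
    ∃ B : ℝ, 0 ≤ B ∧ ∀ t ∈ Icc t₀ (t₀ + T), ∀ z w : E d, ‖z‖ ≤ R → ‖w‖ ≤ R →
      |Φ (t, z) - Φ (t, w)| ≤ B * ‖z - w‖ ∧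
      |Φ (t, z) - Φ (t, w) - fderivWithin ℝ Φ (dom t₀ T d) (t, z) (0, z - w)|
        ≤ B * ‖z - w‖ ^ 2 := by
  obtain ⟨B₁, hB₁0, hB₁⟩ := exists_lipschitz_on_ball hT (hΦ.of_le (by norm_num)) R
  obtain ⟨B₂, hB₂0, hB₂⟩ := exists_lipschitz_on_ball hT
    (hΦ.fderivWithin (uniqueDiffOn_dom hT d) (m := 1) (by norm_num)) R
  refine ⟨B₁ + B₂, by positivity, fun t ht z w hz hw => ?_⟩
  set K := Icc t₀ (t₀ + T) ×ˢ Metric.closedBall (0 : E d) R with hK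
  have hKS : K ⊆ dom t₀ T d := prod_mono le_rfl (subset_univ _)
  have hKc : Convex ℝ K := (convex_Icc _ _).prod (convex_closedBall _ _)
  have hzK : (t, z) ∈ K := ⟨ht, by simpa using hz⟩
  have hwK : (t, w) ∈ K := ⟨ht, by simpa using hw⟩
  have hnorm : ‖((t, z) : ℝ × E d) - (t, w)‖ = ‖z - w‖ := by
    rw [Prod.mk_sub_mk, sub_self, Prod.norm_mk, norm_zero, max_eq_right (norm_nonneg _)]
  constructor
  · have := hB₁ _ hzK _ hwK
    rw [hnorm, Real.norm_eq_abs] at this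
    exact this.trans (mul_le_mul_of_nonneg_right (by linarith) (norm_nonneg _))
  · have hseg : segment ℝ ((t, z) : ℝ × E d) (t, w) ⊆ K := hKc.segment_subset hzK hwK
    have key := (convex_segment ((t, z) : ℝ × E d) (t, w)).norm_image_sub_le_of_norm_hasFDerivWithin_le'
      (f := Φ) (f' := fderivWithin ℝ Φ (dom t₀ T d))
      (φ := fderivWithin ℝ Φ (dom t₀ T d) (t, z)) (C := B₂ * ‖z - w‖)
      (fun x hx => ((hΦ.differentiableOn (by norm_num) x
        (hKS (hseg hx))).hasFDerivWithinAt.mono (hseg.trans hKS)))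
      (fun x hx => by
        refine (hB₂ _ (hseg hx) _ hzK).trans (mul_le_mul_of_nonneg_left ?_ hB₂0)
        have h1 := norm_sub_le_of_mem_segment hx
        rwa [← norm_neg ((t, w) - (t, z) : ℝ × E d), neg_sub, hnorm] at h1)
      (left_mem_segment ℝ _ _) (right_mem_segment ℝ _ _)
    rw [← norm_neg ((t, w) - (t, z) : ℝ × E d), neg_sub, hnorm] at key
    have e : Φ (t, z) - Φ (t, w) - fderivWithin ℝ Φ (dom t₀ T d) (t, z) (0, z - w)
        = -(Φ (t, w) - Φ (t, z) - fderivWithin ℝ Φ (dom t₀ T d) (t, z) ((t, w) - (t, z))) := by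
      have : ((t, w) - (t, z) : ℝ × E d) = -(0, z - w) := by
        rw [Prod.mk_sub_mk, sub_self, Prod.neg_mk, neg_zero, neg_sub]
      rw [this, map_neg]; ring
    rw [e, abs_neg, ← Real.norm_eq_abs]
    refine key.trans ?_
    rw [pow_two, ← mul_assoc]
    gcongr
    linarith

/-- The Taylor polynomial of the flow is `z ↦ z_c + O(h)` in `C^2`. In particular the quadratic
remainder carries a factor `h`. -/
lemma exists_flowPoly_taylor (hT : 0 < T)
    (hf : ContDiffOn ℝ m (fun p : ℝ × E d => f p.1 p.2) (dom t₀ T d)) {M : ℕ}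
    (hM : 2 + M ≤ m) (R : ℝ) :
    ∃ B : ℝ, 0 ≤ B ∧ ∀ (c : Fin d), ∀ t ∈ Icc t₀ (t₀ + T), ∀ h : ℝ, 0 ≤ h → h ≤ 1 →
      ∀ z w : E d, ‖z‖ ≤ R → ‖w‖ ≤ R →
      |flowPoly f t₀ T c M h t z - flowPoly f t₀ T c M h t w - (z c - w c)| ≤ B * h * ‖z - w‖ ∧
      |flowPoly f t₀ T c M h t z - flowPoly f t₀ T c M h t w
        - flowPolyDeriv f t₀ T c M h (t, z) (z - w)| ≤ B * h * ‖z - w‖ ^ 2 := by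
  have hex : ∀ (c : Fin d) (j : ℕ), ∃ B : ℝ, 0 ≤ B ∧ (j ≤ M → ∀ t ∈ Icc t₀ (t₀ + T),
      ∀ z w : E d, ‖z‖ ≤ R → ‖w‖ ≤ R →
      |flowDeriv f t₀ T c j (t, z) - flowDeriv f t₀ T c j (t, w)| ≤ B * ‖z - w‖ ∧
      |flowDeriv f t₀ T c j (t, z) - flowDeriv f t₀ T c j (t, w)
        - fderivWithin ℝ (flowDeriv f t₀ T c j) (dom t₀ T d) (t, z) (0, z - w)|
        ≤ B * ‖z - w‖ ^ 2) := by
    intro c j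
    by_cases hj : j ≤ M
    · obtain ⟨B, hB0, hB⟩ := exists_taylor_on_ball hT
        (contDiffOn_flowDeriv hT hf c j 2 (by omega)) R
      exact ⟨B, hB0, fun _ => hB⟩
    · exact ⟨0, le_rfl, fun h => absurd h hj⟩
  choose B hB0 hB using hex
  have hBs0 : ∀ c, 0 ≤ ∑ j ∈ Finset.range M, B c (j + 1) :=
    fun c => Finset.sum_nonneg fun _ _ => hB0 _ _
  refine ⟨∑ c, ∑ j ∈ Finset.range M, B c (j + 1), Finset.sum_nonneg fun c _ => hBs0 c,
    fun c t ht h h0 h1 z w hz hw => ?_⟩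
  have hBc : ∑ j ∈ Finset.range M, B c (j + 1) ≤ ∑ c, ∑ j ∈ Finset.range M, B c (j + 1) :=
    Finset.single_le_sum (f := fun c => ∑ j ∈ Finset.range M, B c (j + 1))
      (fun c _ => hBs0 c) (Finset.mem_univ c)
  have hterm : ∀ X : ℕ → ℝ, ∀ Y : ℝ, 0 ≤ Y → (∀ j < M, |X (j + 1)| ≤ B c (j + 1) * Y) →
      |∑ j ∈ Finset.range M, h ^ (j + 1) / (j + 1).factorial * X (j + 1)|
        ≤ (∑ c, ∑ j ∈ Finset.range M, B c (j + 1)) * h * Y := by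
    intro X Y hY hX
    calc _ ≤ ∑ j ∈ Finset.range M, |h ^ (j + 1) / (j + 1).factorial * X (j + 1)| :=
          Finset.abs_sum_le_sum_abs _ _
      _ ≤ ∑ j ∈ Finset.range M, h * (B c (j + 1) * Y) := by
          refine Finset.sum_le_sum fun j hj => ?_
          rw [abs_mul]
          refine mul_le_mul ?_ (hX j (Finset.mem_range.mp hj)) (abs_nonneg _) h0
          rw [abs_of_nonneg (by positivity)]
          refine (div_le_self (by positivity) (by exact_mod_cast (j + 1).factorial_pos)).trans ?_
          exact pow_le_of_le_one h0 h1 (Nat.succ_ne_zero j)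
      _ = (∑ j ∈ Finset.range M, B c (j + 1)) * h * Y := by
          rw [Finset.sum_mul, Finset.sum_mul]
          exact Finset.sum_congr rfl fun _ _ => by ring
      _ ≤ _ := by gcongr
  have hD0 : fderivWithin ℝ (flowDeriv f t₀ T c 0) (dom t₀ T d) (t, z) (0, z - w) = z c - w c := by
    let L : ℝ × E d →L[ℝ] ℝ := (EuclideanSpace.proj c : E d →L[ℝ] ℝ).comp
      (ContinuousLinearMap.snd ℝ ℝ (E d))
    have hL : flowDeriv f t₀ T c 0 = L := rfl
    rw [hL, L.fderivWithin (uniqueDiffOn_dom hT d _ ⟨ht, mem_univ _⟩)]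
    rfl
  constructor
  · have := hterm (fun j => flowDeriv f t₀ T c j (t, z) - flowDeriv f t₀ T c j (t, w)) ‖z - w‖
      (norm_nonneg _) fun j hj => (hB c (j + 1) (by omega) t ht z w hz hw).1
    convert this using 2
    simp only [flowPoly, Finset.sum_range_succ', mul_sub, Finset.sum_sub_distrib]
    simp [flowDeriv]
    ring
  · have := hterm (fun j => flowDeriv f t₀ T c j (t, z) - flowDeriv f t₀ T c j (t, w)
      - fderivWithin ℝ (flowDeriv f t₀ T c j) (dom t₀ T d) (t, z) (0, z - w)) (‖z - w‖ ^ 2)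
      (by positivity) fun j hj => (hB c (j + 1) (by omega) t ht z w hz hw).2
    convert this using 2
    simp only [flowPoly, flowPolyDeriv, Finset.sum_range_succ', mul_sub, Finset.sum_sub_distrib,
      hD0]
    simp [flowDeriv]
    ring

end Flow

/-! ### The local error -/

lemma Scaled.pow {N : ℕ} {h : ℝ} (h0 : 0 ≤ h) {φ : ℝ → ℝ} (hφ : Scaled N h 1 φ) (i : ℕ) :
    Scaled N h ((2 ^ N) ^ i) (fun x : ℝ => φ x ^ i) := by
  induction i with
  | zero => simpa using Scaled.const (N := N) h0 (1 : ℝ)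
  | succ i ih => simpa [pow_succ, mul_comm] using ih.mul h0 hφ

/-- The weights that multiply the defect have bounded derivatives. -/
lemma exists_scaled_flowPolyDeriv {d : ℕ} {f : ℝ → E d → E d} {t₀ T : ℝ} {m : ℕ} (hT : 0 < T)
    (hf : ContDiffOn ℝ m (fun p : ℝ × E d => f p.1 p.2) (dom t₀ T d)) {N M : ℕ}
    (hm : N + 1 + M ≤ m) (n : ℕ) (R : ℝ) :
    ∃ B : ℝ, 0 ≤ B ∧ ∀ (c l : Fin d) (a b : ℝ), t₀ ≤ a → a < b → b ≤ t₀ + T → b - a ≤ 1 →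
      ∀ P : Fin d → ℝ[X], (∀ c, P c ∈ degreeLT ℝ n) →
      (∀ c i, |(P c).coeff i| ≤ R * (b - a) ^ i) →
      Scaled N (b - a) B (fun x => flowPolyDeriv f t₀ T c M ((b - a) / 2 * (1 - x))
        (aff a b x, pval P x) (EuclideanSpace.single l 1)) := by
  have hex : ∀ (c l : Fin d) (j : ℕ), ∃ B : ℝ, 0 ≤ B ∧ (j ≤ M → ∀ a b : ℝ, t₀ ≤ a → a < b →
      b ≤ t₀ + T → b - a ≤ 1 → ∀ P : Fin d → ℝ[X], (∀ c, P c ∈ degreeLT ℝ n) →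
      (∀ c i, |(P c).coeff i| ≤ R * (b - a) ^ i) →
      Scaled N (b - a) B (fun x => fderivWithin ℝ (flowDeriv f t₀ T c j) (dom t₀ T d)
        (aff a b x, pval P x) (0, EuclideanSpace.single l 1))) := by
    intro c l j
    by_cases hj : j ≤ M
    · have hs : ContDiffOn ℝ N (fun p => fderivWithin ℝ (flowDeriv f t₀ T c j) (dom t₀ T d) p
          ((0 : ℝ), (EuclideanSpace.single l 1 : E d))) (dom t₀ T d) :=
        ((contDiffOn_flowDeriv hT hf c j (N + 1) (by omega)).fderivWithin
          (uniqueDiffOn_dom hT d) (m := N) (by norm_cast)).clm_apply contDiffOn_const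
      obtain ⟨B, hB0, hB⟩ := exists_scaled_comp N n hT hs R
      exact ⟨B, hB0, fun _ => hB⟩
    · exact ⟨0, le_rfl, fun h => absurd h hj⟩
  choose B hB0 hB using hex
  set W : Fin d → Fin d → ℝ := fun c l => ∑ j ∈ Finset.range (M + 1),
    2 ^ N * (|(1 : ℝ) / j.factorial| * (2 ^ N) ^ j * B c l j) with hW
  have hW0 : ∀ c l, 0 ≤ W c l := fun c l => Finset.sum_nonneg fun j _ => by
    have := hB0 c l j; positivity
  refine ⟨∑ c, ∑ l, W c l, Finset.sum_nonneg fun c _ => Finset.sum_nonneg fun l _ => hW0 c l,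
    fun c l a b ha hab hb h1 P hP hc => ?_⟩
  set h := b - a with hh
  have h0 : 0 < h := sub_pos.mpr hab
  have hle : W c l ≤ ∑ c, ∑ l, W c l :=
    (Finset.single_le_sum (f := fun l => W c l) (fun l _ => hW0 c l) (Finset.mem_univ l)).trans
      (Finset.single_le_sum (f := fun c => ∑ l, W c l)
        (fun c _ => Finset.sum_nonneg fun l _ => hW0 c l) (Finset.mem_univ c))
  have hθ : Scaled N h 1 (fun x => h / 2 * (1 - x)) := by
    have e1 := (Scaled.const (N := N) h0.le (h / 2)).sub
      ((Scaled.const_mul_id (N := N) h0.le h1).const_mul (1 / 2))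
    refine (e1.mono_const h0.le ?_).congr fun x _ => by ring
    rw [Real.norm_of_nonneg (by positivity), abs_of_pos (by norm_num : (0 : ℝ) < 1 / 2)]
    linarith
  refine ((Scaled.sum (Finset.range (M + 1)) h0.le fun j hj =>
    ((hθ.pow h0.le j).const_mul (1 / (j.factorial : ℝ))).mul h0.le
      (hB c l j (by have := Finset.mem_range.mp hj; omega) a b ha hab hb h1 P hP hc)).mono_const
      h0.le hle).congr fun x _ => ?_
  simp only [flowPolyDeriv]
  exact Finset.sum_congr rfl fun j _ => by ring

lemma hasDerivAt_pval {d : ℕ} (P : Fin d → ℝ[X]) (x : ℝ) :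
    HasDerivAt (pval P) (pval (fun c => derivative (P c)) x) x := by
  have h : HasDerivAt (fun y (c : Fin d) => (P c).eval y) (fun c => (derivative (P c)).eval x) x :=
    hasDerivAt_pi.mpr fun c => (P c).hasDerivAt x
  exact (PiLp.hasFDerivAt_toLp (𝕜 := ℝ) 2 (fun c => (P c).eval x)).comp_hasDerivAt x h

section LocalError

variable {κQ κA d r k : ℕ} {Q : Integrator κQ} {A : ApproxOp κA} {f : ℝ → E d → E d}
  {t₀ T CQ CA L CL : ℝ}

/-- One step of the method increases the error by `O(h)` times the old error and by the local error.
The square of the jump enters with an additional factor `h`. -/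
lemma StabData.exists_step_error (D : StabData r k Q A f t₀ T CQ CA L CL) (hkr : k ≤ r)
    (hT : 0 < T) {N m : ℕ} (hN : kJ k κQ κA ≤ N) (hrN : 2 * r + 1 ≤ N)
    (hm : N + 1 + (2 * r + 1) ≤ m)
    (hf : ContDiffOn ℝ m (fun q : ℝ × E d => f q.1 q.2) (dom t₀ T d))
    (hord : (r : ℕ∞) ≤ ordSucc Q A (r - k) + 1) {p q : ℕ}
    (hp : (p : ℕ∞) ≤ superExp r k Q A) (hq : (q : ℕ∞) = min (r : ℕ∞) (ordSucc Q A (r - k)))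
    {u : ℝ → E d} (hu : ∀ t ∈ Icc t₀ (t₀ + T), HasDerivWithinAt u (f t (u t)) (Icc t₀ (t₀ + T)) t)
    {R : ℝ} (hR : 0 ≤ R) :
    ∃ K : ℝ, 0 ≤ K ∧ ∀ (a b : ℝ) (Uin : E d) (P : Fin d → ℝ[X]),
      RefSolution r k Q A f t₀ T a b Uin P → ‖Uin‖ ≤ R → (∀ c i, |(P c).coeff i| ≤ R) →
      ‖(u b - pval P 1) - (u a - Uin)‖ ≤ K * (b - a) * (‖u a - Uin‖
        + ((b - a) ^ p + if k = 0 then (b - a) ^ (2 * q + 2) else 0)) := by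
  have hkA : max κA κQ ≤ N := le_trans (by rw [kJ]; omega) hN
  have hfN : ContDiffOn ℝ N (fun q : ℝ × E d => f q.1 q.2) (dom t₀ T d) :=
    hf.of_le (by exact_mod_cast (by omega : N ≤ m))
  have hqr : q ≤ r := by
    have : (q : ℕ∞) ≤ r := hq ▸ min_le_left _ _
    exact_mod_cast this
  have hqo : (q : ℕ∞) ≤ ordSucc Q A (r - k) := hq ▸ min_le_right _ _
  have hpM : p ≤ 2 * r + 1 := by
    have h1 : (p : ℕ∞) ≤ ((2 * r - k + 1 : ℕ) : ℕ∞) := hp.trans (min_le_left _ _)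
    have : p ≤ 2 * r - k + 1 := by exact_mod_cast h1
    omega
  obtain ⟨K₁, hK₁0, hK₁⟩ := D.exists_defect_bounds hT hN (by omega) hfN hord hqr hqo hR
  obtain ⟨B₁, hB₁0, hB₁⟩ := exists_scaled_flowPolyDeriv hT hf hm (r + 1) K₁
  have huc : ContinuousOn u (Icc t₀ (t₀ + T)) := fun t ht => (hu t ht).continuousWithinAt
  obtain ⟨Ru, hRu⟩ := isCompact_Icc.exists_bound_of_continuousOn huc
  set R' : ℝ := R + |Ru| + polyConst 0 (r + 1) * (d * R) with hR'
  have hpR0 : 0 ≤ polyConst 0 (r + 1) * (d * R) := by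
    have := polyConst_nonneg 0 (r + 1); positivity
  obtain ⟨B₂, hB₂0, hB₂⟩ := exists_flowPoly_error hT hf (M := 2 * r + 1) (by omega) R'
  obtain ⟨B₃, hB₃0, hB₃⟩ := exists_flowPoly_taylor hT hf (M := 2 * r + 1) (by omega) R'
  set K₂ := K₁ + B₁ with hK₂
  set W := weightedConst r N κQ CQ CA K₂ with hW
  have hW0 : 0 ≤ W := by
    have := D.CQ_nonneg; have := D.CA_nonneg
    rw [hW, weightedConst]; positivity
  set K₃ := B₃ + (d * W + 2 * B₂ + B₃ * (d * K₁) ^ 2) with hK₃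
  refine ⟨d * K₃, by positivity, fun a b Uin P hP hUin hPR => ?_⟩
  set h := b - a with hh
  have h0 : 0 < h := sub_pos.mpr hP.lt
  have h1 : h ≤ 1 := hP.le_one
  obtain ⟨hcoef, hdef⟩ := hK₁ a b Uin P hP hPR
  have haI : a ∈ Icc t₀ (t₀ + T) := ⟨hP.left_le, by linarith [hP.le_right, hP.lt]⟩
  have hPval : ∀ x ∈ Jhat, ‖pval P x‖ ≤ R' := fun x hx =>
    ((scaled_pval (N := 0) one_pos le_rfl hP.deg (R := R) (by simpa using hPR)).norm_le hx).trans
      (by rw [hR']; linarith [abs_nonneg Ru])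
  have hUinR : ‖Uin‖ ≤ R' := hUin.trans (by rw [hR']; linarith [abs_nonneg Ru])
  have huR : ∀ t ∈ Icc t₀ (t₀ + T), ‖u t‖ ≤ R' := fun t ht =>
    (hRu t ht).trans (by rw [hR']; linarith [le_abs_self Ru])
  have hmaps : MapsTo (aff a b) Jhat (Icc t₀ (t₀ + T)) := fun x hx =>
    Icc_subset_Icc hP.left_le hP.le_right (aff_mem hP.lt.le hx)
  -- the exact solution is a curve without defect
  have hexact : ∀ c, |u b c - flowPoly f t₀ T c (2 * r + 1) h a (u a)| ≤ B₂ * h ^ (2 * r + 2) := by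
    intro c
    have hder : ∀ x ∈ Jhat, HasDerivWithinAt (fun x => u (aff a b x))
        ((h / 2) • f (aff a b x) (u (aff a b x))) Jhat x := fun x hx =>
      (hu _ (hmaps hx)).scomp x (hasDerivAt_aff a b x).hasDerivWithinAt hmaps
    have hfc : ContinuousOn (fun x => f (aff a b x) (u (aff a b x))) Jhat := by
      have haffc : ContinuousOn (aff a b) Jhat :=
        (contDiff_aff (n := 0) a b).continuous.continuousOn
      exact hf.continuousOn.comp (haffc.prodMk (huc.comp haffc hmaps))
        fun x hx => ⟨hmaps hx, mem_univ _⟩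
    have := hB₂ c a b hP.left_le hP.lt hP.le_right (fun x => u (aff a b x)) _ hder
      (hfc.const_smul (h / 2)) fun x hx => huR _ (hmaps hx)
    simp only [aff_one, aff_neg_one] at this
    rw [Finset.sum_eq_zero fun l _ => by simp [hh], sub_zero] at this
    exact this
  have hnum := fun c => hB₂ c a b hP.left_le hP.lt hP.le_right (pval P) _
    (fun x _ => (hasDerivAt_pval P x).hasDerivWithinAt)
    (contDiff_pval (n := 0) fun c => derivative (P c)).continuous.continuousOn hPval
  set J : E d := pval P (-1) - Uin with hJ
  have hJc : ∀ c, |J c| ≤ K₁ * h ^ (q + 1) := fun c => (hdef c).2.2.2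
  have hJn : ‖J‖ ≤ d * (K₁ * h ^ (q + 1)) := norm_le_card_mul hJc
  have hweight : ∀ c l, |(∫ x in (-1 : ℝ)..1, defect f a b P l x
        * flowPolyDeriv f t₀ T c (2 * r + 1) (h / 2 * (1 - x)) (aff a b x, pval P x)
          (EuclideanSpace.single l 1))
      + J l * flowPolyDeriv f t₀ T c (2 * r + 1) h (a, pval P (-1)) (EuclideanSpace.single l 1)|
      ≤ W * h ^ (p + 1) := by
    intro c l
    have hψ := hB₁ c l a b hP.left_le hP.lt hP.le_right h1 P hP.deg hcoef
    obtain ⟨d1, d2, d3, d4⟩ := hdef l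
    have hKh : K₁ * h ≤ K₂ * h := mul_le_mul_of_nonneg_right (by linarith) h0.le
    have hKq : K₁ * h ^ (q + 1) ≤ K₂ * h ^ (q + 1) :=
      mul_le_mul_of_nonneg_right (by linarith) (by positivity)
    have := abs_weighted_defect_le hkr D.CQ_nonneg D.CA_nonneg D.integ D.approx hkA hrN hp hq h0 h1
      (hP.sys l) (d1.mono_const h0.le (by linarith : K₁ ≤ K₂))
      (hψ.mono_const h0.le (by linarith : B₁ ≤ K₂)) (d2.mono_const h0.le hKh)
      (d3.mono_const zero_le_one hKq) (d4.trans hKq)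
    have e : (b - a) / 2 * (1 - (-1)) = h := by rw [hh]; ring
    rw [e, aff_neg_one] at this
    exact this
  -- `hsplit` below compares, through the Taylor polynomial `Φ` of the flow, the two solutions with
  -- each other; the linear effect of the jump is estimated together with the weighted defect
  have hcomp : ∀ c, |((u b - pval P 1) - (u a - Uin)) c| ≤ K₃ * h * (‖u a - Uin‖
      + (h ^ p + if k = 0 then h ^ (2 * q + 2) else 0)) := by
    intro c
    set Φ := fun z => flowPoly f t₀ T c (2 * r + 1) h a z with hΦ
    set Ψ := fun l => flowPolyDeriv f t₀ T c (2 * r + 1) h (a, pval P (-1))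
      (EuclideanSpace.single l 1) with hΨ
    set S := fun l => ∫ x in (-1 : ℝ)..1, defect f a b P l x
        * flowPolyDeriv f t₀ T c (2 * r + 1) (h / 2 * (1 - x)) (aff a b x, pval P x)
          (EuclideanSpace.single l 1) with hS
    have s1 := hexact c
    have s2 : |pval P 1 c - Φ (pval P (-1)) - ∑ l, S l| ≤ B₂ * h ^ (2 * r + 2) := hnum c
    have s3 := (hB₃ c a haI h h0.le h1 (u a) Uin (huR a haI) hUinR).1
    have s4 : |Φ (pval P (-1)) - Φ Uin - ∑ l, J l * Ψ l| ≤ B₃ * h * ‖J‖ ^ 2 := by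
      have := (hB₃ c a haI h h0.le h1 (pval P (-1)) Uin (hPval _ neg_one_mem_Jhat) hUinR).2
      rwa [flowPolyDeriv_eq_sum] at this
    have s5 : |∑ l, (S l + J l * Ψ l)| ≤ d * (W * h ^ (p + 1)) :=
      (Finset.abs_sum_le_sum_abs _ _).trans
        ((Finset.sum_le_sum fun l _ => hweight c l).trans (by simp))
    have hJsq : B₃ * h * ‖J‖ ^ 2 ≤ B₃ * (d * K₁) ^ 2 * h
        * (if k = 0 then h ^ (2 * q + 2) else 0) := by
      split_ifs with hk
      · calc B₃ * h * ‖J‖ ^ 2 ≤ B₃ * h * (d * (K₁ * h ^ (q + 1))) ^ 2 := by gcongr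
          _ = _ := by rw [show 2 * q + 2 = (q + 1) * 2 by ring, pow_mul]; ring
      · have : J = 0 := by
          ext l; exact (hP.sys l).jump (Nat.one_le_iff_ne_zero.mpr hk)
        rw [this]; simp
    have hM : B₂ * h ^ (2 * r + 2) ≤ B₂ * h ^ (p + 1) :=
      mul_le_mul_of_nonneg_left (pow_le_pow_of_le_one h0.le h1 (by omega)) hB₂0
    have hsplit : ((u b - pval P 1) - (u a - Uin)) c
        = (u b c - Φ (u a)) + (Φ (u a) - Φ Uin - (u a c - Uin c))
          - (Φ (pval P (-1)) - Φ Uin - ∑ l, J l * Ψ l) - ∑ l, (S l + J l * Ψ l)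
          - (pval P 1 c - Φ (pval P (-1)) - ∑ l, S l) := by
      rw [Finset.sum_add_distrib]
      simp only [WithLp.ofLp_sub, Pi.sub_apply]
      ring
    set Y := (if k = 0 then h ^ (2 * q + 2) else 0) with hY
    have hY0 : 0 ≤ Y := by rw [hY]; split_ifs <;> positivity
    have hp0 : 0 ≤ h ^ p := by positivity
    have ha0 := norm_nonneg (u a - Uin)
    have htot : |((u b - pval P 1) - (u a - Uin)) c| ≤ B₂ * h ^ (p + 1) + B₃ * h * ‖u a - Uin‖
        + B₃ * (d * K₁) ^ 2 * h * Y + d * (W * h ^ (p + 1)) + B₂ * h ^ (p + 1) := by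
      rw [hsplit]
      refine (abs_sub _ _).trans (add_le_add ((abs_sub _ _).trans (add_le_add
        ((abs_sub _ _).trans (add_le_add ((abs_add_le _ _).trans (add_le_add (s1.trans hM) s3))
          (s4.trans hJsq))) s5)) (s2.trans hM))
    refine htot.trans ?_
    have hhp : h ^ (p + 1) = h * h ^ p := by rw [pow_succ, mul_comm]
    rw [hhp]
    have w0 : 0 ≤ d * W + 2 * B₂ := by positivity
    have w1 : 0 ≤ B₃ * (d * K₁) ^ 2 := by positivity
    have g1 : B₃ * (h * ‖u a - Uin‖) ≤ K₃ * (h * ‖u a - Uin‖) :=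
      mul_le_mul_of_nonneg_right (by linarith) (by positivity)
    have g2 : (d * W + 2 * B₂) * (h * h ^ p) ≤ K₃ * (h * h ^ p) :=
      mul_le_mul_of_nonneg_right (by linarith) (by positivity)
    have g3 : B₃ * (d * K₁) ^ 2 * (h * Y) ≤ K₃ * (h * Y) :=
      mul_le_mul_of_nonneg_right (by linarith) (by positivity)
    linarith
  exact (norm_le_card_mul hcomp).trans_eq (by ring)

end LocalError

/-! ### Accumulation of the local errors -/

namespace Mesh

variable {t₀ T : ℝ} (M : Mesh t₀ T)

lemma step_le_size {n : ℕ} (hn : n < M.N) : M.node (n + 1) - M.node n ≤ M.size :=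
  le_ciSup (f := fun n : Fin M.N => M.node (n + 1) - M.node n) (finite_range _).bddAbove ⟨n, hn⟩

lemma size_nonneg : 0 ≤ M.size :=
  Real.iSup_nonneg fun n => sub_nonneg.mpr (M.node_lt n n.2).le

lemma node_mono {i j : ℕ} (hij : i ≤ j) (hj : j ≤ M.N) : M.node i ≤ M.node j := by
  induction j, hij using Nat.le_induction with
  | base => exact le_rfl
  | succ j _ ih => exact (ih (by omega)).trans (M.node_lt j (by omega)).le

lemma le_node {n : ℕ} (hn : n ≤ M.N) : t₀ ≤ M.node n :=
  M.node_zero.symm.trans_le (M.node_mono (Nat.zero_le _) hn)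

lemma node_le {n : ℕ} (hn : n ≤ M.N) : M.node n ≤ t₀ + T :=
  (M.node_mono hn le_rfl).trans_eq M.node_last

/-- The discrete Gronwall inequality on a mesh. -/
lemma le_exp_mul {K : ℝ} (hK : 0 ≤ K) {x : ℕ → ℝ} (h0 : 0 ≤ x 0)
    (hx : ∀ n < M.N, x (n + 1) ≤ (1 + K * (M.node (n + 1) - M.node n)) * x n) {n : ℕ}
    (hn : n ≤ M.N) : x n ≤ Real.exp (K * T) * x 0 := by
  have key : ∀ n ≤ M.N, x n ≤ Real.exp (K * (M.node n - t₀)) * x 0 := by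
    intro n
    induction n with
    | zero => intro _; rw [M.node_zero]; simp
    | succ n ih =>
      intro hn
      have hstep : 0 ≤ M.node (n + 1) - M.node n := sub_nonneg.mpr (M.node_lt n hn).le
      calc x (n + 1) ≤ (1 + K * (M.node (n + 1) - M.node n)) * x n := hx n hn
        _ ≤ (1 + K * (M.node (n + 1) - M.node n)) * (Real.exp (K * (M.node n - t₀)) * x 0) :=
            mul_le_mul_of_nonneg_left (ih (by omega)) (by positivity)
        _ ≤ Real.exp (K * (M.node (n + 1) - M.node n))
              * (Real.exp (K * (M.node n - t₀)) * x 0) := by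
            refine mul_le_mul_of_nonneg_right ?_ (by positivity)
            linarith [Real.add_one_le_exp (K * (M.node (n + 1) - M.node n))]
        _ = _ := by rw [← mul_assoc, ← Real.exp_add]; congr 2; ring
  refine (key n hn).trans (mul_le_mul_of_nonneg_right (Real.exp_le_exp.mpr ?_) h0)
  exact mul_le_mul_of_nonneg_left (by linarith [M.node_le hn]) hK

end Mesh

lemma powTop_nonneg {x : ℝ} (hx : 0 ≤ x) (e : ℕ∞) : 0 ≤ powTop x e := by
  rw [powTop]; split_ifs
  · exact le_rfl
  · positivity

/-- The contribution of the squared jump is of the asserted order, or absorbed by the first term. -/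
lemma pow_two_mul_add_two_le {κQ κA r k p q : ℕ} {Q : Integrator κQ} {A : ApproxOp κA}
    (hp : p ≤ 2 * r + 1) (hq : (q : ℕ∞) = min (r : ℕ∞) (ordSucc Q A (r - k))) {h τ : ℝ}
    (h0 : 0 ≤ h) (hhτ : h ≤ τ) (hτ : τ ≤ 1) :
    h ^ (2 * q + 2) ≤ τ ^ p + powTop τ (2 * ordSucc Q A (r - k) + 2) := by
  have hτ0 : 0 ≤ τ := h0.trans hhτ
  refine (pow_le_pow_left₀ h0 hhτ _).trans ?_
  rcases le_total (r : ℕ∞) (ordSucc Q A (r - k)) with hro | hor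
  · rw [min_eq_left hro] at hq
    have hqr : q = r := by exact_mod_cast hq
    have := powTop_nonneg hτ0 (2 * ordSucc Q A (r - k) + 2)
    linarith [pow_le_pow_of_le_one hτ0 hτ (by omega : p ≤ 2 * q + 2)]
  · rw [min_eq_right hor] at hq
    have e : 2 * ordSucc Q A (r - k) + 2 = ((2 * q + 2 : ℕ) : ℕ∞) := by
      rw [← hq]; push_cast; rfl
    rw [powTop, e, if_neg (ENat.natCast_ne_top _), ENat.toNat_natCast]
    linarith [pow_nonneg hτ0 p]

/-- The assumptions on the method and the Lipschitz condition provide the constants. -/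
lemma exists_stabData {κQ κA d r k : ℕ} (hkr : k ≤ r) (c : Fin d) {Q : Integrator κQ}
    {A : ApproxOp κA} {f : ℝ → E d → E d} {t₀ T : ℝ} (hT : 0 < T)
    (hf : ContDiffOn ℝ (kJ k κQ κA) (fun p : ℝ × E d => f p.1 p.2) (dom t₀ T d))
    (hS : AssSolvable r k Q) (hQ : AssStabQ d Q) (hA : AssStabA d κQ A)
    (hL : AssLip (kJ k κQ κA) f t₀ T) :
    ∃ CQ CA L CL : ℝ, StabData r k Q A f t₀ T CQ CA L CL := by
  obtain ⟨CQ, hCQ0, hCQ⟩ := hQ.exists_abs_le c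
  obtain ⟨CA, hCA0, hCA⟩ := hA.exists_scaled c
  obtain ⟨L, hL0, hsys⟩ := exists_system_stability hkr hS hCQ0 hCA0 hCQ hCA
  obtain ⟨CL, hCL0, hlip⟩ := exists_scaled_sub_of_assLip (n := r + 1) hT hf hL
  exact ⟨CQ, CA, L, CL, hCQ0, hCA0, hL0, hCL0, hCQ, hCA, hsys, hlip⟩

lemma nodeVal_succ {d : ℕ} {t₀ T : ℝ} (M : Mesh t₀ T) (u₀ : E d) (U : ℕ → Fin d → ℝ[X]) (n : ℕ) :
    nodeVal M u₀ U (n + 1)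
      = pval (hatPoly (M.node n) (M.node (n + 1)) (U (n + 1))) 1 := by
  rw [nodeVal, if_neg (Nat.succ_ne_zero n), pval_hatPoly, aff_one]

lemma norm_sub_nodeVal_le_supOn {d : ℕ} {t₀ T : ℝ} {u : ℝ → E d}
    (hu : ContinuousOn u (Icc t₀ (t₀ + T))) (M : Mesh t₀ T) (u₀ : E d) (U : ℕ → Fin d → ℝ[X])
    {n : ℕ} (hn1 : 1 ≤ n) (hn : n ≤ M.N) :
    ‖u (M.node n) - nodeVal M u₀ U n‖
      ≤ supOn (Ioc (M.node (n - 1)) (M.node n)) (fun t => u t - pval (U n) t) := by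
  have hlt : M.node (n - 1) < M.node n := by
    have := M.node_lt (n - 1) (by omega)
    rwa [Nat.sub_add_cancel hn1] at this
  rw [nodeVal, if_neg (by omega)]
  refine norm_le_supOn (v := fun t => u t - pval (U n) t) ?_ (right_mem_Ioc.mpr hlt)
  obtain ⟨B, hB⟩ := isCompact_Icc.exists_bound_of_continuousOn
    (hu.sub (contDiff_pval (n := 0) (U n)).continuous.continuousOn)
  refine ⟨B, ?_⟩
  rintro _ ⟨t, rfl⟩
  exact hB t ⟨(M.le_node (by omega)).trans t.2.1.le, t.2.2.trans (M.node_le hn)⟩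

/-- Superconvergence at the nodes, for a fixed problem and method. -/
lemma exists_nodal_error {κQ κA d r k : ℕ} (hkr : k ≤ r) {Q : Integrator κQ} {A : ApproxOp κA}
    {f : ℝ → E d → E d} {t₀ T : ℝ} {u₀ : E d} {u : ℝ → E d} (hT : 0 < T) {N m : ℕ}
    (hN : kJ k κQ κA ≤ N) (hkN : k / 2 ≤ N) (hrN : 2 * r + 1 ≤ N)
    (hm : N + 1 + (2 * r + 1) ≤ m)
    (hf : ContDiffOn ℝ m (fun q : ℝ × E d => f q.1 q.2) (dom t₀ T d))
    (hu : SolvesIVP f t₀ T u₀ u) (hS : AssSolvable r k Q) (hQ : AssStabQ d Q)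
    (hA : AssStabA d κQ A) (hL : AssLip (kJ k κQ κA) f t₀ T)
    (hord : (r : ℕ∞) ≤ ordSucc Q A (r - k) + 1) :
    ∃ C > (0 : ℝ), ∃ τ₀ > (0 : ℝ), ∀ M : Mesh t₀ T, M.size ≤ τ₀ →
      ∀ U : ℕ → Fin d → ℝ[X], IsDiscreteSolution r k Q A f M u₀ U → ∀ n, 1 ≤ n → n ≤ M.N →
        ‖u (M.node n) - nodeVal M u₀ U n‖ ≤ C * (powTop M.size (superExp r k Q A)
          + if k = 0 then powTop M.size (2 * ordSucc Q A (r - k) + 2) else 0) := by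
  -- scalar stability bounds come from the vector-valued ones through a coordinate direction, so
  -- `d = 0` is separate
  rcases Nat.eq_zero_or_pos d with rfl | hd
  · refine ⟨1, one_pos, 1, one_pos, fun M _ U _ n _ _ => ?_⟩
    rw [Subsingleton.elim (u (M.node n) - nodeVal M u₀ U n) 0, norm_zero, one_mul]
    have := powTop_nonneg M.size_nonneg (superExp r k Q A)
    have := powTop_nonneg M.size_nonneg (2 * ordSucc Q A (r - k) + 2)
    split_ifs <;> positivity
  have hfle : ∀ n : ℕ, n ≤ m → ContDiffOn ℝ n (fun q : ℝ × E d => f q.1 q.2) (dom t₀ T d) :=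
    fun n hn => hf.of_le (by exact_mod_cast hn)
  obtain ⟨CQ, CA, L, CL, D⟩ := exists_stabData hkr ⟨0, hd⟩ hT (hfle _ (by omega)) hS hQ hA hL
  obtain ⟨K₁, hK₁0, h₀, hh₀, hK₁⟩ := D.exists_apriori hT (hfle _ (by omega))
  -- the orders as natural numbers
  obtain ⟨p, hp⟩ : ∃ p : ℕ, (p : ℕ∞) = superExp r k Q A := by
    have : superExp r k Q A ≠ ⊤ := ne_top_of_le_ne_top (ENat.natCast_ne_top (2 * r - k + 1))
      (min_le_left _ _)
    exact ⟨_, ENat.natCast_toNat this⟩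
  obtain ⟨q, hq⟩ : ∃ q : ℕ, (q : ℕ∞) = min (r : ℕ∞) (ordSucc Q A (r - k)) := by
    have : min (r : ℕ∞) (ordSucc Q A (r - k)) ≠ ⊤ := ne_top_of_le_ne_top (ENat.natCast_ne_top r)
      (min_le_left _ _)
    exact ⟨_, ENat.natCast_toNat this⟩
  have hpr : p ≤ 2 * r + 1 := by
    have h1 : (p : ℕ∞) ≤ ((2 * r - k + 1 : ℕ) : ℕ∞) := hp.trans_le (min_le_left _ _)
    have : p ≤ 2 * r - k + 1 := by exact_mod_cast h1
    omega
  set R₁ : ℝ := Real.exp (K₁ * T) * (‖u₀‖ + 1) with hR₁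
  have hR₁0 : 0 ≤ R₁ := by positivity
  set R : ℝ := R₁ + K₁ * (1 + R₁) with hR
  have hRR : R₁ ≤ R := le_add_of_nonneg_right (by positivity)
  obtain ⟨K, hK0, hK⟩ := D.exists_step_error hkr hT hN hrN hm hf hord hp.le hq hu.2
    (R := R) (by positivity)
  refine ⟨2 * Real.exp (K * T), by positivity, min 1 h₀, lt_min one_pos hh₀,
    fun M hM U hU n _ hn => ?_⟩
  set τ := M.size with hτ
  have hτ0 : 0 ≤ τ := M.size_nonneg
  have hτ1 : τ ≤ 1 := hM.trans (min_le_left _ _)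
  set V := nodeVal M u₀ U with hV
  have hV0 : V 0 = u₀ := by simp [hV, nodeVal]
  have href : ∀ n < M.N, RefSolution r k Q A f t₀ T (M.node n) (M.node (n + 1)) (V n)
      (hatPoly (M.node n) (M.node (n + 1)) (U (n + 1))) := fun n hn => by
    have := hU (n + 1) (by omega) hn
    rw [Nat.add_sub_cancel] at this
    exact this.refSolution (hfle _ (by omega)) (M.le_node hn.le) (M.node_lt n hn) (M.node_le hn)
      ((M.step_le_size hn).trans hτ1)
  have hap := fun n (hn : n < M.N) => hK₁ _ _ _ _ (href n hn)
    ((M.step_le_size hn).trans (hM.trans (min_le_right _ _)))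
  -- the discrete solution stays in a fixed ball, so `f` is only needed on a compact set
  have hVb : ∀ n ≤ M.N, ‖V n‖ ≤ R₁ := by
    intro n hn
    have := M.le_exp_mul hK₁0 (x := fun n => ‖V n‖ + 1) (by positivity) (fun n hn => by
      have h1 := (hap n hn).2
      rw [← nodeVal_succ M u₀ U n] at h1
      have h2 : ‖V (n + 1)‖ ≤ ‖V (n + 1) - V n‖ + ‖V n‖ := by
        simpa using norm_add_le (V (n + 1) - V n) (V n)
      change ‖V (n + 1)‖ + 1 ≤ _
      calc ‖V (n + 1)‖ + 1 ≤ K₁ * (M.node (n + 1) - M.node n) * (1 + ‖V n‖) + ‖V n‖ + 1 := by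
            linarith
        _ = _ := by ring) hn
    simp only [hV0] at this
    linarith
  set X : ℝ := powTop τ (superExp r k Q A)
    + if k = 0 then powTop τ (2 * ordSucc Q A (r - k) + 2) else 0 with hX
  have hXp : powTop τ (superExp r k Q A) = τ ^ p := by
    rw [powTop, ← hp, if_neg (ENat.natCast_ne_top _), ENat.toNat_natCast]
  have hX0 : 0 ≤ X := by
    have := powTop_nonneg hτ0 (superExp r k Q A)
    have := powTop_nonneg hτ0 (2 * ordSucc Q A (r - k) + 2)
    rw [hX]; split_ifs <;> positivity
  have hloc : ∀ n < M.N, (M.node (n + 1) - M.node n) ^ p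
      + (if k = 0 then (M.node (n + 1) - M.node n) ^ (2 * q + 2) else 0) ≤ 2 * X := by
    intro n hn
    have h0 : 0 ≤ M.node (n + 1) - M.node n := sub_nonneg.mpr (M.node_lt n hn).le
    have hle := M.step_le_size hn
    have a1 := pow_le_pow_left₀ h0 hle p
    have a2 := pow_two_mul_add_two_le (p := p) hpr hq h0 hle hτ1
    have a3 : 0 ≤ τ ^ p := by positivity
    have a4 := powTop_nonneg hτ0 (2 * ordSucc Q A (r - k) + 2)
    rw [hX, hXp]
    split_ifs <;> linarith
  -- adding the constant `2 * X` to the error makes the recursion homogeneous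
  have hfin := M.le_exp_mul hK0 (x := fun n => ‖u (M.node n) - V n‖ + 2 * X) (by positivity)
    (fun n hn => by
      have h1 := hK _ _ _ _ (href n hn) ((hVb n hn.le).trans hRR) (fun c i => ((hap n hn).1 c i).trans (by
          have := mul_le_mul_of_nonneg_left (hVb n hn.le) hK₁0
          rw [hR]; linarith))
      rw [← nodeVal_succ M u₀ U n] at h1
      have h0 : 0 ≤ K * (M.node (n + 1) - M.node n) :=
        mul_nonneg hK0 (sub_nonneg.mpr (M.node_lt n hn).le)
      have h2 := h1.trans (mul_le_mul_of_nonneg_left (add_le_add le_rfl (hloc n hn)) h0)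
      have h3 : ‖u (M.node (n + 1)) - V (n + 1)‖
          ≤ ‖(u (M.node (n + 1)) - V (n + 1)) - (u (M.node n) - V n)‖ + ‖u (M.node n) - V n‖ := by
        simpa using norm_add_le ((u (M.node (n + 1)) - V (n + 1)) - (u (M.node n) - V n))
          (u (M.node n) - V n)
      change ‖u (M.node (n + 1)) - V (n + 1)‖ + 2 * X ≤ _
      calc ‖u (M.node (n + 1)) - V (n + 1)‖ + 2 * X
          ≤ K * (M.node (n + 1) - M.node n) * (‖u (M.node n) - V n‖ + 2 * X)
            + ‖u (M.node n) - V n‖ + 2 * X := by linarith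
        _ = _ := by ring) hn
  simp only [hV0, M.node_zero, hu.1, sub_self, norm_zero, zero_add] at hfin
  calc ‖u (M.node n) - V n‖ ≤ ‖u (M.node n) - V n‖ + 2 * X := by linarith
    _ ≤ Real.exp (K * T) * (2 * X) := hfin
    _ = 2 * Real.exp (K * T) * X := by ring

end VTD

theorem mainTheorem4 (r k κQ κA : ℕ) (hkr : k ≤ r) :
    ∃ m : ℕ, ∀ (d : ℕ) (Q : VTD.Integrator κQ) (A : VTD.ApproxOp κA)
      (t₀ T : ℝ) (f : ℝ → VTD.E d → VTD.E d) (u₀ : VTD.E d) (u : ℝ → VTD.E d),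
      0 < T →
      ContDiffOn ℝ m (fun p : ℝ × VTD.E d => f p.1 p.2) (Set.Icc t₀ (t₀ + T) ×ˢ Set.univ) →
      VTD.SolvesIVP f t₀ T u₀ u →
      VTD.AssSolvable r k Q →
      VTD.AssStabQ d Q →
      VTD.AssStabA d κQ A →
      VTD.AssLip (VTD.kJ k κQ κA) f t₀ T →
      (VTD.AssPointA d κQ A ∨ VTD.AssPointB d Q A) →
      -- superconvergence if `r_{r-k} ≥ r - 2`
      ((r : ℕ∞) ≤ VTD.ordSucc Q A (r - k) + 1 →
        ∃ C > (0 : ℝ), ∃ τ₀ > (0 : ℝ), ∀ M : VTD.Mesh t₀ T, M.size ≤ τ₀ →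
          ∀ U : ℕ → Fin d → Polynomial ℝ, VTD.IsDiscreteSolution r k Q A f M u₀ U →
            ∀ n, 1 ≤ n → n ≤ M.N →
              ‖u (M.node n) - VTD.nodeVal M u₀ U n‖ ≤
                C * (VTD.powTop M.size (VTD.superExp r k Q A)
                  + if k = 0 then VTD.powTop M.size (2 * VTD.ordSucc Q A (r - k) + 2) else 0)) ∧
      -- the nodal error is always bounded by the supremum of the error over the mesh interval
      (∀ M : VTD.Mesh t₀ T, ∀ U : ℕ → Fin d → Polynomial ℝ,
        VTD.IsDiscreteSolution r k Q A f M u₀ U → ∀ n, 1 ≤ n → n ≤ M.N →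
          ‖u (M.node n) - VTD.nodeVal M u₀ U n‖ ≤
            VTD.supOn (Set.Ioc (M.node (n - 1)) (M.node n))
              (fun t => u t - VTD.pval (U n) t)) := by
  set N := 2 * r + 1 + k + κQ + κA with hN
  have hkJ : VTD.kJ k κQ κA ≤ N := by rw [VTD.kJ]; omega
  refine ⟨N + 1 + (2 * r + 1), fun d Q A t₀ T f u₀ u hT hf hu hS hQ hA hL _ => ⟨fun hord => ?_,
    fun M U _ n hn1 hn => ?_⟩⟩
  · exact VTD.exists_nodal_error hkr hT hkJ (by omega) (by omega) le_rfl hf hu hS hQ hA hL hord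
  · exact VTD.norm_sub_nodeVal_le_supOn (fun t ht => (hu.2 t ht).continuousWithinAt) M u₀ U hn1 hn
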